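/- Let $(G,K)$ be a compact symmetric pair: $G$ is a compact connected Lie group whose Lie algebra $\mathfrak g$ has negative definite Killing form $B$, $\sigma$ is an involutive automorphism of $G$, and $K$ is a closed subgroup of $G$ with $(G^\sigma)_0\subseteq K\subseteq G^\sigma$. Let $\theta=d\sigma_e$, and let $\mathfrak g=\mathfrak k\oplus\mathfrak p$ be the Cartan decomposition, i.e. the decomposition into the $(+1)$- and $(-1)$-eigenspaces of $\theta$; $\mathfrak k$ is the Lie algebra of $K$, and $\mathfrak p$ carries the inner product $-B|_{\mathfrak p\times\mathfrak p}$. Assume that $(G,K)$ satisfies the maximality property: $K$ is connected and contains no nontrivial normal subgroup of $G$, and $\mathrm{Ad}(K)|_{\mathfrak p}$ is maximal among the connected subgroups of $\mathrm O(\mathfrak p)$ that have the same orbits on $\mathfrak p$ as $\mathrm{Ad}(K)|_{\mathfrak p}$. Let $\mathcal F_{G/K}$ be the foliation of the unit sphere of $\mathfrak p$ by the orbits of $\mathrm{Ad}(K)$. A complex structure on $\mathfrak p$ is an orthogonal, skew-symmetric linear map $J\colon\mathfrak p\to\mathfrak p$; it preserves $\mathcal F_{G/K}$ if for every leaf $L$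 and every $v\in L$ the Hopf circle $\{\cos(t)v+\sin(t)Jv : t\in\mathbb R\}$ is contained in $L$. Let $\mathfrak t$ be a maximal abelian subalgebra of $\mathfrak k$. Then there exists a complex structure on $\mathfrak p$ preserving $\mathcal F_{G/K}$ if and only if $G/K$ is inner, that is, $\theta$ is an inner automorphism of $\mathfrak g$ ($\theta=\mathrm{Ad}(g)$ for some $g\in G$). In this situation, let $T\in\mathfrak t$. Call $\alpha\in(\mathfrak t^{\mathbb C})^*$, $\alpha\ne0$, a root of $\mathfrak g$ if $\mathfrak g_\alpha=\{X\in\mathfrak g^{\mathbb C} : [H,X]=i\,\alpha(H)X \text{ for all } H\in\mathfrak t\}$ is nonzero, and call it noncompact if $\mathfrak g_\alpha\subseteq\mathfrak p^{\mathbb C}$. Then $\mathrm{ad}(T)|_{\mathfrak p}$ is a complex structure on $\mathfrak p$ preserving $\mathcal F_{G/K}$ if and only if $\alpha(T)\in\{1,-1\}$ for all noncompact roots $\alpha$ of $\mathfrak g$; equivalently, for any fixed choice of positive roots, if and only if $\alpha(T)\in\{1,-1\}$ for all positive noncompact roots $\alpha$. -/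

import Mathlib

open scoped Manifold ContDiff TensorProduct
open VectorField

noncomputable section

/-! ### The Lie algebra and the adjoint representation of a Lie group -/

instance leInfty_minSmoothness_three : ENat.LEInfty (minSmoothness ℝ 3) :=
  ⟨by
    rw [minSmoothness_of_isRCLikeNormedField]
    exact ENat.LEInfty.out⟩

section LieGroups

variable {n : ℕ} {G : Type*} [TopologicalSpace G] [ChartedSpace (EuclideanSpace ℝ (Fin n)) G]
  [Group G]

/-- The Lie algebra `𝔤 = T_e G` of an `n`-dimensional Lie group. -/
abbrev LieAlg (n : ℕ) (G : Type*) [TopologicalSpace G]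
    [ChartedSpace (EuclideanSpace ℝ (Fin n)) G] [Group G] : Type :=
  GroupLieAlgebra (𝓡 n) G

/-- The differential at the identity of a group homomorphism `G → G`. The source of the coercion
is `T_{σ(e)} G = T_e G`. -/
def lieDifferential (n : ℕ) {G : Type*} [TopologicalSpace G]
    [ChartedSpace (EuclideanSpace ℝ (Fin n)) G] [Group G] (σ : G →* G) :
    LieAlg n G →L[ℝ] LieAlg n G :=
  mfderiv (𝓡 n) (𝓡 n) σ (1 : G)

/-- The adjoint representation: `Ad g` is the differential at `e` of `x ↦ g x g⁻¹`. -/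
def lieAd (n : ℕ) {G : Type*} [TopologicalSpace G]
    [ChartedSpace (EuclideanSpace ℝ (Fin n)) G] [Group G] (g : G) :
    LieAlg n G →L[ℝ] LieAlg n G :=
  lieDifferential n (MulAut.conj g).toMonoidHom

theorem lieDifferential_comp {σ τ : G →* G}
    (hσ : MDifferentiable (𝓡 n) (𝓡 n) σ) (hτ : MDifferentiable (𝓡 n) (𝓡 n) τ) :
    lieDifferential n (σ.comp τ) = (lieDifferential n σ).comp (lieDifferential n τ) := by
  have h := mfderiv_comp (I := 𝓡 n) (I' := 𝓡 n) (I'' := 𝓡 n) (1 : G) (hσ (τ 1)) (hτ 1)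
  have e : ∀ a : G, a = 1 →
      (mfderiv (𝓡 n) (𝓡 n) σ a : EuclideanSpace ℝ (Fin n) →L[ℝ] EuclideanSpace ℝ (Fin n))
        = mfderiv (𝓡 n) (𝓡 n) σ (1 : G) := by rintro a rfl; rfl
  have h2 := e (τ 1) (map_one τ)
  ext1 x
  have h3 := congrArg (fun f : EuclideanSpace ℝ (Fin n) →L[ℝ] EuclideanSpace ℝ (Fin n) => f x) h
  refine h3.trans ?_
  exact congrArg (fun f : EuclideanSpace ℝ (Fin n) →L[ℝ] EuclideanSpace ℝ (Fin n) =>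
    f (mfderiv (𝓡 n) (𝓡 n) τ (1 : G) x)) h2

theorem lieDifferential_id :
    lieDifferential n (MonoidHom.id G) = ContinuousLinearMap.id ℝ (LieAlg n G) :=
  mfderiv_id

theorem lieAd_one : lieAd n (1 : G) = 1 := by
  have : (MulAut.conj (1 : G)).toMonoidHom = MonoidHom.id G := by ext; simp
  rw [lieAd, this, lieDifferential_id]; rfl

variable [LieGroup (𝓡 n) ∞ G]

theorem mdifferentiable_conj (g : G) :
    MDifferentiable (𝓡 n) (𝓡 n) (MulAut.conj g).toMonoidHom := by
  have h : ContMDiff (𝓡 n) (𝓡 n) ∞ (fun x : G => g * x * g⁻¹) :=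
    (contMDiff_mul_right (a := g⁻¹)).comp (contMDiff_mul_left (a := g))
  exact h.mdifferentiable (by simp)

theorem lieAd_mul (g h : G) : lieAd n (g * h) = lieAd n g * lieAd n h := by
  have : (MulAut.conj (g * h)).toMonoidHom
      = (MulAut.conj g).toMonoidHom.comp (MulAut.conj h).toMonoidHom := by
    ext; simp
  rw [lieAd, this, lieDifferential_comp (mdifferentiable_conj g) (mdifferentiable_conj h)]; rfl

/-- The differential of a smooth involutive automorphism is a Lie algebra homomorphism. -/
theorem lieDifferential_lie {σ : G →* G} (hσ : ContMDiff (𝓡 n) (𝓡 n) ∞ σ)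
    (hinv : ∀ g, σ (σ g) = g) (X Y : LieAlg n G) :
    lieDifferential n σ ⁅X, Y⁆ = ⁅lieDifferential n σ X, lieDifferential n σ Y⁆ := by
  have hd : MDifferentiable (𝓡 n) (𝓡 n) σ := hσ.mdifferentiable (by simp)
  have hss : (σ ∘ σ : G → G) = id := funext hinv
  have hcomp : ∀ g : G, (mfderiv (𝓡 n) (𝓡 n) σ (σ g)).comp (mfderiv (𝓡 n) (𝓡 n) σ g)
      = ContinuousLinearMap.id ℝ (EuclideanSpace ℝ (Fin n)) := by
    intro g
    have h := mfderiv_comp (I := 𝓡 n) (I' := 𝓡 n) (I'' := 𝓡 n) g (hd (σ g)) (hd g)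
    rw [hss, mfderiv_id] at h
    exact h.symm
  have hcomp' : ∀ g : G, ContinuousLinearMap.comp
      (mfderiv (𝓡 n) (𝓡 n) σ g : EuclideanSpace ℝ (Fin n) →L[ℝ] EuclideanSpace ℝ (Fin n))
      (mfderiv (𝓡 n) (𝓡 n) σ (σ g) : EuclideanSpace ℝ (Fin n) →L[ℝ] EuclideanSpace ℝ (Fin n))
      = ContinuousLinearMap.id ℝ (EuclideanSpace ℝ (Fin n)) := by
    intro g
    have e : ∀ a : G, a = g →
        (mfderiv (𝓡 n) (𝓡 n) σ a : EuclideanSpace ℝ (Fin n) →L[ℝ] EuclideanSpace ℝ (Fin n))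
          = mfderiv (𝓡 n) (𝓡 n) σ g := by rintro a rfl; rfl
    rw [← e _ (hinv g)]
    exact hcomp (σ g)
  have hinverse : ∀ g : G, (mfderiv (𝓡 n) (𝓡 n) σ g).inverse = mfderiv (𝓡 n) (𝓡 n) σ (σ g) :=
    fun g => ContinuousLinearMap.inverse_eq (hcomp' g) (hcomp g)
  have hfield : ∀ Z : LieAlg n G,
      mpullback (𝓡 n) (𝓡 n) σ (mulInvariantVectorField (lieDifferential n σ Z))
        = mulInvariantVectorField Z := by
    intro Z
    ext1 g
    have hL : ∀ a : G, MDifferentiable (𝓡 n) (𝓡 n) (fun x : G => a * x) := fun a =>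
      (contMDiff_mul_left (I := 𝓡 n) (n := ∞) (a := a)).mdifferentiable (by simp)
    have h1 := mfderiv_comp (I := 𝓡 n) (I' := 𝓡 n) (I'' := 𝓡 n) (1 : G)
      (hL (σ g) (σ 1)) (hd 1)
    have h2 := mfderiv_comp (I := 𝓡 n) (I' := 𝓡 n) (I'' := 𝓡 n) (1 : G)
      (hd (g * 1)) (hL g 1)
    have h3 : (fun x : G => σ g * x) ∘ σ = σ ∘ (fun x : G => g * x) := by
      funext x; simp
    have e1 : ∀ a : G, a = 1 →
        (mfderiv (𝓡 n) (𝓡 n) (fun x : G => σ g * x) a :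
          EuclideanSpace ℝ (Fin n) →L[ℝ] EuclideanSpace ℝ (Fin n))
          = mfderiv (𝓡 n) (𝓡 n) (fun x : G => σ g * x) (1 : G) := by rintro a rfl; rfl
    have e2 : ∀ a : G, a = g →
        (mfderiv (𝓡 n) (𝓡 n) σ a : EuclideanSpace ℝ (Fin n) →L[ℝ] EuclideanSpace ℝ (Fin n))
          = mfderiv (𝓡 n) (𝓡 n) σ g := by rintro a rfl; rfl
    have key : ContinuousLinearMap.comp
        (mfderiv (𝓡 n) (𝓡 n) (fun x : G => σ g * x) (1 : G) :
          EuclideanSpace ℝ (Fin n) →L[ℝ] EuclideanSpace ℝ (Fin n))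
        (mfderiv (𝓡 n) (𝓡 n) σ (1 : G) :
          EuclideanSpace ℝ (Fin n) →L[ℝ] EuclideanSpace ℝ (Fin n))
        = ContinuousLinearMap.comp
        (mfderiv (𝓡 n) (𝓡 n) σ g :
          EuclideanSpace ℝ (Fin n) →L[ℝ] EuclideanSpace ℝ (Fin n))
        (mfderiv (𝓡 n) (𝓡 n) (fun x : G => g * x) (1 : G) :
          EuclideanSpace ℝ (Fin n) →L[ℝ] EuclideanSpace ℝ (Fin n)) := by
      rw [← e1 _ (map_one σ), ← e2 _ (mul_one g)]
      rw [h3] at h1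
      exact h1.symm.trans h2
    have hk := congrArg
      (fun f : EuclideanSpace ℝ (Fin n) →L[ℝ] EuclideanSpace ℝ (Fin n) => f Z) key
    have hc := congrArg
      (fun f : EuclideanSpace ℝ (Fin n) →L[ℝ] EuclideanSpace ℝ (Fin n) =>
        f (mfderiv (𝓡 n) (𝓡 n) (fun x : G => g * x) (1 : G) Z)) (hcomp g)
    rw [mpullback_apply, hinverse]
    refine Eq.trans ?_ hc
    exact congrArg (fun v : EuclideanSpace ℝ (Fin n) =>
      (mfderiv (𝓡 n) (𝓡 n) σ (σ g) :
        EuclideanSpace ℝ (Fin n) →L[ℝ] EuclideanSpace ℝ (Fin n)) v) hk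
  have hb := mpullback_mlieBracket (I := 𝓡 n) (I' := 𝓡 n) (n := ∞) (f := σ) (x₀ := (1 : G))
    (V := mulInvariantVectorField (lieDifferential n σ X))
    (W := mulInvariantVectorField (lieDifferential n σ Y))
    (mdifferentiableAt_mulInvariantVectorField _) (mdifferentiableAt_mulInvariantVectorField _)
    hσ.contMDiffAt (by rw [minSmoothness_of_isRCLikeNormedField]; exact ENat.LEInfty.out)
  rw [hfield, hfield, mpullback_apply] at hb
  have e3 : ∀ a : G, a = 1 →
      (mlieBracket (𝓡 n) (mulInvariantVectorField (lieDifferential n σ X))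
        (mulInvariantVectorField (lieDifferential n σ Y)) a : EuclideanSpace ℝ (Fin n))
      = mlieBracket (𝓡 n) (mulInvariantVectorField (lieDifferential n σ X))
        (mulInvariantVectorField (lieDifferential n σ Y)) (1 : G) := by rintro a rfl; rfl
  have hI : ∀ v : EuclideanSpace ℝ (Fin n),
      (mfderiv (𝓡 n) (𝓡 n) σ (1 : G) :
        EuclideanSpace ℝ (Fin n) →L[ℝ] EuclideanSpace ℝ (Fin n))
        ((mfderiv (𝓡 n) (𝓡 n) σ (1 : G)).inverse v) = v := by
    intro v
    rw [hinverse]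
    exact congrArg
      (fun f : EuclideanSpace ℝ (Fin n) →L[ℝ] EuclideanSpace ℝ (Fin n) => f v) (hcomp' 1)
  have hb2 := congrArg (fun v : EuclideanSpace ℝ (Fin n) =>
    (mfderiv (𝓡 n) (𝓡 n) σ (1 : G) :
      EuclideanSpace ℝ (Fin n) →L[ℝ] EuclideanSpace ℝ (Fin n)) v) hb
  exact (hb2.symm.trans (hI _)).trans (e3 _ (map_one σ))

end LieGroups

/-! ### Compact symmetric pairs -/

/-- A compact symmetric pair `(G, K)`: a compact connected Lie group `G` whose Killing form is
negative definite, an involutive smooth automorphism `σ` of `G`, and a closed subgroup `K` of `G`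
with `(G^σ)₀ ⊆ K ⊆ G^σ`, where `G^σ` is the group of fixed points of `σ` and `(G^σ)₀` its identity
component. -/
structure CompactSymmetricPair (n : ℕ) (G : Type*) [TopologicalSpace G]
    [ChartedSpace (EuclideanSpace ℝ (Fin n)) G] [Group G] [LieGroup (𝓡 n) ∞ G]
    [T2Space G] [CompactSpace G] [ConnectedSpace G] where
  σ : G →* G
  contMDiff_σ : ContMDiff (𝓡 n) (𝓡 n) ∞ σ
  σ_σ : ∀ g, σ (σ g) = g
  K : Subgroup G
  isClosed_K : IsClosed (K : Set G)
  σ_eq_of_mem_K : ∀ k ∈ K, σ k = k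
  connectedComponent_subset_K : connectedComponentIn {g : G | σ g = g} 1 ⊆ K
  killingForm_neg : ∀ X : LieAlg n G, X ≠ 0 → killingForm ℝ (LieAlg n G) X X < 0

namespace CompactSymmetricPair

variable {n : ℕ} {G : Type*} [TopologicalSpace G]
  [ChartedSpace (EuclideanSpace ℝ (Fin n)) G] [Group G] [LieGroup (𝓡 n) ∞ G]
  [T2Space G] [CompactSpace G] [ConnectedSpace G] (P : CompactSymmetricPair n G)

/-- The Cartan involution `θ` of `𝔤`, the differential of `σ`. -/
def θ : LieAlg n G →L[ℝ] LieAlg n G := lieDifferential n P.σ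

theorem θ_lie (X Y : LieAlg n G) : P.θ ⁅X, Y⁆ = ⁅P.θ X, P.θ Y⁆ :=
  lieDifferential_lie P.contMDiff_σ P.σ_σ X Y

/-- The Lie algebra `𝔨` of `K`, i.e. the `+1`-eigenspace of `θ` (recall that `K` and `G^σ` have
the same identity component). -/
def 𝔨 : LieSubalgebra ℝ (LieAlg n G) where
  carrier := {X | P.θ X = X}
  add_mem' {X Y} hX hY := by
    simp only [Set.mem_ofPred_eq] at hX hY ⊢
    rw [map_add, hX, hY]
  zero_mem' := map_zero P.θ
  smul_mem' c X hX := by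
    simp only [Set.mem_ofPred_eq] at hX ⊢
    rw [map_smul, hX]
  lie_mem' {X Y} hX hY := by
    change P.θ X = X at hX
    change P.θ Y = Y at hY
    change P.θ ⁅X, Y⁆ = ⁅X, Y⁆
    rw [θ_lie, hX, hY]

/-- The `-1`-eigenspace `𝔭` of `θ`, so that `𝔤 = 𝔨 ⊕ 𝔭` is the Cartan decomposition; it is the
orthogonal complement of `𝔨` for the Killing form. -/
def 𝔭 : Submodule ℝ (LieAlg n G) where
  carrier := {X | P.θ X = -X}
  add_mem' {X Y} hX hY := by
    simp only [Set.mem_ofPred_eq] at hX hY ⊢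
    rw [map_add, hX, hY, neg_add]
  zero_mem' := by simp
  smul_mem' c X hX := by
    simp only [Set.mem_ofPred_eq] at hX ⊢
    rw [map_smul, hX, smul_neg]

/-- The inner product `⟨x, y⟩ = -B(x, y)` on `𝔭`, where `B` is the Killing form of `𝔤`. -/
def innerP (x y : P.𝔭) : ℝ := -killingForm ℝ (LieAlg n G) (x : LieAlg n G) (y : LieAlg n G)

theorem lie_mem_𝔭 {T x : LieAlg n G} (hT : T ∈ P.𝔨) (hx : x ∈ P.𝔭) : ⁅T, x⁆ ∈ P.𝔭 := by
  change P.θ T = T at hT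
  change P.θ x = -x at hx
  change P.θ ⁅T, x⁆ = -⁅T, x⁆
  rw [θ_lie, hT, hx, lie_neg]

/-- `ad(T)|_𝔭` for `T ∈ 𝔨`. -/
def adP (T : P.𝔨) : P.𝔭 →ₗ[ℝ] P.𝔭 :=
  (LieAlgebra.ad ℝ (LieAlg n G) (T : LieAlg n G)).restrict
    (fun _ hx => P.lie_mem_𝔭 T.2 hx)

theorem lieAd_mem_𝔭 {k : G} (hk : k ∈ P.K) {x : LieAlg n G} (hx : x ∈ P.𝔭) :
    lieAd n k x ∈ P.𝔭 := by
  have hσ : MDifferentiable (𝓡 n) (𝓡 n) P.σ := P.contMDiff_σ.mdifferentiable (by simp)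
  have h : P.σ.comp (MulAut.conj k).toMonoidHom = (MulAut.conj k).toMonoidHom.comp P.σ := by
    ext g
    simp [P.σ_eq_of_mem_K k hk]
  have h2 := congrArg (lieDifferential n) h
  rw [lieDifferential_comp hσ (mdifferentiable_conj k),
    lieDifferential_comp (mdifferentiable_conj k) hσ] at h2
  have h3 := congrArg (fun f : LieAlg n G →L[ℝ] LieAlg n G => f x) h2
  change P.θ x = -x at hx
  change P.θ (lieAd n k x) = -lieAd n k x
  refine Eq.trans h3 ?_
  change lieAd n k (P.θ x) = _
  rw [hx, map_neg]

/-- The `s`-representation `K → GL(𝔭)`, `k ↦ Ad(k)|_𝔭`. -/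
def sRep : P.K →* (P.𝔭 →L[ℝ] P.𝔭)ˣ :=
  MonoidHom.toHomUnits
    { toFun := fun k => (lieAd n (k : G)).restrict (fun _ hx => P.lieAd_mem_𝔭 k.2 hx)
      map_one' := by
        ext x
        simp [lieAd_one]
      map_mul' := fun a b => by
        ext x
        simp [lieAd_mul] }

/-- The group `Ad(K)|_𝔭`. -/
def adK : Subgroup (P.𝔭 →L[ℝ] P.𝔭)ˣ := P.sRep.range

/-- The orthogonal group `O(𝔭)`. -/
def orthogonalGroup : Subgroup (P.𝔭 →L[ℝ] P.𝔭)ˣ where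
  carrier := {A | ∀ x y, P.innerP (A.val x) (A.val y) = P.innerP x y}
  one_mem' := fun _ _ => rfl
  mul_mem' := fun {A B} hA hB x y => (hA (B.val x) (B.val y)).trans (hB x y)
  inv_mem' := fun {A} hA x y => by
    have h : ∀ z, A.val (A⁻¹.val z) = z := fun z =>
      congrArg (fun f : P.𝔭 →L[ℝ] P.𝔭 => f z) A.mul_inv
    have := hA (A⁻¹.val x) (A⁻¹.val y)
    rw [h, h] at this
    exact this.symm

/-- `(G, K)` is effective: `K` contains no nontrivial normal subgroup of `G`. -/
def IsEffective : Prop := ∀ N : Subgroup G, N.Normal → N ≤ P.K → N = ⊥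

/-- The maximality property: `(G, K)` is effective, `K` is connected, and `Ad(K)|_𝔭` is maximal
among the connected subgroups of `O(𝔭)` with the same orbits on `𝔭` as the `s`-representation. -/
structure MaximalityProperty : Prop where
  effective : P.IsEffective
  connected : IsConnected (P.K : Set G)
  maximal : Maximal (fun H : Subgroup (P.𝔭 →L[ℝ] P.𝔭)ˣ =>
    H ≤ P.orthogonalGroup ∧ IsConnected (H : Set (P.𝔭 →L[ℝ] P.𝔭)ˣ) ∧
      ∀ v : P.𝔭, MulAction.orbit H v = MulAction.orbit P.adK v) P.adK

/-- `G/K` is inner: its involution `θ` is an inner automorphism of `𝔤`, that is, an element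
of `Int(𝔤) = Ad(G)` (recall that `G` is connected). -/
def IsInner : Prop := ∃ g : G, P.θ = lieAd n g

/-! ### Complex structures preserving the orbit foliation -/

/-- A complex structure on `𝔭`: an orthogonal and skew-symmetric transformation. -/
def IsComplexStructure (J : P.𝔭 →ₗ[ℝ] P.𝔭) : Prop :=
  (∀ x y, P.innerP (J x) (J y) = P.innerP x y) ∧ ∀ x y, P.innerP (J x) y = -P.innerP x (J y)

/-- The foliation `F_{G/K}` of the unit sphere of `𝔭`: its leaves are the orbits of the
`s`-representation through unit vectors. -/
def foliation : Set (Set P.𝔭) :=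
  {L | ∃ v : P.𝔭, P.innerP v v = 1 ∧ L = MulAction.orbit P.adK v}

/-- The Hopf circle through `v` determined by `J`. -/
def hopfCircle (J : P.𝔭 →ₗ[ℝ] P.𝔭) (v : P.𝔭) : Set P.𝔭 :=
  Set.range fun t : ℝ => Real.cos t • v + Real.sin t • J v

/-- `J` preserves `F_{G/K}`: the leaves are foliated by the Hopf circles determined by `J`. -/
def PreservesFoliation (J : P.𝔭 →ₗ[ℝ] P.𝔭) : Prop :=
  ∀ L ∈ P.foliation, ∀ v ∈ L, P.hopfCircle J v ⊆ L

/-! ### Roots -/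

/-- `𝔱` is a maximal abelian subalgebra of `𝔨`. -/
def IsMaximalAbelian (𝔱 : LieSubalgebra ℝ (LieAlg n G)) : Prop :=
  Maximal (fun 𝔰 : LieSubalgebra ℝ (LieAlg n G) => 𝔰 ≤ P.𝔨 ∧ IsLieAbelian 𝔰) 𝔱

end CompactSymmetricPair

section Roots

/-- The extension of scalars `A ⊗ V`. -/
abbrev ScalarExtension (R A V : Type*) [CommRing R] [CommRing A] [Algebra R A] [AddCommGroup V]
    [Module R V] : Type _ := A ⊗[R] V

/-- The canonical map `V → A ⊗ V`, `v ↦ 1 ⊗ v`. -/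
abbrev scalarExtensionMk (R A : Type*) {V : Type*} [CommRing R] [CommRing A] [Algebra R A]
    [AddCommGroup V] [Module R V] (v : V) : ScalarExtension R A V := (1 : A) ⊗ₜ[R] v

/-- The complexification `V^ℂ = ℂ ⊗ V` of a real vector space. -/
abbrev Complexification (V : Type*) [AddCommGroup V] [Module ℝ V] : Type _ :=
  ScalarExtension ℝ ℂ V

/-- The canonical inclusion `V → V^ℂ`. -/
abbrev toComplexification {V : Type*} [AddCommGroup V] [Module ℝ V] (v : V) : Complexification V :=
  scalarExtensionMk ℝ ℂ v

variable {L : Type*} [LieRing L] [LieAlgebra ℝ L]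

/-- For `α` in the dual of `𝔱^ℂ`, the space
`𝔤_α = {X ∈ 𝔤^ℂ : [H, X] = i α(H) X for all H ∈ 𝔱}`, where `𝔤 = L`. -/
def complexRootSpace (𝔱 : LieSubalgebra ℝ L) (α : Module.Dual ℂ (Complexification 𝔱)) :
    Submodule ℂ (Complexification L) where
  carrier := {X | ∀ H : 𝔱, ⁅toComplexification (H : L), X⁆
    = (Complex.I * α (toComplexification H)) • X}
  add_mem' {X Y} hX hY H := by rw [lie_add, hX H, hY H, smul_add]
  zero_mem' H := by rw [lie_zero, smul_zero]
  smul_mem' c X hX H := by rw [lie_smul, hX H, smul_comm]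

/-- The set `Δ_𝔤` of roots of `𝔤 = L` with respect to `𝔱`. -/
def complexRoots (𝔱 : LieSubalgebra ℝ L) : Set (Module.Dual ℂ (Complexification 𝔱)) :=
  {α | α ≠ 0 ∧ complexRootSpace 𝔱 α ≠ ⊥}

/-- A set of positive roots: it contains exactly one of `α`, `-α` for each root `α`, and a root that
is a sum of two of its members belongs to it. -/
def IsPositiveSystem (𝔱 : LieSubalgebra ℝ L) (Δp : Set (Module.Dual ℂ (Complexification 𝔱))) : Prop :=
  Δp ⊆ complexRoots 𝔱 ∧ (∀ α ∈ complexRoots 𝔱, Xor (α ∈ Δp) (-α ∈ Δp)) ∧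
    ∀ α ∈ Δp, ∀ β ∈ Δp, α + β ∈ complexRoots 𝔱 → α + β ∈ Δp

end Roots

namespace CompactSymmetricPair

variable {n : ℕ} {G : Type*} [TopologicalSpace G]
  [ChartedSpace (EuclideanSpace ℝ (Fin n)) G] [Group G] [LieGroup (𝓡 n) ∞ G]
  [T2Space G] [CompactSpace G] [ConnectedSpace G] (P : CompactSymmetricPair n G)

/-- A root `α` is noncompact if `𝔤_α ⊆ 𝔭^ℂ`. -/
def IsNoncompactRoot (𝔱 : LieSubalgebra ℝ (LieAlg n G)) (α : Module.Dual ℂ (Complexification 𝔱)) : Prop :=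
  α ∈ complexRoots 𝔱 ∧ complexRootSpace 𝔱 α ≤ P.𝔭.baseChange ℂ

end CompactSymmetricPair

end

/-! Existence implies inner. If $J$ preserves the foliation, the rotations $\cos t+\sin t\,J$
together with $\mathrm{Ad}(K)|_{\mathfrak p}$ generate a connected subgroup of $\mathrm O(\mathfrak
p)$ with the same orbits. Maximality puts the rotations into $\mathrm{Ad}(K)|_{\mathfrak p}$, and
$t=\pi$ gives $k\in K$ with $\mathrm{Ad}(k)|_{\mathfrak p}=-1$. By effectiveness $\mathfrak k$ acts
faithfully on $\mathfrak p$ (`eq_zero_of_isEffective`), so $\mathrm{Ad}(k)$ fixes $\mathfrak k$ and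
equals $\theta$ (`isInner_of_complexStructure`).

Inner implies existence. Every $\mathrm{Ad}(g)$ is $e^{\mathrm{ad}\,Y}$ (`exists_modelAd_eq_exp`).
As $\theta$ fixes $\mathfrak t$, its logarithm can be chosen to commute with $\mathfrak t$
(`exists_log_commuting`); it is fixed by $\theta$, so by maximality it lies in $\mathfrak t$. Let
$X\in\mathfrak t$ be a shortest logarithm of $\theta$. On a noncompact root space
$e^{\mathrm{ad}X}=-1$, so $\alpha(X)$ is an odd multiple of $\pi$. Shifting $X$ along the
$\mathfrak{so}(3)$ belonging to $\alpha$ does not change the exponential, so minimality gives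
$|\alpha(X)|\le2\pi$ (`abs_le_two_pi`). Hence $\alpha(X)=\pm\pi$, and $T=X/\pi$ takes the values
$\pm1$.

Criterion. For $T\in\mathfrak t$, $\mathrm{ad}(T)|_{\mathfrak p}$ is skew, and it is a complex
structure exactly when its square is $-1$. On the real and imaginary parts of an $\alpha$-root
vector the square is $-\alpha(T)^2$, and when $\theta$ is inner $\mathfrak p^{\mathbb C}$ is made of
noncompact root spaces (`lie_lie_eq_neg`). Such a structure preserves the foliation automatically:
its rotations are $e^{t\,\mathrm{ad}T}|_{\mathfrak p}$, which come from $K$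
(`preservesFoliation_adP`).

The Lie theory used is derived in a chart at the identity: the differential of $\mathrm{Ad}$ is the
bracket, and small exponentials $e^{t\,\mathrm{ad}Z}$ lift to $G$. Analysis takes place on the model
space, where the norm lives. -/

/-! ### The differential of the adjoint representation is the bracket. -/

section ChartCalculus

open Filter Topology

variable {n : ℕ} {G : Type*} [TopologicalSpace G] [ChartedSpace (EuclideanSpace ℝ (Fin n)) G]
  [Group G]

/-- The preferred chart at the identity, as a map `G → E`. -/
noncomputable abbrev chartOne (n : ℕ) (G : Type*) [TopologicalSpace G]
    [ChartedSpace (EuclideanSpace ℝ (Fin n)) G] [Group G] :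
    PartialEquiv G (EuclideanSpace ℝ (Fin n)) := extChartAt (𝓡 n) (1 : G)

theorem chartOne_symm_apply_self : (chartOne n G).symm (chartOne n G 1) = 1 :=
  extChartAt_to_inv (I := 𝓡 n) (1 : G)

/-- The multiplication read in the chart at the identity. -/
noncomputable def chartMul (n : ℕ) (G : Type*) [TopologicalSpace G]
    [ChartedSpace (EuclideanSpace ℝ (Fin n)) G] [Group G]
    (p : EuclideanSpace ℝ (Fin n) × EuclideanSpace ℝ (Fin n)) : EuclideanSpace ℝ (Fin n) :=
  chartOne n G ((chartOne n G).symm p.1 * (chartOne n G).symm p.2)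

/-- The conjugation read in the chart at the identity. -/
noncomputable def chartConj (n : ℕ) (G : Type*) [TopologicalSpace G]
    [ChartedSpace (EuclideanSpace ℝ (Fin n)) G] [Group G]
    (p : EuclideanSpace ℝ (Fin n) × EuclideanSpace ℝ (Fin n)) : EuclideanSpace ℝ (Fin n) :=
  chartOne n G ((chartOne n G).symm p.1 * (chartOne n G).symm p.2 * ((chartOne n G).symm p.1)⁻¹)

/-- The adjoint action, as an operator on the model space. -/
noncomputable def modelAd (n : ℕ) {G : Type*} [TopologicalSpace G]
    [ChartedSpace (EuclideanSpace ℝ (Fin n)) G] [Group G] (g : G) :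
    EuclideanSpace ℝ (Fin n) →L[ℝ] EuclideanSpace ℝ (Fin n) := lieAd n g

theorem mfderiv_one_eq_fderiv {f : G → G} (h1 : f 1 = 1) (hf : MDifferentiableAt (𝓡 n) (𝓡 n) f 1) :
    (mfderiv (𝓡 n) (𝓡 n) f (1 : G) : EuclideanSpace ℝ (Fin n) →L[ℝ] EuclideanSpace ℝ (Fin n))
      = fderiv ℝ (fun x => chartOne n G (f ((chartOne n G).symm x))) (chartOne n G 1) := by
  obtain ⟨f', hf'⟩ : ∃ f' : EuclideanSpace ℝ (Fin n) →L[ℝ] EuclideanSpace ℝ (Fin n),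
    mfderiv (𝓡 n) (𝓡 n) f (1 : G) = f' := ⟨_, rfl⟩
  have h : HasFDerivWithinAt (fun x => chartOne n G (f ((chartOne n G).symm x))) f'
      Set.univ (chartOne n G 1) := by
    rw [← hf']
    have h := hf.hasMFDerivAt.2
    simp only [writtenInExtChartAt, h1, modelWithCornersSelf_coe, Set.range_id] at h
    exact h
  exact hf'.trans (hasFDerivWithinAt_univ.1 h).fderiv.symm

theorem chartMul_right_one {x : EuclideanSpace ℝ (Fin n)} (hx : x ∈ (chartOne n G).target) :
    chartMul n G (x, chartOne n G 1) = x := by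
  rw [chartMul, chartOne_symm_apply_self, mul_one, PartialEquiv.right_inv _ hx]

theorem chartMul_left_one {x : EuclideanSpace ℝ (Fin n)} (hx : x ∈ (chartOne n G).target) :
    chartMul n G (chartOne n G 1, x) = x := by
  rw [chartMul, chartOne_symm_apply_self, one_mul, PartialEquiv.right_inv _ hx]

/-- The tangent space at `1` is identified with the model space by this same chart, so the
derivative of the chart there is the identity. This removes the outer derivative from the definition
of the bracket. -/
theorem mfderiv_chartOne_inverse_apply (v : EuclideanSpace ℝ (Fin n)) :
    ((mfderiv (𝓡 n) 𝓘(ℝ, EuclideanSpace ℝ (Fin n)) (chartOne n G) (1 : G)).inverse v :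
      EuclideanSpace ℝ (Fin n)) = v := by
  obtain ⟨f', hf'⟩ : ∃ f' : EuclideanSpace ℝ (Fin n) →L[ℝ] EuclideanSpace ℝ (Fin n),
    mfderiv (𝓡 n) 𝓘(ℝ, EuclideanSpace ℝ (Fin n)) (chartOne n G) (1 : G) = f' := ⟨_, rfl⟩
  have hd : HasFDerivWithinAt (id ∘ chartOne n G ∘ (chartOne n G).symm) f' Set.univ
      (chartOne n G 1) := by
    rw [← hf']
    have hd := (contMDiffAt_extChartAt (I := 𝓡 n) (n := 1) (x := (1 : G))).mdifferentiableAt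
      (by simp) |>.hasMFDerivAt.2
    simp only [writtenInExtChartAt, modelWithCornersSelf_coe, Set.range_id,
      extChartAt_model_space_eq_id, PartialEquiv.refl_coe] at hd
    exact hd
  have hid : HasFDerivAt (id ∘ chartOne n G ∘ (chartOne n G).symm)
      (ContinuousLinearMap.id ℝ (EuclideanSpace ℝ (Fin n))) (chartOne n G 1) := by
    refine (hasFDerivAt_id _).congr_of_eventuallyEq ?_
    filter_upwards [extChartAt_target_mem_nhds (I := 𝓡 n) (1 : G)] with x hx
    exact (chartOne n G).right_inv hx
  have h := hf'.trans ((hasFDerivWithinAt_univ.1 hd).unique hid)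
  have h2 : (mfderiv (𝓡 n) 𝓘(ℝ, EuclideanSpace ℝ (Fin n)) (chartOne n G) (1 : G)).inverse
      = ContinuousLinearMap.id ℝ (EuclideanSpace ℝ (Fin n)) := by
    refine Eq.trans ?_ (ContinuousLinearMap.inverse_id (R := ℝ) (M := EuclideanSpace ℝ (Fin n)))
    exact congrArg (ContinuousLinearMap.inverse (R := ℝ) (M := EuclideanSpace ℝ (Fin n))
      (M₂ := EuclideanSpace ℝ (Fin n))) h
  exact congrArg (fun f : EuclideanSpace ℝ (Fin n) →L[ℝ] EuclideanSpace ℝ (Fin n) => f v) h2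

/-- The Lie bracket of the Lie algebra of `G`, as an operation on the model space. -/
noncomputable def modelLie (n : ℕ) (G : Type*) [TopologicalSpace G]
    [ChartedSpace (EuclideanSpace ℝ (Fin n)) G] [Group G] (T X : EuclideanSpace ℝ (Fin n)) :
    EuclideanSpace ℝ (Fin n) :=
  Bracket.bracket (L := LieAlg n G) (M := LieAlg n G) T X

theorem modelLie_eq_lieBracketWithin (T X : LieAlg n G) :
    modelLie n G T X = lieBracketWithin ℝ
      (mpullbackWithin 𝓘(ℝ, EuclideanSpace ℝ (Fin n)) (𝓡 n) (chartOne n G).symm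
        (mulInvariantVectorField T) (Set.range (𝓡 n)))
      (mpullbackWithin 𝓘(ℝ, EuclideanSpace ℝ (Fin n)) (𝓡 n) (chartOne n G).symm
        (mulInvariantVectorField X) (Set.range (𝓡 n))) (Set.range (𝓡 n)) (chartOne n G 1) := by
  change (⁅T, X⁆ : LieAlg n G) = _
  rw [GroupLieAlgebra.bracket_def, mlieBracket, mlieBracketWithin_apply,
    Set.preimage_univ, Set.univ_inter]
  exact mfderiv_chartOne_inverse_apply (n := n) (G := G) _

variable [LieGroup (𝓡 n) ∞ G]

theorem contMDiffAt_chartOne_symm :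
    ContMDiffAt (𝓡 n) (𝓡 n) ∞ (chartOne n G).symm (chartOne n G 1) :=
  (contMDiffOn_extChartAt_symm (I := 𝓡 n) (n := ∞) (1 : G)).contMDiffAt
    (extChartAt_target_mem_nhds (I := 𝓡 n) (1 : G))

theorem contDiffAt_chartMul :
    ContDiffAt ℝ ∞ (chartMul n G) (chartOne n G 1, chartOne n G 1) := by
  have hs := contMDiffAt_chartOne_symm (n := n) (G := G)
  have h1 : ContMDiffAt 𝓘(ℝ, EuclideanSpace ℝ (Fin n) × EuclideanSpace ℝ (Fin n)) (𝓡 n) ∞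
      (fun p : EuclideanSpace ℝ (Fin n) × EuclideanSpace ℝ (Fin n) =>
        (chartOne n G).symm p.1) (chartOne n G 1, chartOne n G 1) :=
    ContMDiffAt.comp (I' := 𝓡 n) (chartOne n G 1, chartOne n G 1) hs
      contDiff_fst.contDiffAt.contMDiffAt
  have h2 : ContMDiffAt 𝓘(ℝ, EuclideanSpace ℝ (Fin n) × EuclideanSpace ℝ (Fin n)) (𝓡 n) ∞
      (fun p : EuclideanSpace ℝ (Fin n) × EuclideanSpace ℝ (Fin n) =>
        (chartOne n G).symm p.2) (chartOne n G 1, chartOne n G 1) :=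
    ContMDiffAt.comp (I' := 𝓡 n) (chartOne n G 1, chartOne n G 1) hs
      contDiff_snd.contDiffAt.contMDiffAt
  have h3 := h1.mul h2
  have h4 : ContMDiffAt (𝓡 n) 𝓘(ℝ, EuclideanSpace ℝ (Fin n)) ∞ (chartOne n G)
      ((chartOne n G).symm (chartOne n G 1) * (chartOne n G).symm (chartOne n G 1)) := by
    rw [chartOne_symm_apply_self, mul_one]
    exact contMDiffAt_extChartAt
  exact (ContMDiffAt.comp (chartOne n G 1, chartOne n G 1) h4 h3).contDiffAt

theorem contDiffAt_chartConj :
    ContDiffAt ℝ ∞ (chartConj n G) (chartOne n G 1, chartOne n G 1) := by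
  have hs := contMDiffAt_chartOne_symm (n := n) (G := G)
  have h1 : ContMDiffAt 𝓘(ℝ, EuclideanSpace ℝ (Fin n) × EuclideanSpace ℝ (Fin n)) (𝓡 n) ∞
      (fun p : EuclideanSpace ℝ (Fin n) × EuclideanSpace ℝ (Fin n) =>
        (chartOne n G).symm p.1) (chartOne n G 1, chartOne n G 1) :=
    ContMDiffAt.comp (I' := 𝓡 n) (chartOne n G 1, chartOne n G 1) hs
      contDiff_fst.contDiffAt.contMDiffAt
  have h2 : ContMDiffAt 𝓘(ℝ, EuclideanSpace ℝ (Fin n) × EuclideanSpace ℝ (Fin n)) (𝓡 n) ∞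
      (fun p : EuclideanSpace ℝ (Fin n) × EuclideanSpace ℝ (Fin n) =>
        (chartOne n G).symm p.2) (chartOne n G 1, chartOne n G 1) :=
    ContMDiffAt.comp (I' := 𝓡 n) (chartOne n G 1, chartOne n G 1) hs
      contDiff_snd.contDiffAt.contMDiffAt
  have h3 := (h1.mul h2).mul h1.inv
  have h4 : ContMDiffAt (𝓡 n) 𝓘(ℝ, EuclideanSpace ℝ (Fin n)) ∞ (chartOne n G)
      ((chartOne n G).symm (chartOne n G 1) * (chartOne n G).symm (chartOne n G 1) *
        ((chartOne n G).symm (chartOne n G 1))⁻¹) := by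
    rw [chartOne_symm_apply_self, mul_one, inv_one, mul_one]
    exact contMDiffAt_extChartAt
  exact (ContMDiffAt.comp (chartOne n G 1, chartOne n G 1) h4 h3).contDiffAt

theorem modelAd_eq_fderiv (x : EuclideanSpace ℝ (Fin n)) :
    modelAd n ((chartOne n G).symm x)
      = fderiv ℝ (fun y => chartConj n G (x, y)) (chartOne n G 1) := by
  refine mfderiv_one_eq_fderiv ?_ ?_
  · simp
  · exact mdifferentiable_conj _ _

theorem eventually_modelAd_eq : ∀ᶠ x in 𝓝 (chartOne n G 1),
    modelAd n ((chartOne n G).symm x) = (fderiv ℝ (chartConj n G) (x, chartOne n G 1)).comp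
      (ContinuousLinearMap.inr ℝ _ _) := by
  have hc := contDiffAt_chartConj (n := n) (G := G)
  have h1 : ∀ᶠ p in 𝓝 (chartOne n G 1, chartOne n G 1), DifferentiableAt ℝ (chartConj n G) p := by
    have := (hc.of_le (m := 1) (by exact_mod_cast le_top)).eventually (by simp)
    exact this.mono fun p hp => hp.differentiableAt (by simp)
  have h2 : Tendsto (fun x : EuclideanSpace ℝ (Fin n) => (x, chartOne n G 1))
      (𝓝 (chartOne n G 1)) (𝓝 (chartOne n G 1, chartOne n G 1)) :=
    (Continuous.prodMk_left _).tendsto _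
  filter_upwards [h2.eventually h1] with x hx
  rw [modelAd_eq_fderiv]
  exact (hx.hasFDerivAt.comp (chartOne n G 1) (hasFDerivAt_prodMk_right x _)).fderiv

theorem eventually_differentiableAt_chartMul :
    ∀ᶠ p in 𝓝 (chartOne n G 1, chartOne n G 1), DifferentiableAt ℝ (chartMul n G) p := by
  have := ((contDiffAt_chartMul (n := n) (G := G)).of_le (m := 1)
    (by exact_mod_cast le_top)).eventually (by simp)
  exact this.mono fun p hp => hp.differentiableAt (by simp)

theorem fderiv_chartMul_inr :
    (fderiv ℝ (chartMul n G) (chartOne n G 1, chartOne n G 1)).comp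
      (ContinuousLinearMap.inr ℝ _ _) = ContinuousLinearMap.id ℝ _ := by
  have h1 := (contDiffAt_chartMul (n := n) (G := G)).differentiableAt (by simp)
  have h2 := (h1.hasFDerivAt.comp (chartOne n G 1)
    (hasFDerivAt_prodMk_right (chartOne n G 1) (chartOne n G 1)))
  refine h2.unique ((hasFDerivAt_id _).congr_of_eventuallyEq ?_)
  filter_upwards [extChartAt_target_mem_nhds (I := 𝓡 n) (1 : G)] with x hx
  exact chartMul_left_one hx

theorem fderiv_chartMul_inl :
    (fderiv ℝ (chartMul n G) (chartOne n G 1, chartOne n G 1)).comp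
      (ContinuousLinearMap.inl ℝ _ _) = ContinuousLinearMap.id ℝ _ := by
  have h1 := (contDiffAt_chartMul (n := n) (G := G)).differentiableAt (by simp)
  have h2 := (h1.hasFDerivAt.comp (f := fun z => (z, chartOne n G 1)) (chartOne n G 1)
    (hasFDerivAt_prodMk_left (chartOne n G 1) (chartOne n G 1)))
  refine h2.unique ((hasFDerivAt_id _).congr_of_eventuallyEq ?_)
  filter_upwards [extChartAt_target_mem_nhds (I := 𝓡 n) (1 : G)] with x hx
  exact chartMul_right_one hx

/-- The derivatives of the right and left translations, read in the chart at the identity, are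
intertwined by the adjoint action. -/
theorem eventually_fderiv_chartMul_comp_modelAd : ∀ᶠ x in 𝓝 (chartOne n G 1),
    ((fderiv ℝ (chartMul n G) (chartOne n G 1, x)).comp (ContinuousLinearMap.inl ℝ _ _)).comp
      (modelAd n ((chartOne n G).symm x)) =
    (fderiv ℝ (chartMul n G) (x, chartOne n G 1)).comp (ContinuousLinearMap.inr ℝ _ _) := by
  have hG : IsTopologicalGroup G := topologicalGroup_of_lieGroup (𝓡 n) ∞
  have hs := (contMDiffAt_chartOne_symm (n := n) (G := G)).continuousAt
  have hsrc : ∀ᶠ p : EuclideanSpace ℝ (Fin n) × EuclideanSpace ℝ (Fin n) in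
      𝓝 (chartOne n G 1, chartOne n G 1),
      (chartOne n G).symm p.1 * (chartOne n G).symm p.2 * ((chartOne n G).symm p.1)⁻¹
        ∈ (chartOne n G).source := by
    have h1 : ContinuousAt (fun p : EuclideanSpace ℝ (Fin n) × EuclideanSpace ℝ (Fin n) =>
        (chartOne n G).symm p.1) (chartOne n G 1, chartOne n G 1) :=
      ContinuousAt.comp (f := Prod.fst) hs continuousAt_fst
    have h2 : ContinuousAt (fun p : EuclideanSpace ℝ (Fin n) × EuclideanSpace ℝ (Fin n) =>
        (chartOne n G).symm p.2) (chartOne n G 1, chartOne n G 1) :=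
      ContinuousAt.comp (f := Prod.snd) hs continuousAt_snd
    refine ((h1.mul h2).mul h1.inv).eventually_mem ?_
    simp only [Pi.mul_apply, Pi.inv_apply]
    rw [chartOne_symm_apply_self, mul_one, inv_one, mul_one]
    exact extChartAt_source_mem_nhds (I := 𝓡 n) (1 : G)
  have hconj : ∀ᶠ p in 𝓝 (chartOne n G 1, chartOne n G 1), DifferentiableAt ℝ (chartConj n G) p := by
    have := ((contDiffAt_chartConj (n := n) (G := G)).of_le (m := 1)
      (by exact_mod_cast le_top)).eventually (by simp)
    exact this.mono fun p hp => hp.differentiableAt (by simp)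
  have hl : Tendsto (fun x : EuclideanSpace ℝ (Fin n) => (x, chartOne n G 1))
      (𝓝 (chartOne n G 1)) (𝓝 (chartOne n G 1, chartOne n G 1)) :=
    (Continuous.prodMk_left _).tendsto _
  have hr : Tendsto (fun x : EuclideanSpace ℝ (Fin n) => (chartOne n G 1, x))
      (𝓝 (chartOne n G 1)) (𝓝 (chartOne n G 1, chartOne n G 1)) :=
    (Continuous.prodMk_right _).tendsto _
  filter_upwards [hsrc.curry_nhds, hl.eventually hconj, hl.eventually
    eventually_differentiableAt_chartMul, hr.eventually eventually_differentiableAt_chartMul]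
    with x hx1 hx2 hx3 hx4
  have hc1 : chartConj n G (x, chartOne n G 1) = chartOne n G 1 := by
    rw [chartConj, chartOne_symm_apply_self, mul_one, mul_inv_cancel]
  have hA : HasFDerivAt (fun y => chartConj n G (x, y)) (modelAd n ((chartOne n G).symm x))
      (chartOne n G 1) := by
    rw [modelAd_eq_fderiv]
    exact (hx2.hasFDerivAt.comp (chartOne n G 1)
      (hasFDerivAt_prodMk_right x _)).differentiableAt.hasFDerivAt
  have hR : HasFDerivAt (fun z => chartMul n G (z, x))
      ((fderiv ℝ (chartMul n G) (chartOne n G 1, x)).comp (ContinuousLinearMap.inl ℝ _ _))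
      (chartConj n G (x, chartOne n G 1)) := by
    rw [hc1]
    exact hx4.hasFDerivAt.comp (f := fun z => (z, x)) _ (hasFDerivAt_prodMk_left _ x)
  have hL : HasFDerivAt (fun z => chartMul n G (x, z))
      ((fderiv ℝ (chartMul n G) (x, chartOne n G 1)).comp (ContinuousLinearMap.inr ℝ _ _))
      (chartOne n G 1) := hx3.hasFDerivAt.comp _ (hasFDerivAt_prodMk_right x _)
  -- The identity being differentiated in $y$ at $1$ is $(xyx^{-1})\,x=xy$.
  refine (hR.comp (f := fun y => chartConj n G (x, y)) _ hA).unique (hL.congr_of_eventuallyEq ?_)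
  filter_upwards [hx1] with y hy
  simp only [Function.comp_apply, chartMul, chartConj]
  rw [PartialEquiv.left_inv _ hy, inv_mul_cancel_right]

/-- A left-invariant vector field, read in the chart at the identity. -/
theorem eventually_mpullback_mulInvariantVectorField (X : LieAlg n G) :
    ∀ᶠ x in 𝓝 (chartOne n G 1),
      (mpullbackWithin 𝓘(ℝ, EuclideanSpace ℝ (Fin n)) (𝓡 n) (chartOne n G).symm
        (mulInvariantVectorField X) (Set.range (𝓡 n)) x : EuclideanSpace ℝ (Fin n)) =
      fderiv ℝ (chartMul n G) (x, chartOne n G 1) (0, X) := by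
  have hl : Tendsto (fun x : EuclideanSpace ℝ (Fin n) => (x, chartOne n G 1))
      (𝓝 (chartOne n G 1)) (𝓝 (chartOne n G 1, chartOne n G 1)) :=
    (Continuous.prodMk_left _).tendsto _
  filter_upwards [extChartAt_target_mem_nhds (I := 𝓡 n) (1 : G),
    hl.eventually eventually_differentiableAt_chartMul] with x hx hx3
  have hI : IsManifold (𝓡 n) 1 G := IsManifold.of_le (n := ∞) (by simp)
  have hinv := ContinuousLinearMap.inverse_eq
    (mfderivWithin_extChartAt_symm_comp_mfderiv_extChartAt (I := 𝓡 n) hx)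
    (mfderiv_extChartAt_comp_mfderivWithin_extChartAt_symm (I := 𝓡 n) hx)
  rw [mpullbackWithin_apply]
  refine (congrArg (fun f : TangentSpace (𝓡 n) ((chartOne n G).symm x) →L[ℝ]
    EuclideanSpace ℝ (Fin n) => f (mulInvariantVectorField X ((chartOne n G).symm x))) hinv).trans ?_
  have hL : HasFDerivAt (fun z => chartMul n G (x, z))
      ((fderiv ℝ (chartMul n G) (x, chartOne n G 1)).comp (ContinuousLinearMap.inr ℝ _ _))
      (chartOne n G 1) := hx3.hasFDerivAt.comp _ (hasFDerivAt_prodMk_right x _)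
  have hmul : MDifferentiable (𝓡 n) (𝓡 n) (fun y : G => (chartOne n G).symm x * y) :=
    (contMDiff_mul_left (I := 𝓡 n) (n := ∞)).mdifferentiable (by simp)
  have hch : MDifferentiableAt (𝓡 n) 𝓘(ℝ, EuclideanSpace ℝ (Fin n)) (chartOne n G)
      ((chartOne n G).symm x * 1) := by
    rw [mul_one]
    refine (contMDiffAt_extChartAt' (I := 𝓡 n) (n := 1) ?_).mdifferentiableAt (by simp)
    rw [← extChartAt_source (𝓡 n)]
    exact (chartOne n G).map_target hx
  have hcomp := (mfderiv_comp (I := 𝓡 n) (I' := 𝓡 n)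
    (I'' := 𝓘(ℝ, EuclideanSpace ℝ (Fin n))) (1 : G) hch (hmul 1))
  obtain ⟨f', hf'⟩ : ∃ f' : EuclideanSpace ℝ (Fin n) →L[ℝ] EuclideanSpace ℝ (Fin n),
    mfderiv (𝓡 n) 𝓘(ℝ, EuclideanSpace ℝ (Fin n))
      (chartOne n G ∘ fun y : G => (chartOne n G).symm x * y) (1 : G) = f' := ⟨_, rfl⟩
  have hd : HasFDerivWithinAt (fun z => chartMul n G (x, z)) f' Set.univ (chartOne n G 1) := by
    rw [← hf']
    have hd := (hch.comp (1 : G) (hmul 1)).hasMFDerivAt.2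
    simp only [writtenInExtChartAt, modelWithCornersSelf_coe, Set.range_id,
      extChartAt_model_space_eq_id, PartialEquiv.refl_coe] at hd
    exact hd
  have hd' := (hasFDerivWithinAt_univ.1 hd).unique hL
  -- The base points $x\cdot1$ and $x$ are only propositionally equal, so the derivatives are
  -- compared as operators on the model space.
  have e1 : ∀ a : G, a = (chartOne n G).symm x →
      (mfderiv (𝓡 n) 𝓘(ℝ, EuclideanSpace ℝ (Fin n)) (chartOne n G) a :
        EuclideanSpace ℝ (Fin n) →L[ℝ] EuclideanSpace ℝ (Fin n)) =
      mfderiv (𝓡 n) 𝓘(ℝ, EuclideanSpace ℝ (Fin n)) (chartOne n G) ((chartOne n G).symm x) := by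
    rintro a rfl; rfl
  have e2 := (hcomp.symm.trans hf').trans hd'
  have e3 := congrArg (fun f : EuclideanSpace ℝ (Fin n) →L[ℝ] EuclideanSpace ℝ (Fin n) => f X) e2
  refine Eq.trans ?_ e3
  exact (congrArg (fun f : EuclideanSpace ℝ (Fin n) →L[ℝ] EuclideanSpace ℝ (Fin n) =>
    f (mfderiv (𝓡 n) (𝓡 n) (fun y : G => (chartOne n G).symm x * y) 1 X)) (e1 _ (mul_one _))).symm

/-- The derivative of the adjoint representation at the identity is the Lie bracket. -/
theorem exists_hasStrictFDerivAt_modelAd :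
    ∃ A' : EuclideanSpace ℝ (Fin n) →L[ℝ] EuclideanSpace ℝ (Fin n) →L[ℝ] EuclideanSpace ℝ (Fin n),
      HasStrictFDerivAt (fun x => modelAd n ((chartOne n G).symm x)) A' (chartOne n G 1) ∧
      ∀ T X, A' T X = modelLie n G T X := by
  set e := chartOne n G 1 with he
  have hm := contDiffAt_chartMul (n := n) (G := G)
  have hc := contDiffAt_chartConj (n := n) (G := G)
  have hl : ContDiffAt ℝ 1 (fun x : EuclideanSpace ℝ (Fin n) => (x, e)) e := by fun_prop
  have hA : ContDiffAt ℝ 1 (fun x => modelAd n ((chartOne n G).symm x)) e := by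
    have h1 : ContDiffAt ℝ 1 (fderiv ℝ (chartConj n G)) (e, e) :=
      hc.fderiv_right (m := 1)
        (by rw [one_add_one_eq_two]; exact ENat.LEInfty.out)
    have h2 : ContDiffAt ℝ 1 (fun x => (fderiv ℝ (chartConj n G) (x, e)).comp
        (ContinuousLinearMap.inr ℝ _ _)) e :=
      (ContDiffAt.comp (f := fun x : EuclideanSpace ℝ (Fin n) => (x, e)) e h1 hl).clm_comp
        contDiffAt_const
    exact h2.congr_of_eventuallyEq eventually_modelAd_eq
  refine ⟨_, hA.hasStrictFDerivAt (by simp), fun T X => ?_⟩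
  have hA' := (hA.differentiableAt (by simp)).hasFDerivAt
  have h1 : ContDiffAt ℝ 1 (fderiv ℝ (chartMul n G)) (e, e) :=
      hm.fderiv_right (m := 1)
        (by rw [one_add_one_eq_two]; exact ENat.LEInfty.out)
  set D := fderiv ℝ (fderiv ℝ (chartMul n G)) (e, e) with hD
  have hD' : HasFDerivAt (fderiv ℝ (chartMul n G)) D (e, e) :=
    (h1.differentiableAt (by simp)).hasFDerivAt
  have hsymm : ∀ p q, D p q = D q p := by
    have : IsSymmSndFDerivAt ℝ (chartMul n G) (e, e) :=
      (hm.of_le (m := 2) ENat.LEInfty.out).isSymmSndFDerivAt (by simp)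
    exact fun p q => this p q
  have hℓ := hD'.comp (f := fun z => (z, e)) e (hasFDerivAt_prodMk_left e e)
  have hr := hD'.comp (f := fun z => (e, z)) e (hasFDerivAt_prodMk_right e e)
  have hℓY : ∀ Y, fderiv ℝ (fun x => fderiv ℝ (chartMul n G) (x, e) (0, Y)) e =
      (D.comp (ContinuousLinearMap.inl ℝ _ _)).flip (0, Y) := fun Y => by
    have := (hℓ.clm_apply (hasFDerivAt_const ((0, Y) : EuclideanSpace ℝ (Fin n) × _) e)).fderiv
    simpa using this
  -- the derivative of the relation between the translations
  have hrel : D (0, T) (X, 0) + fderiv ℝ (fun x => modelAd n ((chartOne n G).symm x)) e T X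
      = D (T, 0) (0, X) := by
    have hX := hA'.clm_apply (hasFDerivAt_const X e)
    have hpair : HasFDerivAt (fun x => ((modelAd n ((chartOne n G).symm x) X, 0) :
        EuclideanSpace ℝ (Fin n) × EuclideanSpace ℝ (Fin n))) _ e :=
      hX.prodMk (hasFDerivAt_const 0 e)
    have hlhs := hr.clm_apply hpair
    have hrhs := hℓ.clm_apply (hasFDerivAt_const ((0, X) : EuclideanSpace ℝ (Fin n) × _) e)
    have heq := hlhs.unique (hrhs.congr_of_eventuallyEq ?_)
    · have h0 := congrArg (fun f : EuclideanSpace ℝ (Fin n) →L[ℝ] EuclideanSpace ℝ (Fin n) => f T) heq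
      have hone : modelAd n ((chartOne n G).symm e) X = X := by
        rw [he, chartOne_symm_apply_self]
        exact congrArg (fun f : EuclideanSpace ℝ (Fin n) →L[ℝ] EuclideanSpace ℝ (Fin n) => f X)
          (lieAd_one (n := n) (G := G))
      have hinl : ∀ v, fderiv ℝ (chartMul n G) (e, e) (v, 0) = v := fun v =>
        congrArg (fun f : EuclideanSpace ℝ (Fin n) →L[ℝ] EuclideanSpace ℝ (Fin n) => f v)
          (fderiv_chartMul_inl (n := n) (G := G))
      change fderiv ℝ (chartMul n G) (e, e) (modelAd n ((chartOne n G).symm e) 0 +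
          fderiv ℝ (fun x => modelAd n ((chartOne n G).symm x)) e T X, 0) +
        D (0, T) (modelAd n ((chartOne n G).symm e) X, 0) =
        fderiv ℝ (chartMul n G) (e, e) 0 + D (T, 0) (0, X) at h0
      rwa [hone, hinl, map_zero, map_zero, zero_add, zero_add, add_comm] at h0
    · filter_upwards [eventually_fderiv_chartMul_comp_modelAd (n := n) (G := G)] with x hx
      exact congrArg (fun f : EuclideanSpace ℝ (Fin n) →L[ℝ] EuclideanSpace ℝ (Fin n) => f X) hx
  -- The derivative of $\mathrm{Ad}$ is now a difference of mixed second derivatives of the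
  -- multiplication. The bracket of the left-invariant fields $x\mapsto Dm(x,e)(0,\cdot)$ gives the
  -- same difference, up to the symmetry of the second derivative.
  rw [eq_sub_of_add_eq' hrel]
  refine Eq.trans ?_ (modelLie_eq_lieBracketWithin (n := n) (G := G) T X).symm
  have hinr : ∀ v, fderiv ℝ (chartMul n G) (e, e) (0, v) = v := fun v =>
    congrArg (fun f : EuclideanSpace ℝ (Fin n) →L[ℝ] EuclideanSpace ℝ (Fin n) => f v)
      (fderiv_chartMul_inr (n := n) (G := G))
  have hT := eventually_mpullback_mulInvariantVectorField (n := n) (G := G) T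
  have hX := eventually_mpullback_mulInvariantVectorField (n := n) (G := G) X
  have key : ∀ V W : EuclideanSpace ℝ (Fin n) → EuclideanSpace ℝ (Fin n),
      V =ᶠ[𝓝 e] (fun x => fderiv ℝ (chartMul n G) (x, e) (0, T)) →
      W =ᶠ[𝓝 e] (fun x => fderiv ℝ (chartMul n G) (x, e) (0, X)) →
      D (T, 0) (0, X) - D (0, T) (X, 0) = lieBracketWithin ℝ V W Set.univ e := by
    intro V W hV hW
    rw [lieBracketWithin_univ, Filter.EventuallyEq.lieBracket_vectorField_eq hV hW, lieBracket_eq]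
    change _ = fderiv ℝ (fun x => fderiv ℝ (chartMul n G) (x, e) (0, X)) e
        (fderiv ℝ (chartMul n G) (e, e) (0, T)) -
      fderiv ℝ (fun x => fderiv ℝ (chartMul n G) (x, e) (0, T)) e
        (fderiv ℝ (chartMul n G) (e, e) (0, X))
    rw [hinr, hinr, hℓY, hℓY, hsymm (0, T)]
    rfl
  simp only [modelWithCornersSelf_coe, Set.range_id] at hT hX ⊢
  exact key _ _ hT hX

end ChartCalculus

/-! ### One-parameter groups of operators. -/

section OperatorExponential

open Filter Topology NormedSpace

variable {V W : Type*} [NormedAddCommGroup V] [NormedSpace ℝ V] [CompleteSpace V]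
  [NormedAddCommGroup W] [NormedSpace ℝ W] [CompleteSpace W]

theorem hasDerivAt_exp_smul_apply (D : V →L[ℝ] V) (v : V) (t : ℝ) :
    HasDerivAt (fun t : ℝ => exp (t • D) v) (D (exp (t • D) v)) t := by
  have h := (hasDerivAt_exp_smul_const' (𝕂 := ℝ) D t).clm_apply (hasDerivAt_const t v)
  simpa using h

/-- A solution of the linear equation `γ' = D γ` is given by the exponential of `D`. -/
theorem eq_exp_smul_apply_of_hasDerivAt {D : V →L[ℝ] V} {γ : ℝ → V}
    (h : ∀ t, HasDerivAt γ (D (γ t)) t) (s : ℝ) : γ s = exp (s • D) (γ 0) := by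
  -- The curve $e^{(s-t)D}\gamma(t)$ is constant; compare $t=s$ with $t=0$.
  have hg : ∀ t, HasDerivAt (fun t => exp ((s - t) • D) (γ t)) 0 t := by
    intro t
    have h1 := HasDerivAt.comp_const_sub s t (hasDerivAt_exp_smul_const (𝕂 := ℝ) D (s - t))
    simpa using h1.clm_apply (h t)
  have hc := is_const_of_deriv_eq_zero (fun t => (hg t).differentiableAt) (fun t => (hg t).deriv) s 0
  simpa using hc

theorem map_exp_smul_apply_of_comp_eq {D : V →L[ℝ] V} {D' : W →L[ℝ] W} {f : V →L[ℝ] W}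
    (h : f.comp D = D'.comp f) (t : ℝ) (v : V) : f (exp (t • D) v) = exp (t • D') (f v) := by
  have := eq_exp_smul_apply_of_hasDerivAt (D := D') (γ := fun t => f (exp (t • D) v)) (fun t => by
    have h1 := f.hasFDerivAt.comp_hasDerivAt t (hasDerivAt_exp_smul_apply D v t)
    have h2 := congrArg (fun F : V →L[ℝ] W => F (exp (t • D) v)) h
    simp only [ContinuousLinearMap.comp_apply] at h2
    rwa [← h2]) t
  simpa using this

theorem exp_smul_apply_of_rotation {D : V →L[ℝ] V} {u w : V} (hu : D u = w) (hw : D w = -u)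
    (t : ℝ) : exp (t • D) u = Real.cos t • u + Real.sin t • w := by
  have := eq_exp_smul_apply_of_hasDerivAt (D := D)
    (γ := fun t => Real.cos t • u + Real.sin t • w) (fun t => by
      have h1 := ((Real.hasDerivAt_cos t).smul_const u).add ((Real.hasDerivAt_sin t).smul_const w)
      convert! h1 using 1
      rw [map_add, map_smul, map_smul, hu, hw, smul_neg, neg_smul, add_comm]) t
  simpa using this.symm

theorem exp_smul_apply_of_apply_eq_zero {D : V →L[ℝ] V} {u : V} (hu : D u = 0) (t : ℝ) :
    exp (t • D) u = u := by
  have := eq_exp_smul_apply_of_hasDerivAt (D := D) (γ := fun _ => u) (fun t => by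
      rw [hu]; exact hasDerivAt_const t u) t
  exact this.symm

theorem exp_smul_add_apply (D : V →L[ℝ] V) (s t : ℝ) (v : V) :
    exp ((s + t) • D) v = exp (s • D) (exp (t • D) v) := by
  have := eq_exp_smul_apply_of_hasDerivAt (D := D) (γ := fun s => exp ((s + t) • D) v) (fun s => by
      exact HasDerivAt.comp_add_const s t (hasDerivAt_exp_smul_apply D v (s + t))) s
  simpa using this

theorem exp_neg_apply_exp_apply (D : V →L[ℝ] V) (v : V) : exp (-D) (exp D v) = v := by
  have := exp_smul_add_apply D (-1) 1 v
  simpa using this.symm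

theorem exp_apply_exp_neg_apply (D : V →L[ℝ] V) (v : V) : exp D (exp (-D) v) = v := by
  have := exp_smul_add_apply D 1 (-1) v
  simpa using this.symm

theorem exp_add_of_commute_real {D E : V →L[ℝ] V} (h : Commute D E) :
    exp (D + E) = exp D * exp E := by
  let _ : NormedAlgebra ℚ (V →L[ℝ] V) := NormedAlgebra.restrictScalars ℚ ℝ _
  exact exp_add_of_commute h

theorem hasDerivAt_exp_smul_neg_bilin (s : V →L[ℝ] V) (b : V →L[ℝ] V →L[ℝ] V) (x y : V) (t : ℝ) :
    HasDerivAt (fun t : ℝ => exp (t • (-s)) (b (exp (t • s) x) (exp (t • s) y)))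
      (exp (t • (-s)) (b (s (exp (t • s) x)) (exp (t • s) y) + b (exp (t • s) x) (s (exp (t • s) y))
        - s (b (exp (t • s) x) (exp (t • s) y)))) t := by
  have hx := hasDerivAt_exp_smul_apply s x t
  have hy := hasDerivAt_exp_smul_apply s y t
  have h1 := ((hasDerivAt_const t b).clm_apply hx).clm_apply hy
  have h2 := (hasDerivAt_exp_smul_const (𝕂 := ℝ) (-s) t).clm_apply h1
  refine h2.congr_deriv ?_
  simp only [zero_apply, zero_add, mul_apply_eq_comp, neg_apply, map_neg, map_sub, map_add]
  abel

/-- An operator close to zero whose exponential preserves a bilinear map is a derivation of it. -/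
theorem eventually_derivation_of_exp_hom (b : V →L[ℝ] V →L[ℝ] V) :
    ∀ᶠ s : V →L[ℝ] V in 𝓝 0, (∀ x y, exp s (b x y) = b (exp s x) (exp s y)) →
      ∀ x y, s (b x y) = b (s x) y + b x (s y) := by
  have hcont : ContinuousAt (exp : (V →L[ℝ] V) → V →L[ℝ] V) 0 :=
    (hasStrictFDerivAt_exp_zero (𝕂 := ℝ)).continuousAt
  -- With $1/10$ the three error terms below add up to at most $0.331\,\|c\|\|x\|\|y\|$, below the
  -- required $\tfrac12\|c\|\|x\|\|y\|$.
  have h1 : ∀ᶠ M : V →L[ℝ] V in 𝓝 0, ‖exp M - 1‖ < 1 / 10 := by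
    have : ContinuousAt (fun M : V →L[ℝ] V => ‖exp M - 1‖) 0 :=
      (hcont.sub continuousAt_const).norm
    refine this.eventually_lt continuousAt_const ?_
    simp
  obtain ⟨r, hr, hball⟩ := Metric.eventually_nhds_iff_ball.1 h1
  filter_upwards [Metric.ball_mem_nhds _ hr] with s hs hhom
  -- the failure of `s` to be a derivation
  let c : V →L[ℝ] V →L[ℝ] V := b.comp s + (b.flip.comp s).flip
    - (ContinuousLinearMap.compL ℝ V V V s).comp b
  have hc : ∀ x y, c x y = b (s x) y + b x (s y) - s (b x y) := fun _ _ => rfl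
  have hclose : ∀ t ∈ Set.Icc (0 : ℝ) 1, ∀ N : V →L[ℝ] V, ‖N‖ = ‖s‖ → ∀ v,
      ‖exp (t • N) v - v‖ ≤ 1 / 10 * ‖v‖ := by
    intro t ht N hN v
    have hmem : t • N ∈ Metric.ball (0 : V →L[ℝ] V) r := by
      rw [mem_ball_zero_iff] at hs ⊢
      rw [norm_smul, Real.norm_of_nonneg ht.1, hN]
      nlinarith [norm_nonneg s, ht.2]
    refine le_trans ?_ (((exp (t • N) - 1).le_opNorm v).trans
      (mul_le_mul_of_nonneg_right (hball _ hmem).le (norm_nonneg _)))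
    simp
  -- The curve $e^{-ts}b(e^{ts}x,e^{ts}y)$ has the same value at $0$ and $1$, while its derivative
  -- $e^{-ts}c(e^{ts}x,e^{ts}y)$ stays close to $c(x,y)$. So $c(x,y)$ is bounded by the deviation,
  -- which gives $\|c\|\le\frac12\|c\|$ and $c=0$.
  have hbound : ∀ x y, ‖c x y‖ ≤ 1 / 2 * ‖c‖ * ‖x‖ * ‖y‖ := by
    intro x y
    have hder : ∀ t ∈ Set.Icc (0 : ℝ) 1, HasDerivWithinAt
        (fun t : ℝ => exp (t • (-s)) (b (exp (t • s) x) (exp (t • s) y)) - t • c x y)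
        (exp (t • (-s)) (c (exp (t • s) x) (exp (t • s) y)) - c x y) (Set.Icc 0 1) t := by
      intro t _
      have h3 : HasDerivAt (fun t : ℝ => t • c x y) (c x y) t := by
        simpa using (hasDerivAt_id t).smul_const (c x y)
      exact ((hasDerivAt_exp_smul_neg_bilin s b x y t).sub h3).hasDerivWithinAt
    have hb : ∀ t ∈ Set.Ico (0 : ℝ) 1,
        ‖exp (t • (-s)) (c (exp (t • s) x) (exp (t • s) y)) - c x y‖
          ≤ 1 / 2 * ‖c‖ * ‖x‖ * ‖y‖ := by
      intro t ht
      have ht' : t ∈ Set.Icc (0 : ℝ) 1 := ⟨ht.1, ht.2.le⟩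
      set x' := exp (t • s) x with hx'
      set y' := exp (t • s) y with hy'
      have hx1 : ‖x' - x‖ ≤ 1 / 10 * ‖x‖ := hclose t ht' s rfl x
      have hy1 : ‖y' - y‖ ≤ 1 / 10 * ‖y‖ := hclose t ht' s rfl y
      have hx2 : ‖x'‖ ≤ 11 / 10 * ‖x‖ := by
        have := norm_add_le (x' - x) x
        rw [sub_add_cancel] at this
        linarith
      have hy2 : ‖y'‖ ≤ 11 / 10 * ‖y‖ := by
        have := norm_add_le (y' - y) y
        rw [sub_add_cancel] at this
        linarith
      have hz := hclose t ht' (-s) (norm_neg s) (c x' y')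
      have e : exp (t • (-s)) (c x' y') - c x y
          = (exp (t • (-s)) (c x' y') - c x' y') + c (x' - x) y' + c x (y' - y) := by
        simp only [map_sub, sub_apply]
        abel
      have b1 := c.le_opNorm₂ x' y'
      have b2 := c.le_opNorm₂ (x' - x) y'
      have b3 := c.le_opNorm₂ x (y' - y)
      have k1 : ‖c‖ * ‖x'‖ * ‖y'‖ ≤ ‖c‖ * (11 / 10 * ‖x‖) * (11 / 10 * ‖y‖) := by gcongr
      have k2 : ‖c‖ * ‖x' - x‖ * ‖y'‖ ≤ ‖c‖ * (1 / 10 * ‖x‖) * (11 / 10 * ‖y‖) := by gcongr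
      have k3 : ‖c‖ * ‖x‖ * ‖y' - y‖ ≤ ‖c‖ * ‖x‖ * (1 / 10 * ‖y‖) := by gcongr
      have hpos : 0 ≤ ‖c‖ * ‖x‖ * ‖y‖ := by positivity
      rw [e]
      refine (norm_add₃_le).trans ?_
      nlinarith
    have := norm_image_sub_le_of_norm_deriv_le_segment_01' hder hb
    have hone : exp (-s) (b (exp s x) (exp s y)) = b x y := by
      rw [← hhom, exp_neg_apply_exp_apply]
    simp only [one_smul, zero_smul, exp_zero, one_apply_eq_self, sub_zero, hone] at this
    rwa [sub_sub_cancel_left, norm_neg] at this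
  have hnorm : ‖c‖ ≤ 1 / 2 * ‖c‖ := c.opNorm_le_bound₂ (by positivity) hbound
  have hzero : ‖c‖ = 0 := le_antisymm (by linarith) (c.opNorm_nonneg)
  intro x y
  have := hbound x y
  rw [hzero, mul_zero, zero_mul, zero_mul] at this
  have := norm_le_zero_iff.1 this
  rw [hc] at this
  exact (sub_eq_zero.1 this).symm

end OperatorExponential

/-! ### Compact Lie algebras and their automorphisms. -/

/-- A Lie bracket on a normed space, with an invariant inner product and only inner derivations. -/
structure CompactBracket (V : Type*) [NormedAddCommGroup V] [NormedSpace ℝ V] where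
  ad : V →L[ℝ] V →L[ℝ] V
  form : V →L[ℝ] V →L[ℝ] ℝ
  ad_skew : ∀ x y, ad x y = -ad y x
  ad_ad : ∀ x y z, ad x (ad y z) = ad (ad x y) z + ad y (ad x z)
  form_symm : ∀ x y, form x y = form y x
  form_pos : ∀ x, x ≠ 0 → 0 < form x x
  form_ad : ∀ x y z, form (ad x y) z = -form y (ad x z)
  exists_eq_ad : ∀ D : V →L[ℝ] V, (∀ x y, D (ad x y) = ad (D x) y + ad x (D y)) → ∃ z, D = ad z

namespace CompactBracket

open Filter Topology NormedSpace

variable {V : Type*} [NormedAddCommGroup V] [NormedSpace ℝ V] (C : CompactBracket V)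

theorem ad_self (x : V) : C.ad x x = 0 := by
  have := C.ad_skew x x
  have h2 : (2 : ℝ) • C.ad x x = 0 := by
    rw [two_smul]
    nth_rewrite 1 [this]
    exact neg_add_cancel _
  exact (smul_eq_zero.1 h2).resolve_left two_ne_zero

theorem eq_zero_of_form_self {x : V} (h : C.form x x = 0) : x = 0 := by
  by_contra hx
  exact (C.form_pos x hx).ne' h

/-- Automorphisms of the bracket preserving the inner product. -/
def IsAut (A : V →L[ℝ] V) : Prop :=
  (∀ x y, A (C.ad x y) = C.ad (A x) (A y)) ∧ ∀ x y, C.form (A x) (A y) = C.form x y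

theorem isAut_one : C.IsAut 1 := ⟨fun _ _ => rfl, fun _ _ => rfl⟩

variable {C}

theorem IsAut.mul {A B : V →L[ℝ] V} (hA : C.IsAut A) (hB : C.IsAut B) : C.IsAut (A * B) :=
  ⟨fun x y => by simp only [mul_apply_eq_comp, hB.1, hA.1],
    fun x y => by simp only [mul_apply_eq_comp, hA.2, hB.2]⟩

theorem IsAut.of_mul_eq {A B D : V →L[ℝ] V} (hA : C.IsAut A) (hD : C.IsAut D) (h : A * B = D) :
    C.IsAut B := by
  have h' : ∀ x, A (B x) = D x := fun x => congrArg (fun f : V →L[ℝ] V => f x) h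
  have hinj : ∀ x y, A x = A y → x = y := by
    intro x y hxy
    refine sub_eq_zero.1 (C.eq_zero_of_form_self ?_)
    rw [← hA.2, map_sub, hxy, sub_self, map_zero]
  refine ⟨fun x y => hinj _ _ ?_, fun x y => ?_⟩
  · rw [h', hD.1, hA.1, h', h']
  · rw [← hA.2, h', h', hD.2]

/-- By Jacobi, the bracket of two flow lines again solves $\gamma'=[x,\gamma]$; by invariance of the
form, the pairing of two flow lines is constant. -/
theorem isAut_exp [CompleteSpace V] (x : V) : C.IsAut (exp (C.ad x)) := by
  constructor
  · intro y z
    have := eq_exp_smul_apply_of_hasDerivAt (D := C.ad x)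
      (γ := fun t => C.ad (exp (t • C.ad x) y) (exp (t • C.ad x) z)) (fun t => by
        have h1 := ((hasDerivAt_const t C.ad).clm_apply
          (hasDerivAt_exp_smul_apply (C.ad x) y t)).clm_apply
          (hasDerivAt_exp_smul_apply (C.ad x) z t)
        refine h1.congr_deriv ?_
        rw [zero_apply, zero_add]
        exact (C.ad_ad _ _ _).symm) 1
    simpa using this.symm
  · intro y z
    have h : ∀ t, HasDerivAt (fun t : ℝ => C.form (exp (t • C.ad x) y) (exp (t • C.ad x) z)) 0 t := by
      intro t
      have h1 := ((hasDerivAt_const t C.form).clm_apply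
          (hasDerivAt_exp_smul_apply (C.ad x) y t)).clm_apply
          (hasDerivAt_exp_smul_apply (C.ad x) z t)
      refine h1.congr_deriv ?_
      simp [C.form_ad]
    have hc := is_const_of_deriv_eq_zero (fun t => (h t).differentiableAt)
      (fun t => (h t).deriv) 1 0
    simpa using hc

theorem exp_ad_mul_exp_neg_ad [CompleteSpace V] (x : V) :
    exp (C.ad x) * exp (-C.ad x) = 1 := by
  ext v
  simp [exp_apply_exp_neg_apply]

theorem exp_neg_ad_mul_exp_ad [CompleteSpace V] (x : V) :
    exp (-C.ad x) * exp (C.ad x) = 1 := by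
  ext v
  simp [exp_neg_apply_exp_apply]

/-- Automorphisms intertwine exponentials. -/
theorem IsAut.mul_exp_ad [CompleteSpace V] {A : V →L[ℝ] V} (hA : C.IsAut A) (x : V) :
    A * exp (C.ad x) = exp (C.ad (A x)) * A := by
  ext v
  have := map_exp_smul_apply_of_comp_eq (D := C.ad x) (D' := C.ad (A x)) (f := A)
    (by ext y; exact hA.1 x y) 1 v
  simpa using this

theorem exp_ad_apply_self [CompleteSpace V] (x : V) : exp (C.ad x) x = x := by
  simpa using exp_smul_apply_of_apply_eq_zero (C.ad_self x) 1

theorem exp_ad_apply_of_commute [CompleteSpace V] {x y : V} (h : C.ad x y = 0) :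
    exp (C.ad x) y = y := by
  simpa using exp_smul_apply_of_apply_eq_zero h 1

theorem commute_ad {x y : V} (h : C.ad x y = 0) : Commute (C.ad x) (C.ad y) := by
  ext z
  have := C.ad_ad x y z
  rw [h, map_zero, zero_apply, zero_add] at this
  exact this

theorem exp_ad_add [CompleteSpace V] {x y : V} (h : C.ad x y = 0) :
    exp (C.ad (x + y)) = exp (C.ad x) * exp (C.ad y) := by
  rw [map_add, exp_add_of_commute_real (commute_ad h)]

section FiniteDimensional

variable [FiniteDimensional ℝ V]

theorem IsAut.exists_inv {A : V →L[ℝ] V} (hA : C.IsAut A) :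
    ∃ B, C.IsAut B ∧ A * B = 1 ∧ B * A = 1 := by
  have hinj : Function.Injective (A : V →ₗ[ℝ] V) := by
    intro x y hxy
    refine sub_eq_zero.1 (C.eq_zero_of_form_self ?_)
    rw [← hA.2, map_sub, show A x = A y from hxy, sub_self, map_zero]
  let e := LinearEquiv.ofInjectiveEndo (A : V →ₗ[ℝ] V) hinj
  let B : V →L[ℝ] V := LinearMap.toContinuousLinearMap (e.symm : V →ₗ[ℝ] V)
  have h1 : A * B = 1 := by
    ext x
    exact e.apply_symm_apply x
  have h2 : B * A = 1 := by
    ext x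
    exact e.symm_apply_apply x
  exact ⟨B, hA.of_mul_eq C.isAut_one h1, h1, h2⟩

/-- The inner product bounds the norm. -/
theorem exists_norm_sq_le (C : CompactBracket V) : ∃ c > 0, ∀ x, c * ‖x‖ ^ 2 ≤ C.form x x := by
  have : ProperSpace V := FiniteDimensional.proper_real V
  have hcont : Continuous fun x : V => C.form x x := by fun_prop
  rcases (Metric.sphere (0 : V) 1).eq_empty_or_nonempty with h | h
  · refine ⟨1, one_pos, fun x => ?_⟩
    rcases eq_or_ne x 0 with rfl | hx
    · simp
    · exfalso
      have : (‖x‖⁻¹ • x) ∈ Metric.sphere (0 : V) 1 := by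
        simp [norm_smul, norm_ne_zero_iff.2 hx]
      rw [h] at this
      exact this
  · obtain ⟨u, hu, hmin⟩ := (isCompact_sphere (0 : V) 1).exists_isMinOn h hcont.continuousOn
    have hu0 : u ≠ 0 := by
      rintro rfl
      simp at hu
    refine ⟨C.form u u, C.form_pos u hu0, fun x => ?_⟩
    rcases eq_or_ne x 0 with rfl | hx
    · simp
    · have hn : ‖x‖ ≠ 0 := norm_ne_zero_iff.2 hx
      have hm : (‖x‖⁻¹ • x) ∈ Metric.sphere (0 : V) 1 := by
        simp [norm_smul, hn]
      have h1 : C.form u u ≤ C.form (‖x‖⁻¹ • x) (‖x‖⁻¹ • x) := hmin hm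
      simp only [map_smul, smul_apply, smul_eq_mul] at h1
      calc C.form u u * ‖x‖ ^ 2 ≤ (‖x‖⁻¹ * (‖x‖⁻¹ * C.form x x)) * ‖x‖ ^ 2 := by gcongr
        _ = C.form x x := by field_simp

/-- Automorphisms are isometries of a definite form, hence bounded in operator norm, and their
defining equations are closed. -/
theorem isCompact_setOf_isAut_and {p : Set (V →L[ℝ] V)} (hp : IsClosed p) :
    IsCompact {A : V →L[ℝ] V | C.IsAut A ∧ A ∈ p} := by
  have : ProperSpace (V →L[ℝ] V) := FiniteDimensional.proper_real _
  refine Metric.isCompact_of_isClosed_isBounded ?_ ?_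
  · have h1 : IsClosed {A : V →L[ℝ] V | ∀ x y, A (C.ad x y) = C.ad (A x) (A y)} := by
      simp only [Set.ofPred_forall]
      refine isClosed_iInter fun x => isClosed_iInter fun y => isClosed_eq ?_ ?_ <;> fun_prop
    have h2 : IsClosed {A : V →L[ℝ] V | ∀ x y, C.form (A x) (A y) = C.form x y} := by
      simp only [Set.ofPred_forall]
      refine isClosed_iInter fun x => isClosed_iInter fun y => isClosed_eq ?_ ?_ <;> fun_prop
    exact (h1.inter h2).inter hp
  · obtain ⟨c, hc, hcx⟩ := C.exists_norm_sq_le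
    refine isBounded_iff_forall_norm_le.2 ⟨Real.sqrt (‖C.form‖ / c), fun A hA => ?_⟩
    refine A.opNorm_le_bound (Real.sqrt_nonneg _) fun x => ?_
    have h1 := hcx (A x)
    rw [hA.1.2] at h1
    have h2 : C.form x x ≤ ‖C.form‖ * ‖x‖ * ‖x‖ := (le_abs_self _).trans (C.form.le_opNorm₂ x x)
    have h3 : ‖A x‖ ^ 2 ≤ (‖C.form‖ / c) * ‖x‖ ^ 2 := by
      rw [div_mul_eq_mul_div, le_div_iff₀ hc]
      nlinarith
    have := Real.sqrt_le_sqrt h3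
    rwa [Real.sqrt_sq (norm_nonneg _), Real.sqrt_mul (by positivity),
      Real.sqrt_sq (norm_nonneg _)] at this

/-- Two elements fixed by an automorphism become commuting after applying to one of them an
automorphism which commutes with the given one. -/
theorem IsAut.exists_commuting_ad_eq_zero {A : V →L[ℝ] V} (hA : C.IsAut A) {S : Set V} {Y Z : V}
    (hY : A Y = Y) (hZ : A Z = Z) (hSY : ∀ u ∈ S, C.ad u Y = 0) (hSZ : ∀ u ∈ S, C.ad u Z = 0) :
    ∃ k, C.IsAut k ∧ k * A = A * k ∧ (∀ u ∈ S, k u = u) ∧ C.ad (k Y) Z = 0 := by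
  have hcl : IsClosed {k : V →L[ℝ] V | k * A = A * k ∧ ∀ u ∈ S, k u = u} := by
    have h1 : IsClosed {k : V →L[ℝ] V | ∀ u ∈ S, k u = u} := by
      simp only [Set.ofPred_forall]
      refine isClosed_iInter fun x => isClosed_iInter fun _ => isClosed_eq ?_ ?_ <;> fun_prop
    have h2 : IsClosed {k : V →L[ℝ] V | k * A = A * k} := isClosed_eq (by fun_prop) (by fun_prop)
    exact h2.inter h1
  -- The automorphism $k$ is chosen to maximise $\langle kY,Z\rangle$ on the compact group of
  -- automorphisms that commute with $A$ and fix $S$.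
  have hcont : Continuous fun k : V →L[ℝ] V => C.form (k Y) Z := by fun_prop
  obtain ⟨k, ⟨hk, hkA, hkS⟩, hmax⟩ := (isCompact_setOf_isAut_and (C := C) hcl).exists_isMaxOn
    ⟨1, C.isAut_one, by simp, by simp⟩ hcont.continuousOn
  refine ⟨k, hk, hkA, hkS, ?_⟩
  set U := C.ad (k Y) Z with hU
  have hkY : A (k Y) = k Y := by
    have := congrArg (fun f : V →L[ℝ] V => f Y) hkA
    simp only [mul_apply_eq_comp] at this
    rw [← this, hY]
  have hAU : A U = U := by rw [hU, hA.1, hkY, hZ]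
  have hSU : ∀ u ∈ S, C.ad U u = 0 := by
    intro u hu
    have h1 : C.ad u (k Y) = 0 := by
      rw [← hkS u hu, ← hk.1, hSY u hu, map_zero]
    rw [C.ad_skew, hU, C.ad_ad, h1, hSZ u hu]
    simp
  -- Since $U=[kY,Z]$ is fixed by $A$ and commutes with $S$, the operators $e^{t\,\mathrm{ad}U}$ are
  -- admissible variations. The derivative at the maximum is $\langle[U,kY],Z\rangle=\langle
  -- U,U\rangle$, so $U=0$.
  have hmem : ∀ t : ℝ, exp (t • C.ad U) * k ∈
      {k : V →L[ℝ] V | C.IsAut k ∧ k ∈ {k : V →L[ℝ] V | k * A = A * k ∧ ∀ u ∈ S, k u = u}} := by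
    intro t
    rw [← map_smul]
    refine ⟨(isAut_exp _).mul hk, ?_, fun u hu => ?_⟩
    · rw [mul_assoc, hkA, ← mul_assoc, ← mul_assoc, hA.mul_exp_ad, map_smul A, hAU]
    · rw [mul_apply_eq_comp, hkS u hu]
      exact exp_ad_apply_of_commute (by rw [map_smul, smul_apply, hSU u hu, smul_zero])
  have hder : HasDerivAt (fun t : ℝ => C.form (exp (t • C.ad U) (k Y)) Z)
      (C.form (C.ad U (k Y)) Z) 0 := by
    have h1 := ((hasDerivAt_const (0 : ℝ) C.form).clm_apply
      (hasDerivAt_exp_smul_apply (C.ad U) (k Y) 0)).clm_apply (hasDerivAt_const (0 : ℝ) Z)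
    refine h1.congr_deriv ?_
    simp
  have hloc : IsLocalMax (fun t : ℝ => C.form (exp (t • C.ad U) (k Y)) Z) 0 := by
    refine Filter.Eventually.of_forall fun t => ?_
    have h1 : C.form ((exp (t • C.ad U) * k) Y) Z ≤ C.form (k Y) Z := hmax (hmem t)
    simpa using h1
  have h0 := hloc.hasDerivAt_eq_zero hder
  rw [C.ad_skew, map_neg, neg_apply, C.form_ad, neg_neg] at h0
  exact C.eq_zero_of_form_self h0

/-- Conjugation by $k$ fixes $A$ and carries the logarithm $Y$ to $kY$; this is how logarithms are
moved into commuting position. -/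
theorem exp_ad_eq_of_commuting {A k : V →L[ℝ] V} {Y : V} (hk : C.IsAut k) (hkA : k * A = A * k)
    (hY : A = exp (C.ad Y)) : A = exp (C.ad (k Y)) := by
  obtain ⟨B, -, hB, -⟩ := hk.exists_inv
  have h := hk.mul_exp_ad Y
  rw [← hY, hkA] at h
  have := congrArg (· * B) h
  simpa [mul_assoc, hB] using this

/-- In both directions the logarithm $Y$ and $Z$ are fixed by the same automorphism, so $Y$ can be
moved to a logarithm that commutes with $Z$; then exponents add. -/
theorem exists_exp_ad_of_mul_exp_ad {A : V →L[ℝ] V} (hA : C.IsAut A) {Z : V} (hZ : A Z = Z) :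
    (∃ Y, A * exp (C.ad Z) = exp (C.ad Y)) ↔ ∃ Y, A = exp (C.ad Y) := by
  constructor
  · rintro ⟨Y, hY⟩
    have hZ' : (A * exp (C.ad Z)) Z = Z := by
      rw [mul_apply_eq_comp, exp_ad_apply_self, hZ]
    have hY' : (A * exp (C.ad Z)) Y = Y := by rw [hY, exp_ad_apply_self]
    obtain ⟨k, hk, hkA, -, h0⟩ := (hA.mul (isAut_exp Z)).exists_commuting_ad_eq_zero (S := ∅)
      hY' hZ' (by simp) (by simp)
    have h1 := exp_ad_eq_of_commuting hk hkA hY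
    refine ⟨k Y + -Z, ?_⟩
    rw [exp_ad_add (by rw [map_neg, h0, neg_zero]), ← h1, map_neg, mul_assoc,
      exp_ad_mul_exp_neg_ad, mul_one]
  · rintro ⟨Y, hY⟩
    have hY' : A Y = Y := by rw [hY, exp_ad_apply_self]
    obtain ⟨k, hk, hkA, -, h0⟩ := hA.exists_commuting_ad_eq_zero (S := ∅)
      hY' hZ (by simp) (by simp)
    have h1 := exp_ad_eq_of_commuting hk hkA hY
    exact ⟨k Y + Z, by rw [exp_ad_add h0, ← h1]⟩

/-- For an isometry $A$ the range of $1-A$ is orthogonal to its kernel, so by dimension the two span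
$V$. -/
theorem IsAut.exists_sub_add_fixed {A : V →L[ℝ] V} (hA : C.IsAut A) (v : V) :
    ∃ w z, A z = z ∧ w - A w + z = v := by
  let f : V →ₗ[ℝ] V := LinearMap.id - (A : V →ₗ[ℝ] V)
  have hf : ∀ x, f x = x - A x := fun _ => rfl
  have hdisj : Disjoint (LinearMap.range f) (LinearMap.ker f) := by
    rw [Submodule.disjoint_def]
    rintro x ⟨w, rfl⟩ hx
    rw [LinearMap.mem_ker] at hx
    set x := f w with hxw
    have hAx : A x = x := (sub_eq_zero.1 hx).symm
    refine C.eq_zero_of_form_self ?_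
    nth_rewrite 2 [hxw]
    rw [hf, map_sub, sub_eq_zero, ← hA.2 x w, hAx]
  have htop := Submodule.eq_top_of_disjoint _ _ (LinearMap.finrank_range_add_finrank_ker f).ge hdisj
  have hv : v ∈ LinearMap.range f ⊔ LinearMap.ker f := by rw [htop]; trivial
  obtain ⟨y, ⟨w, rfl⟩, z, hz, rfl⟩ := Submodule.mem_sup.1 hv
  exact ⟨w, z, (sub_eq_zero.1 (LinearMap.mem_ker.1 hz)).symm, rfl⟩

end FiniteDimensional

end CompactBracket

/-! ### Automorphisms near a given one, and existence of logarithms. -/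

namespace CompactBracket

open Filter Topology NormedSpace

variable {V : Type*} [NormedAddCommGroup V] [NormedSpace ℝ V] [FiniteDimensional ℝ V]
  {C : CompactBracket V}

theorem hasStrictFDerivAt_exp_comp {X : Type*} [NormedAddCommGroup X] [NormedSpace ℝ X]
    (L : X →L[ℝ] V →L[ℝ] V) : HasStrictFDerivAt (fun x => exp (L x)) L 0 := by
  have h : HasStrictFDerivAt (exp : (V →L[ℝ] V) → V →L[ℝ] V)
      (1 : (V →L[ℝ] V) →L[ℝ] V →L[ℝ] V) (L 0) := by
    rw [map_zero]
    exact hasStrictFDerivAt_exp_zero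
  exact h.comp 0 L.hasStrictFDerivAt

/-- Product rule, in a form that can be iterated: the value at $0$ remains $A$ after each
exponential factor. -/
theorem hasStrictFDerivAt_mul_exp_comp {X : Type*} [NormedAddCommGroup X] [NormedSpace ℝ X]
    (A : V →L[ℝ] V) {f : X → V →L[ℝ] V} {f' : X →L[ℝ] V →L[ℝ] V} (hf : HasStrictFDerivAt f f' 0)
    (h0 : f 0 = A) (L : X →L[ℝ] V →L[ℝ] V) :
    HasStrictFDerivAt (fun x => f x * exp (L x))
      (f' + (ContinuousLinearMap.compL ℝ V V V A).comp L) 0 ∧ f 0 * exp (L 0) = A := by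
  constructor
  · refine (hf.clm_comp (hasStrictFDerivAt_exp_comp L)).congr_fderiv ?_
    ext x v
    simp [h0, add_comm]
  · rw [h0, map_zero, exp_zero, mul_one]

/-- Automorphisms near `A` are conjugate to products of `A` with exponentials of fixed vectors. -/
theorem IsAut.eventually_exists_conj {A : V →L[ℝ] V} (hA : C.IsAut A) :
    ∀ᶠ A' in 𝓝 A, C.IsAut A' → ∃ W Z, A Z = Z ∧
      A' = exp (C.ad W) * (A * exp (C.ad Z)) * exp (-C.ad W) := by
  -- $S$ is a complement of the inner derivations among all operators. Operators near $A$ are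
  -- written as $A\,e^{\mathrm{ad}\,w}e^{\mathrm{ad}\,z}e^{-\mathrm{ad}\,Aw}e^{s}$ with $Az=z$ and
  -- $s\in S$: the derivative $A(\mathrm{ad}(w-Aw+z)+s)$ is onto.
  obtain ⟨S, hS⟩ := (LinearMap.range (C.ad : V →ₗ[ℝ] V →L[ℝ] V)).exists_isCompl
  let c : Submodule ℝ V := LinearMap.ker ((A : V →ₗ[ℝ] V) - LinearMap.id)
  have hc : ∀ z : V, z ∈ c ↔ A z = z := fun z => by
    rw [LinearMap.mem_ker]
    exact sub_eq_zero
  let X := V × c × S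
  let L₁ : X →L[ℝ] V →L[ℝ] V := C.ad.comp (ContinuousLinearMap.fst ℝ V (c × S))
  let L₂ : X →L[ℝ] V →L[ℝ] V := (C.ad.comp c.subtypeL).comp
    ((ContinuousLinearMap.fst ℝ c S).comp (ContinuousLinearMap.snd ℝ V (c × S)))
  let L₃ : X →L[ℝ] V →L[ℝ] V := -(C.ad.comp A).comp (ContinuousLinearMap.fst ℝ V (c × S))
  let L₄ : X →L[ℝ] V →L[ℝ] V := S.subtypeL.comp
    ((ContinuousLinearMap.snd ℝ c S).comp (ContinuousLinearMap.snd ℝ V (c × S)))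
  obtain ⟨h₁, e₁⟩ := hasStrictFDerivAt_mul_exp_comp A (hasStrictFDerivAt_const A (0 : X)) rfl L₁
  obtain ⟨h₂, e₂⟩ := hasStrictFDerivAt_mul_exp_comp A h₁ e₁ L₂
  obtain ⟨h₃, e₃⟩ := hasStrictFDerivAt_mul_exp_comp A h₂ e₂ L₃
  obtain ⟨hF, hF0⟩ := hasStrictFDerivAt_mul_exp_comp A h₃ e₃ L₄
  let F : X → V →L[ℝ] V := fun p => A * exp (L₁ p) * exp (L₂ p) * exp (L₃ p) * exp (L₄ p)
  obtain ⟨B, -, hAB, -⟩ := hA.exists_inv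
  have hmap := hF.map_nhds_eq_of_surj (by
    rw [LinearMap.range_eq_top]
    intro M
    have hM : B * M ∈ LinearMap.range (C.ad : V →ₗ[ℝ] V →L[ℝ] V) ⊔ S := by
      rw [hS.sup_eq_top]; trivial
    obtain ⟨_, ⟨v, rfl⟩, s, hs, hsum⟩ := Submodule.mem_sup.1 hM
    obtain ⟨w, z, hz, hwz⟩ := hA.exists_sub_add_fixed v
    refine ⟨(w, ⟨z, (hc z).2 hz⟩, ⟨s, hs⟩), ?_⟩
    have hM' : M = A * (C.ad v + s) := by
      rw [show C.ad v + s = B * M from hsum, ← mul_assoc, hAB, one_mul]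
    change 0 + A * C.ad w + A * C.ad z + A * (-C.ad (A w)) + A * s = M
    rw [hM', ← hwz, map_add, map_sub, zero_add, ← mul_add, ← mul_add, ← mul_add]
    congr 1
    abel)
  have hmap' : Filter.map F (𝓝 0) = 𝓝 A := hF0 ▸ hmap
  have hL₄ : Tendsto L₄ (𝓝 0) (𝓝 0) := by
    simpa using L₄.continuous.tendsto 0
  have hsmall := hL₄.eventually (eventually_derivation_of_exp_hom C.ad)
  rw [← hmap', Filter.eventually_map]
  filter_upwards [hsmall] with p hp hAut
  obtain ⟨w, z, s⟩ := p
  have hL₁ : L₁ (w, z, s) = C.ad w := rfl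
  have hL₂ : L₂ (w, z, s) = C.ad z := rfl
  have hL₃ : L₃ (w, z, s) = C.ad (-(A w)) := by rw [map_neg]; rfl
  have hAut' : C.IsAut (exp (L₄ (w, z, s))) := by
    refine IsAut.of_mul_eq (A := A * exp (L₁ (w, z, s)) * exp (L₂ (w, z, s)) * exp (L₃ (w, z, s)))
      ?_ hAut rfl
    rw [hL₁, hL₂, hL₃]
    exact ((hA.mul (isAut_exp _)).mul (isAut_exp _)).mul (isAut_exp _)
  -- The factor $e^s$ is an automorphism and $s$ is small, so $s$ is a derivation, hence inner;
  -- being in $S$, it vanishes.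
  obtain ⟨y, hy⟩ := C.exists_eq_ad _ (hp hAut'.1)
  have hs0 : L₄ (w, z, s) = 0 := by
    have h1 : L₄ (w, z, s) ∈ LinearMap.range (C.ad : V →ₗ[ℝ] V →L[ℝ] V) := ⟨y, hy.symm⟩
    have h2 : L₄ (w, z, s) ∈ S := s.2
    exact (Submodule.disjoint_def.1 hS.disjoint) _ h1 h2
  -- Moving $A$ past $e^{\mathrm{ad}\,w}$ turns $w$ into $Aw$, the conjugating element.
  refine ⟨A w, z, (hc z).1 z.2, ?_⟩
  change A * exp (L₁ (w, z, s)) * exp (L₂ (w, z, s)) * exp (L₃ (w, z, s)) * exp (L₄ (w, z, s)) = _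
  rw [hs0, exp_zero, mul_one, hL₁, hL₂, hL₃, hA.mul_exp_ad, map_neg, mul_assoc (exp (C.ad (A w)))]

theorem exists_exp_ad_conj_iff {A : V →L[ℝ] V} {W : V} :
    (∃ Y, exp (C.ad W) * A * exp (-C.ad W) = exp (C.ad Y)) ↔ ∃ Y, A = exp (C.ad Y) := by
  have h1 : exp (-C.ad W) = exp (C.ad (-W)) := by rw [map_neg]
  constructor
  · rintro ⟨Y, hY⟩
    have h2 := (C.isAut_exp (-W)).mul_exp_ad Y
    rw [← h1, ← hY] at h2
    refine ⟨exp (-C.ad W) Y, ?_⟩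
    have h3 := congrArg (· * exp (C.ad W)) h2
    simp only [mul_assoc, exp_neg_ad_mul_exp_ad, mul_one] at h3
    rw [← h3, ← mul_assoc, exp_neg_ad_mul_exp_ad, one_mul]
  · rintro ⟨Y, rfl⟩
    refine ⟨exp (C.ad W) Y, ?_⟩
    rw [(C.isAut_exp W).mul_exp_ad, mul_assoc, exp_ad_mul_exp_neg_ad, mul_one]

/-- A continuous family of automorphisms parametrized by a connected space and containing the
identity consists of exponentials. -/
theorem exists_eq_exp_ad_of_connected {T : Type*} [TopologicalSpace T] [PreconnectedSpace T]
    {f : T → V →L[ℝ] V} (hf : Continuous f) (hAut : ∀ t, C.IsAut (f t)) {t₀ : T} (h₀ : f t₀ = 1)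
    (t : T) : ∃ Y, f t = exp (C.ad Y) := by
  -- A nearby $f(t')$ is conjugate to $f(t)\,e^{\mathrm{ad}Z}$ with $Z$ fixed by $f(t)$. Neither the
  -- conjugation nor this factor affects the existence of a logarithm, which is therefore a locally
  -- constant property.
  have hloc : ∀ t, ∀ᶠ t' in 𝓝 t, ((∃ Y, f t' = exp (C.ad Y)) ↔ ∃ Y, f t = exp (C.ad Y)) := by
    intro t
    filter_upwards [hf.continuousAt.eventually (hAut t).eventually_exists_conj] with t' ht'
    obtain ⟨W, Z, hZ, h⟩ := ht' (hAut t')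
    rw [h, exists_exp_ad_conj_iff, exists_exp_ad_of_mul_exp_ad (hAut t) hZ]
  have hclopen : IsClopen {t | ∃ Y, f t = exp (C.ad Y)} := by
    constructor
    · rw [← isOpen_compl_iff, isOpen_iff_mem_nhds]
      intro t ht
      filter_upwards [hloc t] with t' h' hmem
      exact ht (h'.1 hmem)
    · rw [isOpen_iff_mem_nhds]
      intro t ht
      filter_upwards [hloc t] with t' h'
      exact h'.2 ht
  have := hclopen.eq_univ ⟨t₀, 0, by rw [h₀, map_zero, exp_zero]⟩
  exact (this ▸ Set.mem_univ t : t ∈ {t | ∃ Y, f t = exp (C.ad Y)})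

/-- If an exponential fixes a commuting subspace, its logarithm can be chosen to commute with it. -/
theorem exists_log_commuting {A : V →L[ℝ] V} (hA : ∃ Y, A = exp (C.ad Y)) {𝔱 : Submodule ℝ V}
    (hfix : ∀ H ∈ 𝔱, A H = H) (hcomm : ∀ H ∈ 𝔱, ∀ H' ∈ 𝔱, C.ad H H' = 0) :
    ∃ Y, A = exp (C.ad Y) ∧ ∀ H ∈ 𝔱, C.ad H Y = 0 := by
  classical
  have hAut : C.IsAut A := by
    obtain ⟨Y, rfl⟩ := hA
    exact isAut_exp Y
  -- Generators are treated one at a time: the automorphism that makes $Y$ commute with the next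
  -- generator fixes the earlier ones.
  have key : ∀ s : Finset V, (s : Set V) ⊆ 𝔱 →
      ∃ Y, A = exp (C.ad Y) ∧ ∀ H ∈ s, C.ad H Y = 0 := by
    intro s
    induction s using Finset.induction_on with
    | empty => intro _; simpa using hA
    | insert Z s _ ih =>
      intro hs
      have hs' : (s : Set V) ⊆ 𝔱 := fun x hx => hs (by simp [Finset.mem_coe.1 hx])
      have hZ : Z ∈ 𝔱 := hs (by simp)
      obtain ⟨Y, hY, hsY⟩ := ih hs'
      obtain ⟨k, hk, hkA, hkS, h0⟩ := hAut.exists_commuting_ad_eq_zero (S := (s : Set V))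
        (Y := Y) (Z := Z) (by rw [hY, exp_ad_apply_self]) (hfix Z hZ) (fun u hu => hsY u hu)
        (fun u hu => hcomm u (hs' hu) Z hZ)
      refine ⟨k Y, exp_ad_eq_of_commuting hk hkA hY, fun H hH => ?_⟩
      rcases Finset.mem_insert.1 hH with rfl | hH
      · rw [C.ad_skew, h0, neg_zero]
      · rw [← hkS H hH, ← hk.1, hsY H hH, map_zero]
  obtain ⟨s, hs⟩ := (IsNoetherian.noetherian 𝔱 : 𝔱.FG)
  obtain ⟨Y, hY, hsY⟩ := key s (fun x hx => hs ▸ Submodule.subset_span hx)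
  refine ⟨Y, hY, fun H hH => ?_⟩
  rw [← hs] at hH
  induction hH using Submodule.span_induction with
  | mem x hx => exact hsY x hx
  | zero => simp
  | add x y _ _ hx hy => simp [hx, hy]
  | smul a x _ hx => simp [hx]

end CompactBracket

/-! ### Root vectors and shortest logarithms. -/

namespace CompactBracket

open Filter Topology NormedSpace

section Rotation

variable {V : Type*} [NormedAddCommGroup V] [NormedSpace ℝ V] [CompleteSpace V]
  {C : CompactBracket V}

theorem exp_apply_of_rotation_by {D : V →L[ℝ] V} {a b : V} {r : ℝ} (ha : D a = -(r • b))
    (hb : D b = r • a) : exp D a = Real.cos r • a - Real.sin r • b := by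
  have := eq_exp_smul_apply_of_hasDerivAt (D := D)
    (γ := fun t => Real.cos (t * r) • a - Real.sin (t * r) • b) (fun t => by
      have h0 : HasDerivAt (fun t : ℝ => t * r) r t := by
        simpa using (hasDerivAt_id t).mul_const r
      have h1 := (h0.cos.smul_const a).sub (h0.sin.smul_const b)
      refine h1.congr_deriv ?_
      rw [map_sub, map_smul, map_smul, ha, hb]
      module) 1
  simpa using this.symm

/-- In a representation of `𝔰𝔬(3)` by derivations, a rotation by `4π` is trivial. -/
theorem exp_ad_four_pi_eq_one {e₁ e₂ e₃ : V} (h₁₂ : C.ad e₁ e₂ = e₃) (h₂₃ : C.ad e₂ e₃ = e₁)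
    (h₃₁ : C.ad e₃ e₁ = e₂) : exp (C.ad ((4 * Real.pi) • e₃)) = 1 := by
  -- $Q$ is the half-turn about $e_1$. It reverses $e_3$, so $QP=P^{-1}Q$; and $P$ fixes $e_1$, so
  -- $P$ commutes with $Q$. Hence $P=P^{-1}$.
  set P := exp (C.ad ((2 * Real.pi) • e₃)) with hP
  set Q := exp (C.ad (Real.pi • e₁)) with hQ
  have hPe : P e₁ = e₁ := by
    rw [hP, map_smul, exp_smul_apply_of_rotation h₃₁ (by rw [C.ad_skew, h₂₃])]
    simp
  have hQe : Q e₃ = -e₃ := by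
    rw [hQ, map_smul, exp_smul_apply_of_rotation (w := -e₂) (by rw [C.ad_skew, h₃₁])
      (by rw [map_neg, h₁₂])]
    simp
  have h1 : Q * P = exp (-C.ad ((2 * Real.pi) • e₃)) * Q := by
    rw [hP, (isAut_exp _).mul_exp_ad, map_smul, hQe, smul_neg, map_neg]
  have h2 : P * Q = Q * P := by
    rw [hQ, (isAut_exp _).mul_exp_ad, map_smul, hPe]
  have h3 : P * P = 1 := by
    have h4 : P * (P * Q) = Q := by
      rw [h2, h1, ← mul_assoc, hP, exp_ad_mul_exp_neg_ad, one_mul]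
    have h5 := congrArg (· * exp (-C.ad (Real.pi • e₁))) h4
    simpa only [mul_assoc, hQ, exp_ad_mul_exp_neg_ad, mul_one] using h5
  have h6 : (4 * Real.pi) • e₃ = (2 * Real.pi) • e₃ + (2 * Real.pi) • e₃ := by
    rw [← add_smul]; ring_nf
  rw [h6, exp_ad_add (by simp [C.ad_self]), ← hP, h3]

end Rotation

variable {V : Type*} [NormedAddCommGroup V] [NormedSpace ℝ V] {C : CompactBracket V}

/-- `a + i b` is a root vector for `α`, with respect to the commuting subspace `𝔱`. -/
structure IsRootPair (C : CompactBracket V) (𝔱 : Submodule ℝ V) (α : V → ℝ) (a b : V) : Prop where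
  ad_fst : ∀ H ∈ 𝔱, C.ad H a = -(α H • b)
  ad_snd : ∀ H ∈ 𝔱, C.ad H b = α H • a

namespace IsRootPair

variable {𝔱 : Submodule ℝ V} {α : V → ℝ} {a b : V}

theorem form_snd_snd (h : IsRootPair C 𝔱 α a b) {H : V} (hH : H ∈ 𝔱) (hα : α H ≠ 0) :
    C.form b b = C.form a a := by
  have h1 := C.form_ad H a b
  rw [h.ad_fst H hH, h.ad_snd H hH] at h1
  simp only [map_neg, map_smul, neg_apply, smul_apply, smul_eq_mul, neg_inj] at h1
  exact mul_left_cancel₀ hα h1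

theorem form_fst_snd (h : IsRootPair C 𝔱 α a b) {H : V} (hH : H ∈ 𝔱) (hα : α H ≠ 0) :
    C.form a b = 0 := by
  have h1 := C.form_ad H a a
  rw [h.ad_fst H hH] at h1
  simp only [map_neg, map_smul, neg_apply, smul_apply, smul_eq_mul, neg_neg] at h1
  rw [C.form_symm b a] at h1
  have h2 : α H * C.form a b = 0 := by linarith
  exact (mul_eq_zero.1 h2).resolve_left hα

theorem ad_ad_eq_zero (h : IsRootPair C 𝔱 α a b) {H : V} (hH : H ∈ 𝔱) :
    C.ad H (C.ad a b) = 0 := by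
  rw [C.ad_ad, h.ad_fst H hH, h.ad_snd H hH]
  simp [C.ad_self]

theorem form_ad_apply (h : IsRootPair C 𝔱 α a b) {H : V} (hH : H ∈ 𝔱) :
    C.form (C.ad a b) H = -(α H * C.form b b) := by
  rw [C.form_ad, C.ad_skew a H, h.ad_fst H hH]
  simp

/-- The values of a root on a shortest logarithm are bounded by `2π`. -/
theorem abs_le_two_pi [CompleteSpace V] (h : IsRootPair C 𝔱 α a b) (ha : a ≠ 0) {H : V}
    (hH : H ∈ 𝔱)
    (hα : α H ≠ 0) (hcomm : ∀ H ∈ 𝔱, ∀ H' ∈ 𝔱, C.ad H H' = 0)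
    (hcent : ∀ x, (∀ H ∈ 𝔱, C.ad H x = 0) → x ∈ 𝔱) {X : V} (hX : X ∈ 𝔱)
    (hmin : ∀ X' ∈ 𝔱, exp (C.ad X') = exp (C.ad X) → C.form X X ≤ C.form X' X') :
    |α X| ≤ 2 * Real.pi := by
  set c := C.ad a b with hc
  have hct : c ∈ 𝔱 := hcent c fun H hH => h.ad_ad_eq_zero hH
  have hq : 0 < C.form b b := by
    rw [h.form_snd_snd hH hα]
    exact C.form_pos a ha
  have hc0 : c ≠ 0 := by
    intro h0
    have := h.form_ad_apply hH
    rw [← hc, h0, map_zero, zero_apply] at this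
    have h1 : α H * C.form b b = 0 := by linarith
    exact mul_ne_zero hα hq.ne' h1
  have hcc : C.form c c = -(α c * C.form b b) := h.form_ad_apply hct
  have hcpos := C.form_pos c hc0
  set r := -α c with hr
  have hrpos : 0 < r := by
    by_contra hle
    have : 0 ≤ α c := by linarith
    nlinarith
  -- The scale $m=r^{-1/2}$ makes $ma,\ mb,\ r^{-1}c$ a standard basis of $\mathfrak{so}(3)$.
  set m := (Real.sqrt r)⁻¹ with hm
  have hmm : m * m = r⁻¹ := by
    rw [hm, ← mul_inv, Real.mul_self_sqrt hrpos.le]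
  have hca : C.ad c a = r • b := by rw [h.ad_fst c hct, hr, neg_smul]
  have hcb : C.ad c b = -(r • a) := by rw [h.ad_snd c hct, hr, neg_smul, neg_neg]
  have hone : exp (C.ad ((4 * Real.pi) • (r⁻¹ • c))) = 1 := by
    refine exp_ad_four_pi_eq_one (e₁ := m • a) (e₂ := m • b) ?_ ?_ ?_
    · simp only [map_smul, smul_apply, smul_smul, hmm, ← hc]
    · rw [C.ad_skew]
      simp only [map_smul, smul_apply, hcb, smul_neg, neg_neg, smul_smul]
      congr 1
      field_simp
    · simp only [map_smul, smul_apply, hca, smul_smul]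
      congr 1
      field_simp
  -- Adding $\pm4\pi r^{-1}c$ to $X$ leaves the exponential unchanged, so it cannot shorten $X$.
  -- Expanding the squared length gives $\pm\alpha(X)\le2\pi$.
  have hshift : ∀ ε : ℝ, ε = 1 ∨ ε = -1 →
      C.form X X ≤ C.form (X + ε • ((4 * Real.pi) • (r⁻¹ • c)))
        (X + ε • ((4 * Real.pi) • (r⁻¹ • c))) := by
    intro ε hε
    refine hmin _ (𝔱.add_mem hX (𝔱.smul_mem _ (𝔱.smul_mem _ (𝔱.smul_mem _ hct)))) ?_
    rw [exp_ad_add (by simp [hcomm X hX c hct])]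
    rcases hε with rfl | rfl
    · rw [one_smul, hone, mul_one]
    · have := exp_ad_mul_exp_neg_ad (C := C) ((4 * Real.pi) • (r⁻¹ • c))
      rw [hone, one_mul] at this
      rw [neg_one_smul, map_neg, this, mul_one]
  have hXc : C.form X c = -(α X * C.form b b) := by rw [C.form_symm, h.form_ad_apply hX]
  have hcX : C.form c X = -(α X * C.form b b) := h.form_ad_apply hX
  have hcc' : C.form c c = r * C.form b b := by rw [hcc, hr]; ring
  have hpi := Real.pi_pos
  have key : ∀ ε : ℝ, ε = 1 ∨ ε = -1 → ε * α X ≤ 2 * Real.pi := by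
    intro ε hε
    have h1 := hshift ε hε
    simp only [map_add, map_smul, add_apply, smul_apply, smul_eq_mul, hXc, hcX, hcc'] at h1
    have hε2 : ε * ε = 1 := by rcases hε with rfl | rfl <;> norm_num
    have h2 : r⁻¹ * r = 1 := inv_mul_cancel₀ hrpos.ne'
    have hpos : 0 < 8 * Real.pi * r⁻¹ * C.form b b := by positivity
    have h3 : 0 ≤ (8 * Real.pi * r⁻¹ * C.form b b) * (2 * Real.pi - ε * α X) := by
      have e : (8 * Real.pi * r⁻¹ * C.form b b) * (2 * Real.pi - ε * α X)
          = (ε * ε) * 16 * Real.pi ^ 2 * r⁻¹ * (r⁻¹ * r) * C.form b b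
            - 8 * Real.pi * r⁻¹ * C.form b b * ε * α X := by
        rw [hε2, h2]; ring
      rw [e]
      linarith
    have := nonneg_of_mul_nonneg_right h3 hpos
    linarith
  exact abs_le.2 ⟨by linarith [key (-1) (Or.inr rfl)], by linarith [key 1 (Or.inl rfl)]⟩

/-- A root vector in the `-1`-eigenspace of `exp (ad X)`, for a shortest logarithm `X`. -/
theorem eq_pi_or_eq_neg_pi [CompleteSpace V] (h : IsRootPair C 𝔱 α a b) (ha : a ≠ 0) {H : V}
    (hH : H ∈ 𝔱) (hα : α H ≠ 0) (hcomm : ∀ H ∈ 𝔱, ∀ H' ∈ 𝔱, C.ad H H' = 0)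
    (hcent : ∀ x, (∀ H ∈ 𝔱, C.ad H x = 0) → x ∈ 𝔱) {X : V} (hX : X ∈ 𝔱)
    (hmin : ∀ X' ∈ 𝔱, exp (C.ad X') = exp (C.ad X) → C.form X X ≤ C.form X' X')
    (hXa : exp (C.ad X) a = -a) : α X = Real.pi ∨ α X = -Real.pi := by
  have hle := h.abs_le_two_pi ha hH hα hcomm hcent hX hmin
  have h1 := exp_apply_of_rotation_by (h.ad_fst X hX) (h.ad_snd X hX)
  rw [hXa] at h1
  have h2 := congrArg (fun v => C.form a v) h1
  simp only [map_neg, map_sub, map_smul, smul_eq_mul, h.form_fst_snd hH hα, mul_zero,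
    sub_zero] at h2
  have hpos := C.form_pos a ha
  have h3 : Real.cos (α X) = -1 := by
    have : (Real.cos (α X) + 1) * C.form a a = 0 := by linarith
    have := (mul_eq_zero.1 this).resolve_right hpos.ne'
    linarith
  -- The odd multiples of $\pi$ in $[-2\pi,2\pi]$ are $\pm\pi$.
  rw [Real.cos_eq_neg_one_iff] at h3
  obtain ⟨k, hk⟩ := h3
  have hpi := Real.pi_pos
  rw [← hk] at hle ⊢
  rw [abs_le] at hle
  have hk1 : (k : ℝ) < 1 := by nlinarith
  have hk2 : (-2 : ℝ) < k := by nlinarith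
  have hk1' : k < 1 := by exact_mod_cast hk1
  have hk2' : -2 < k := by exact_mod_cast hk2
  have : k = 0 ∨ k = -1 := by omega
  rcases this with rfl | rfl
  · left; simp
  · right; push_cast; ring

end IsRootPair

/-- Existence of a shortest logarithm. -/
theorem exists_shortest_log [FiniteDimensional ℝ V] (C : CompactBracket V) {𝔱 : Submodule ℝ V}
    {X₀ : V} (hX₀ : X₀ ∈ 𝔱) :
    ∃ X ∈ 𝔱, exp (C.ad X) = exp (C.ad X₀) ∧
      ∀ X' ∈ 𝔱, exp (C.ad X') = exp (C.ad X) → C.form X X ≤ C.form X' X' := by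
  have : ProperSpace V := FiniteDimensional.proper_real V
  -- Only logarithms no longer than $X_0$ compete, which gives a compact set.
  let K : Set V := {X | X ∈ 𝔱 ∧ exp (C.ad X) = exp (C.ad X₀) ∧ C.form X X ≤ C.form X₀ X₀}
  have hf : Continuous fun x : V => C.form x x := by fun_prop
  have hexp : Continuous fun x : V => exp (C.ad x) := by
    have : Continuous (exp : (V →L[ℝ] V) → V →L[ℝ] V) :=
      continuous_iff_continuousAt.2 fun x => (exp_analytic (𝕂 := ℝ) x).continuousAt
    exact this.comp C.ad.continuous
  have hK : IsCompact K := by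
    refine Metric.isCompact_of_isClosed_isBounded ?_ ?_
    · exact (Submodule.closed_of_finiteDimensional 𝔱).inter
        ((isClosed_eq hexp continuous_const).inter (isClosed_le hf continuous_const))
    · obtain ⟨c, hc, hcx⟩ := C.exists_norm_sq_le
      refine isBounded_iff_forall_norm_le.2 ⟨Real.sqrt (C.form X₀ X₀ / c), fun x hx => ?_⟩
      refine Real.le_sqrt_of_sq_le ?_
      rw [le_div_iff₀ hc, mul_comm]
      exact (hcx x).trans hx.2.2
  obtain ⟨X, hXK, hmin⟩ := hK.exists_isMinOn ⟨X₀, hX₀, rfl, le_rfl⟩ hf.continuousOn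
  refine ⟨X, hXK.1, hXK.2.1, fun X' hX' he => ?_⟩
  by_cases hle : C.form X' X' ≤ C.form X₀ X₀
  · exact hmin ⟨hX', he.trans hXK.2.1, hle⟩
  · exact hXK.2.2.trans (not_le.1 hle).le

end CompactBracket

/-! ### Lifting small exponentials through a family of automorphisms. -/

namespace CompactBracket

open Filter Topology NormedSpace

variable {V : Type*} [NormedAddCommGroup V] [NormedSpace ℝ V] [FiniteDimensional ℝ V]
  {C : CompactBracket V}

theorem exists_localInverse {X Y : Type*} [NormedAddCommGroup X] [NormedSpace ℝ X]
    [NormedAddCommGroup Y] [NormedSpace ℝ Y] [FiniteDimensional ℝ X] [FiniteDimensional ℝ Y]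
    {Φ : X → Y} {L : X →L[ℝ] Y} {p : X} (hΦ : HasStrictFDerivAt Φ L p)
    (hL : Function.Bijective L) : ∃ Ψ : OpenPartialHomeomorph X Y, p ∈ Ψ.source ∧ ⇑Ψ = Φ := by
  have : CompleteSpace X := FiniteDimensional.complete ℝ X
  let Le : X ≃L[ℝ] Y := (LinearEquiv.ofBijective (L : X →ₗ[ℝ] Y) hL).toContinuousLinearEquiv
  have hΦ' : HasStrictFDerivAt Φ (Le : X →L[ℝ] Y) p := hΦ
  exact ⟨hΦ'.toOpenPartialHomeomorph Φ, hΦ'.mem_toOpenPartialHomeomorph_source, rfl⟩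

theorem hasStrictFDerivAt_mul_exp_prod {W : Type*} [NormedAddCommGroup W] [NormedSpace ℝ W]
    {f : V → V →L[ℝ] V} {f' : V →L[ℝ] V →L[ℝ] V} {e : V} {N : W →L[ℝ] V →L[ℝ] V}
    (hf : HasStrictFDerivAt f f' e) (he : f e = 1) :
    HasStrictFDerivAt (fun p : V × W => f p.1 * exp (N p.2))
      (f'.comp (ContinuousLinearMap.fst ℝ V W) + N.comp (ContinuousLinearMap.snd ℝ V W)) (e, 0) := by
  have h1 : HasStrictFDerivAt (fun p : V × W => f p.1)
      (f'.comp (ContinuousLinearMap.fst ℝ V W)) (e, 0) :=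
    HasStrictFDerivAt.comp (g := f) (f := Prod.fst) (e, (0 : W)) hf hasStrictFDerivAt_fst
  have h2 : HasStrictFDerivAt (fun p : V × W => exp (N p.2))
      (N.comp (ContinuousLinearMap.snd ℝ V W)) (e, 0) :=
    HasStrictFDerivAt.comp (g := fun s : W => exp (N s)) (f := Prod.snd) (e, (0 : W))
      (hasStrictFDerivAt_exp_comp N) hasStrictFDerivAt_snd
  refine (h1.clm_comp h2).congr_fderiv ?_
  refine ContinuousLinearMap.ext fun p => ContinuousLinearMap.ext fun v => ?_
  change f e (N p.2 v) + f' p.1 (exp (N 0) v) = f' p.1 v + N p.2 v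
  rw [he, map_zero, exp_zero, add_comm]
  rfl

/-- A family of automorphisms whose derivative at a base point is the adjoint representation is
injective near the base point, and small exponentials belong to it. -/
theorem exists_lift_of_hasStrictFDerivAt (C : CompactBracket V) (hinj : ∀ Z, C.ad Z = 0 → Z = 0)
    {f : V → V →L[ℝ] V} {e : V} (hf : HasStrictFDerivAt f C.ad e) (hAut : ∀ x, C.IsAut (f x))
    (he : f e = 1) {O : Set V} (hO : IsOpen O) (heO : e ∈ O) :
    (∀ᶠ x in 𝓝 e, f x = 1 → x = e) ∧
    ∀ Z : V, ∃ ε > 0, ∃ u : ℝ → V, u 0 = e ∧ ContinuousOn u (Set.Ioo (-ε) ε) ∧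
      ∀ t ∈ Set.Ioo (-ε) ε, u t ∈ O ∧ f (u t) = exp (t • C.ad Z) := by
  obtain ⟨S, hS⟩ := (LinearMap.range (C.ad : V →ₗ[ℝ] V →L[ℝ] V)).exists_isCompl
  let L : V × S →L[ℝ] V →L[ℝ] V := C.ad.comp (ContinuousLinearMap.fst ℝ V S) +
    S.subtypeL.comp (ContinuousLinearMap.snd ℝ V S)
  have hL : ∀ u s, L (u, s) = C.ad u + s := fun _ _ => rfl
  have hLbij : Function.Bijective L := by
    constructor
    · refine (injective_iff_map_eq_zero L).2 ?_
      rintro ⟨u, s⟩ h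
      have h1 : C.ad u + s = 0 := h
      have h2 : (s : V →L[ℝ] V) = 0 := by
        refine (Submodule.disjoint_def.1 hS.disjoint) _ ⟨-u, ?_⟩ s.2
        rw [map_neg]
        exact neg_eq_of_add_eq_zero_right h1
      rw [h2, add_zero] at h1
      rw [Prod.mk_eq_zero]
      exact ⟨hinj _ h1, Subtype.ext h2⟩
    · intro M
      have hM : M ∈ LinearMap.range (C.ad : V →ₗ[ℝ] V →L[ℝ] V) ⊔ S := by
        rw [hS.sup_eq_top]; trivial
      obtain ⟨_, ⟨v, rfl⟩, s, hs, hsum⟩ := Submodule.mem_sup.1 hM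
      exact ⟨(v, ⟨s, hs⟩), hsum⟩
  -- With $S$ complementary to the inner derivations, the derivative of $\Phi$ at $(e,0)$ is
  -- bijective and the inverse function theorem applies.
  let Φ : V × S → V →L[ℝ] V := fun p => f p.1 * exp (p.2 : V →L[ℝ] V)
  have hΦ0 : Φ (e, 0) = 1 := by
    change f e * exp 0 = 1
    rw [he, exp_zero, mul_one]
  have hΦ : HasStrictFDerivAt Φ L (e, 0) := by
    refine (hasStrictFDerivAt_mul_exp_prod (W := S) (N := S.subtypeL) hf he).congr_fderiv ?_
    exact ContinuousLinearMap.ext fun p => rfl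
  obtain ⟨Ψ, hmem, hΨ⟩ := exists_localInverse (X := V × S) (Y := V →L[ℝ] V) (L := L) hΦ hLbij
  have hΨ' : ∀ p, Ψ p = f p.1 * exp (p.2 : V →L[ℝ] V) := fun p => by rw [hΨ]
  have hΨ0 : Ψ (e, 0) = 1 := by rw [hΨ, hΦ0]
  constructor
  · have h1 : Tendsto (fun x : V => (x, (0 : S))) (𝓝 e) (𝓝 (e, 0)) :=
      (Continuous.prodMk_left _).tendsto _
    filter_upwards [h1.eventually (Ψ.open_source.mem_nhds hmem)] with x hx hfx
    have h2 : Ψ (x, 0) = Ψ (e, 0) := by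
      rw [hΨ0, hΨ', hfx, one_mul]
      exact exp_zero
    exact congrArg Prod.fst (Ψ.injOn hx hmem h2)
  · intro Z
    have htarget : (1 : V →L[ℝ] V) ∈ Ψ.target := hΨ0 ▸ Ψ.map_source hmem
    have hsymm : Ψ.symm 1 = (e, 0) := by rw [← hΨ0, Ψ.left_inv hmem]
    have hcont : ContinuousAt Ψ.symm 1 := Ψ.continuousAt_symm htarget
    have hexp : Continuous fun t : ℝ => exp (t • C.ad Z) :=
      continuous_iff_continuousAt.2 fun t =>
        (hasDerivAt_exp_smul_const (𝕂 := ℝ) (C.ad Z) t).continuousAt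
    have hexp0 : exp ((0 : ℝ) • C.ad Z) = 1 := by rw [zero_smul, exp_zero]
    have ht1 : Tendsto (fun t : ℝ => exp (t • C.ad Z)) (𝓝 0) (𝓝 1) := by
      rw [← hexp0]
      exact hexp.tendsto 0
    have hev1 : ∀ᶠ M in 𝓝 (1 : V →L[ℝ] V), M ∈ Ψ.target := Ψ.open_target.mem_nhds htarget
    have hev2 : ∀ᶠ M in 𝓝 (1 : V →L[ℝ] V), (Ψ.symm M).1 ∈ O := by
      have : ContinuousAt (fun M => (Ψ.symm M).1) 1 := hcont.fst
      exact this.eventually_mem (hO.mem_nhds (by rw [hsymm]; exact heO))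
    have hev3 : ∀ᶠ M in 𝓝 (1 : V →L[ℝ] V),
        (∀ x y, exp ((Ψ.symm M).2 : V →L[ℝ] V) (C.ad x y) =
          C.ad (exp ((Ψ.symm M).2 : V →L[ℝ] V) x) (exp ((Ψ.symm M).2 : V →L[ℝ] V) y)) →
        ∀ x y, ((Ψ.symm M).2 : V →L[ℝ] V) (C.ad x y) =
          C.ad (((Ψ.symm M).2 : V →L[ℝ] V) x) y + C.ad x (((Ψ.symm M).2 : V →L[ℝ] V) y) := by
      have h1 : ContinuousAt (fun M => ((Ψ.symm M).2 : V →L[ℝ] V)) 1 :=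
        continuous_subtype_val.continuousAt.comp hcont.snd
      have h2 : Tendsto (fun M => ((Ψ.symm M).2 : V →L[ℝ] V)) (𝓝 1) (𝓝 0) := by
        have := h1.tendsto
        rwa [hsymm] at this
      exact h2.eventually (eventually_derivation_of_exp_hom C.ad)
    obtain ⟨ε, hε, hball⟩ := Metric.eventually_nhds_iff_ball.1
      (ht1.eventually (hev1.and (hev2.and hev3)))
    rw [Real.ball_eq_Ioo, zero_sub, zero_add] at hball
    refine ⟨ε, hε, fun t => (Ψ.symm (exp (t • C.ad Z))).1, ?_, ?_, fun t ht => ?_⟩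
    · change (Ψ.symm (exp ((0 : ℝ) • C.ad Z))).1 = e
      rw [hexp0, hsymm]
    · exact continuous_fst.comp_continuousOn
        (Ψ.continuousOn_symm.comp hexp.continuousOn fun t ht => (hball t ht).1)
    · obtain ⟨h1, h2, h3⟩ := hball t ht
      refine ⟨h2, ?_⟩
      have h4 := Ψ.right_inv h1
      rw [hΨ'] at h4
      have hA : C.IsAut (exp (t • C.ad Z)) := by
        rw [← map_smul]
        exact isAut_exp _
      -- The $S$-component of a small exponential is again a derivation, so it is zero and the
      -- exponential is a value of $f$ itself.
      obtain ⟨y, hy⟩ := C.exists_eq_ad _ (h3 ((hAut _).of_mul_eq hA h4).1)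
      have hs0 : ((Ψ.symm (exp (t • C.ad Z))).2 : V →L[ℝ] V) = 0 :=
        (Submodule.disjoint_def.1 hS.disjoint) _ ⟨y, hy.symm⟩ (Ψ.symm (exp (t • C.ad Z))).2.2
      rw [hs0, exp_zero, mul_one] at h4
      exact h4

end CompactBracket

/-! ### The adjoint representation of $G$. -/

section AdjointRepresentation

open Filter Topology NormedSpace

variable {n : ℕ} {G : Type*} [TopologicalSpace G] [ChartedSpace (EuclideanSpace ℝ (Fin n)) G]
  [Group G]

theorem modelAd_one : modelAd n (1 : G) = 1 := lieAd_one

theorem hasFDerivAt_read_in_chartOne {f : G → G} (h1 : f 1 = 1)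
    (hf : MDifferentiableAt (𝓡 n) (𝓡 n) f 1)
    {f' : EuclideanSpace ℝ (Fin n) →L[ℝ] EuclideanSpace ℝ (Fin n)}
    (hf' : mfderiv (𝓡 n) (𝓡 n) f (1 : G) = f') :
    HasFDerivAt (fun x => chartOne n G (f ((chartOne n G).symm x))) f' (chartOne n G 1) := by
  have h : HasFDerivWithinAt (fun x => chartOne n G (f ((chartOne n G).symm x))) f'
      Set.univ (chartOne n G 1) := by
    rw [← hf']
    have h := hf.hasMFDerivAt.2
    simp only [writtenInExtChartAt, h1, modelWithCornersSelf_coe, Set.range_id] at h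
    exact h
  exact hasFDerivWithinAt_univ.1 h

variable [LieGroup (𝓡 n) ∞ G]

theorem modelAd_mul (g h : G) : modelAd n (g * h) = modelAd n g * modelAd n h := lieAd_mul g h

theorem modelAd_mul_modelAd_inv (g : G) : modelAd n g * modelAd n g⁻¹ = 1 := by
  rw [← modelAd_mul, mul_inv_cancel, modelAd_one]

theorem modelAd_inv_mul_modelAd (g : G) : modelAd n g⁻¹ * modelAd n g = 1 := by
  rw [← modelAd_mul, inv_mul_cancel, modelAd_one]

/-- The Lie bracket of the Lie algebra of `G`, as a continuous bilinear map. -/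
noncomputable def modelBracket (n : ℕ) (G : Type*) [TopologicalSpace G]
    [ChartedSpace (EuclideanSpace ℝ (Fin n)) G] [Group G] [LieGroup (𝓡 n) ∞ G] :
    EuclideanSpace ℝ (Fin n) →L[ℝ] EuclideanSpace ℝ (Fin n) →L[ℝ] EuclideanSpace ℝ (Fin n) :=
  (exists_hasStrictFDerivAt_modelAd (n := n) (G := G)).choose

theorem hasStrictFDerivAt_modelAd :
    HasStrictFDerivAt (fun x => modelAd n ((chartOne n G).symm x)) (modelBracket n G)
      (chartOne n G 1) :=
  (exists_hasStrictFDerivAt_modelAd (n := n) (G := G)).choose_spec.1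

theorem modelBracket_apply (T X : LieAlg n G) : modelBracket n G T X = (⁅T, X⁆ : LieAlg n G) :=
  (exists_hasStrictFDerivAt_modelAd (n := n) (G := G)).choose_spec.2 T X

/-- Continuity at `1` is read off the chart, and the homomorphism property transports it to every
point. -/
theorem continuous_modelAd : Continuous (modelAd n : G → _) := by
  have hG : IsTopologicalGroup G := topologicalGroup_of_lieGroup (𝓡 n) ∞
  have h1 : ContinuousAt (modelAd n : G → _) 1 := by
    have h2 : ContinuousAt (fun g : G => modelAd n ((chartOne n G).symm (chartOne n G g))) 1 :=
      ContinuousAt.comp (f := chartOne n G) hasStrictFDerivAt_modelAd.continuousAt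
        (continuousAt_extChartAt (I := 𝓡 n) (1 : G))
    refine h2.congr ?_
    filter_upwards [extChartAt_source_mem_nhds (I := 𝓡 n) (1 : G)] with g hg
    rw [(chartOne n G).left_inv hg]
  refine continuous_iff_continuousAt.2 fun g => ?_
  have h2 : ContinuousAt (fun h : G => modelAd n g * modelAd n (g⁻¹ * h)) g := by
    refine continuousAt_const.mul (ContinuousAt.comp (g := modelAd n) ?_
      (continuous_const_mul g⁻¹).continuousAt)
    rwa [inv_mul_cancel]
  refine h2.congr (Eventually.of_forall fun h => ?_)
  change modelAd n g * modelAd n (g⁻¹ * h) = modelAd n h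
  rw [← modelAd_mul, mul_inv_cancel_left]

/-- Differentiating $\mathrm{Ad}(gxg^{-1})=\mathrm{Ad}(g)\mathrm{Ad}(x)\mathrm{Ad}(g)^{-1}$ at $x=1$
gives $\mathrm{ad}(\mathrm{Ad}(g)T)=\mathrm{Ad}(g)\,\mathrm{ad}(T)\,\mathrm{Ad}(g)^{-1}$. -/
theorem modelAd_bracket (g : G) (T X : EuclideanSpace ℝ (Fin n)) :
    modelAd n g (modelBracket n G T X)
      = modelBracket n G (modelAd n g T) (modelAd n g X) := by
  have hG : IsTopologicalGroup G := topologicalGroup_of_lieGroup (𝓡 n) ∞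
  have hc : HasFDerivAt (fun x => chartOne n G (MulAut.conj g ((chartOne n G).symm x)))
      (modelAd n g) (chartOne n G 1) :=
    hasFDerivAt_read_in_chartOne (map_one (MulAut.conj g)) (mdifferentiable_conj g 1) rfl
  have hval : chartOne n G (MulAut.conj g ((chartOne n G).symm (chartOne n G 1)))
      = chartOne n G 1 := by
    rw [chartOne_symm_apply_self, map_one]
  have h1 : HasFDerivAt (fun x => modelAd n ((chartOne n G).symm
      (chartOne n G (MulAut.conj g ((chartOne n G).symm x)))))
      ((modelBracket n G).comp (modelAd n g)) (chartOne n G 1) := by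
    refine HasFDerivAt.comp (g := fun x => modelAd n ((chartOne n G).symm x)) _ ?_ hc
    rw [hval]
    exact hasStrictFDerivAt_modelAd.hasFDerivAt
  have h2 : HasFDerivAt (fun x => (modelAd n g).comp
      ((modelAd n ((chartOne n G).symm x)).comp (modelAd n g⁻¹))) _ (chartOne n G 1) :=
    (hasFDerivAt_const (modelAd n g) _).clm_comp
      (hasStrictFDerivAt_modelAd.hasFDerivAt.clm_comp (hasFDerivAt_const (modelAd n g⁻¹) _))
  have h3 := h1.unique (h2.congr_of_eventuallyEq ?_)
  · have h4 := congrArg (fun F : EuclideanSpace ℝ (Fin n) →L[ℝ]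
      EuclideanSpace ℝ (Fin n) →L[ℝ] EuclideanSpace ℝ (Fin n) => F T (modelAd n g X)) h3
    have h5 : modelAd n g⁻¹ (modelAd n g X) = X :=
      congrArg (fun f : EuclideanSpace ℝ (Fin n) →L[ℝ] EuclideanSpace ℝ (Fin n) => f X)
        (modelAd_inv_mul_modelAd g)
    simp [h5] at h4
    exact h4.symm
  · have hcont : ContinuousAt (fun x => MulAut.conj g ((chartOne n G).symm x)) (chartOne n G 1) := by
      have := (contMDiffAt_chartOne_symm (n := n) (G := G)).continuousAt
      simp only [MulAut.conj_apply]
      exact (continuousAt_const.mul this).mul continuousAt_const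
    have hsrc := hcont.eventually_mem (s := (chartOne n G).source) (by
      rw [chartOne_symm_apply_self, map_one]
      exact extChartAt_source_mem_nhds (I := 𝓡 n) (1 : G))
    filter_upwards [hsrc] with x hx
    rw [(chartOne n G).left_inv hx, MulAut.conj_apply, modelAd_mul, modelAd_mul, mul_assoc]
    rfl

/-- The negative of the Killing form, as a continuous bilinear form. -/
noncomputable def modelForm (n : ℕ) (G : Type*) [TopologicalSpace G]
    [ChartedSpace (EuclideanSpace ℝ (Fin n)) G] [Group G] [LieGroup (𝓡 n) ∞ G] :
    EuclideanSpace ℝ (Fin n) →L[ℝ] EuclideanSpace ℝ (Fin n) →L[ℝ] ℝ :=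
  LinearMap.toContinuousBilinearMap (E := EuclideanSpace ℝ (Fin n))
    (F := EuclideanSpace ℝ (Fin n)) (-killingForm ℝ (LieAlg n G))

theorem modelForm_apply (x y : LieAlg n G) :
    modelForm n G x y = -killingForm ℝ (LieAlg n G) x y := rfl

instance finiteDimensional_lieAlg : FiniteDimensional ℝ (LieAlg n G) :=
  inferInstanceAs (FiniteDimensional ℝ (EuclideanSpace ℝ (Fin n)))

theorem isKilling_of_killingForm_neg
    (hneg : ∀ X : LieAlg n G, X ≠ 0 → killingForm ℝ (LieAlg n G) X X < 0) :
    LieAlgebra.IsKilling ℝ (LieAlg n G) := by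
  refine ⟨?_⟩
  rw [eq_bot_iff]
  intro x hx
  by_contra h0
  have h1 := (LieIdeal.mem_killingCompl ℝ (LieAlg n G) ⊤).1 hx x (by trivial)
  exact (hneg x h0).ne h1

theorem modelBracket_skew (x y : LieAlg n G) :
    modelBracket n G x y = -modelBracket n G y x :=
  (modelBracket_apply x y).trans ((lie_skew x y).symm.trans
    (congrArg (fun v : LieAlg n G => -v) (modelBracket_apply y x).symm))

theorem modelBracket_jacobi (x y z : LieAlg n G) :
    modelBracket n G x (modelBracket n G y z) =
      modelBracket n G (modelBracket n G x y) z + modelBracket n G y (modelBracket n G x z) := by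
  have h1 : modelBracket n G x (modelBracket n G y z) = (⁅x, ⁅y, z⁆⁆ : LieAlg n G) :=
    (congrArg (modelBracket n G x) (modelBracket_apply y z)).trans (modelBracket_apply x ⁅y, z⁆)
  have h2 : modelBracket n G (modelBracket n G x y) z = (⁅⁅x, y⁆, z⁆ : LieAlg n G) :=
    (congrArg (fun v => modelBracket n G v z) (modelBracket_apply x y)).trans
      (modelBracket_apply ⁅x, y⁆ z)
  have h3 : modelBracket n G y (modelBracket n G x z) = (⁅y, ⁅x, z⁆⁆ : LieAlg n G) :=
    (congrArg (modelBracket n G y) (modelBracket_apply x z)).trans (modelBracket_apply y ⁅x, z⁆)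
  rw [h1, h2, h3]
  exact leibniz_lie x y z

theorem modelForm_modelBracket (x y z : LieAlg n G) :
    modelForm n G (modelBracket n G x y) z = -modelForm n G y (modelBracket n G x z) := by
  have h1 : modelForm n G (modelBracket n G x y) z = -killingForm ℝ (LieAlg n G) ⁅x, y⁆ z :=
    (congrArg (fun v => modelForm n G v z) (modelBracket_apply x y)).trans
      (modelForm_apply ⁅x, y⁆ z)
  have h2 : modelForm n G y (modelBracket n G x z) = -killingForm ℝ (LieAlg n G) y ⁅x, z⁆ :=
    (congrArg (modelForm n G y) (modelBracket_apply x z)).trans (modelForm_apply y ⁅x, z⁆)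
  rw [h1, h2, LieModule.traceForm_apply_lie_apply']

/-- A definite Killing form is nondegenerate, so all derivations are inner. -/
theorem exists_eq_modelBracket
    (hneg : ∀ X : LieAlg n G, X ≠ 0 → killingForm ℝ (LieAlg n G) X X < 0)
    (D : LieAlg n G →ₗ[ℝ] LieAlg n G) (hD : ∀ x y : LieAlg n G, D ⁅x, y⁆ = ⁅D x, y⁆ + ⁅x, D y⁆) :
    ∃ z : LieAlg n G, ∀ x : LieAlg n G, D x = ⁅z, x⁆ := by
  have := isKilling_of_killingForm_neg hneg
  let D' : LieDerivation ℝ (LieAlg n G) (LieAlg n G) :=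
    { D with
      leibniz' := fun a b => by
        change D ⁅a, b⁆ = ⁅a, D b⁆ - ⁅b, D a⁆
        rw [hD, ← lie_skew b (D a), sub_neg_eq_add, add_comm] }
  obtain ⟨z, hz⟩ := LieDerivation.IsKilling.exists_eq_ad D'
  refine ⟨z, fun x => ?_⟩
  have := congrArg (fun F : LieDerivation ℝ (LieAlg n G) (LieAlg n G) => (F : LieAlg n G →ₗ[ℝ]
    LieAlg n G) x) hz
  rw [LieDerivation.coe_ad_apply_eq_ad_apply] at this
  exact this.symm

/-- The Lie algebra of a Lie group with negative definite Killing form. -/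
noncomputable def compactBracket
    (hneg : ∀ X : LieAlg n G, X ≠ 0 → killingForm ℝ (LieAlg n G) X X < 0) :
    CompactBracket (EuclideanSpace ℝ (Fin n)) where
  ad := modelBracket n G
  form := modelForm n G
  ad_skew x y := modelBracket_skew (n := n) (G := G) x y
  ad_ad x y z := modelBracket_jacobi (n := n) (G := G) x y z
  form_symm x y := by
    exact congrArg (fun r : ℝ => -r)
      (LieModule.traceForm_comm ℝ (LieAlg n G) (LieAlg n G) x y)
  form_pos x hx := by
    have := hneg x hx
    change 0 < -killingForm ℝ (LieAlg n G) x x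
    linarith
  form_ad x y z := modelForm_modelBracket (n := n) (G := G) x y z
  exists_eq_ad D hD := by
    let D' : LieAlg n G →ₗ[ℝ] LieAlg n G :=
      { toFun := D
        map_add' := fun x y => D.map_add x y
        map_smul' := fun c x => D.map_smul c x }
    obtain ⟨z, hz⟩ := exists_eq_modelBracket hneg D' (fun x y => by
      have h := hD x y
      refine Eq.trans (congrArg D' (modelBracket_apply x y).symm) (h.trans ?_)
      exact congrArg₂ (fun a b : LieAlg n G => a + b) (modelBracket_apply (D x) y)
        (modelBracket_apply x (D y)))
    refine ⟨z, ?_⟩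
    ext1 x
    exact (hz x).trans (modelBracket_apply z x).symm

theorem killingForm_self_eq_zero_of_ad_eq_zero {Z : LieAlg n G}
    (h : LieAlgebra.ad ℝ (LieAlg n G) Z = 0) : killingForm ℝ (LieAlg n G) Z Z = 0 := by
  rw [killingForm_apply_apply, h, LinearMap.zero_comp, map_zero]

theorem modelBracket_injective
    (hneg : ∀ X : LieAlg n G, X ≠ 0 → killingForm ℝ (LieAlg n G) X X < 0)
    {Z : EuclideanSpace ℝ (Fin n)} (hZ : modelBracket n G Z = 0) : Z = 0 := by
  by_contra h0
  have hlt := hneg Z h0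
  have had : LieAlgebra.ad ℝ (LieAlg n G) Z = 0 := by
    refine LinearMap.ext fun x => ?_
    refine (modelBracket_apply (n := n) (G := G) Z x).symm.trans ?_
    rw [hZ]
    rfl
  exact hlt.ne (killingForm_self_eq_zero_of_ad_eq_zero had)

/-- An invertible endomorphism of the bracket preserves the Killing form. -/
theorem isAut_of_bracket_of_mul_eq_one
    (hneg : ∀ X : LieAlg n G, X ≠ 0 → killingForm ℝ (LieAlg n G) X X < 0)
    {A B : EuclideanSpace ℝ (Fin n) →L[ℝ] EuclideanSpace ℝ (Fin n)}
    (hA : ∀ x y, A (modelBracket n G x y) = modelBracket n G (A x) (A y))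
    (hAB : A * B = 1) (hBA : B * A = 1) : (compactBracket hneg).IsAut A := by
  refine ⟨hA, ?_⟩
  let e : LieAlg n G ≃ₗ⁅ℝ⁆ LieAlg n G :=
    { toFun := A
      invFun := B
      map_add' := fun x y => A.map_add x y
      map_smul' := fun c x => A.map_smul c x
      map_lie' := fun {x y} => by
        exact (congrArg A (modelBracket_apply x y).symm).trans
          ((hA x y).trans (modelBracket_apply (A x) (A y)))
      left_inv := fun x => congrArg
        (fun f : EuclideanSpace ℝ (Fin n) →L[ℝ] EuclideanSpace ℝ (Fin n) => f x) hBA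
      right_inv := fun x => congrArg
        (fun f : EuclideanSpace ℝ (Fin n) →L[ℝ] EuclideanSpace ℝ (Fin n) => f x) hAB }
  intro x y
  exact congrArg (fun r : ℝ => -r) (LieAlgebra.killingForm_of_equiv_apply e x y)

theorem isAut_modelAd
    (hneg : ∀ X : LieAlg n G, X ≠ 0 → killingForm ℝ (LieAlg n G) X X < 0) (g : G) :
    (compactBracket hneg).IsAut (modelAd n g) :=
  isAut_of_bracket_of_mul_eq_one hneg (modelAd_bracket g) (modelAd_mul_modelAd_inv g)
    (modelAd_inv_mul_modelAd g)

theorem exists_modelAd_eq_exp [ConnectedSpace G]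
    (hneg : ∀ X : LieAlg n G, X ≠ 0 → killingForm ℝ (LieAlg n G) X X < 0) (g : G) :
    ∃ Y, modelAd n g = exp (modelBracket n G Y) :=
  CompactBracket.exists_eq_exp_ad_of_connected (C := compactBracket hneg) continuous_modelAd
    (isAut_modelAd hneg) modelAd_one g

/-- Local structure of the adjoint representation: it is injective near the identity, and small
exponentials lift to `G`. -/
theorem exists_lift_exp
    (hneg : ∀ X : LieAlg n G, X ≠ 0 → killingForm ℝ (LieAlg n G) X X < 0) :
    (∀ᶠ g : G in 𝓝 1, modelAd n g = 1 → g = 1) ∧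
    ∀ Z : EuclideanSpace ℝ (Fin n), ∃ ε > 0, ∃ γ : ℝ → G, γ 0 = 1 ∧
      ContinuousOn γ (Set.Ioo (-ε) ε) ∧
      ∀ t ∈ Set.Ioo (-ε) ε, modelAd n (γ t) = exp (t • modelBracket n G Z) := by
  have hG : IsTopologicalGroup G := topologicalGroup_of_lieGroup (𝓡 n) ∞
  obtain ⟨h1, h2⟩ := (compactBracket hneg).exists_lift_of_hasStrictFDerivAt
    (fun Z hZ => modelBracket_injective hneg hZ) (hasStrictFDerivAt_modelAd (n := n) (G := G))
    (fun x => isAut_modelAd hneg _) (by rw [chartOne_symm_apply_self, modelAd_one])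
    (isOpen_extChartAt_target (I := 𝓡 n) (1 : G)) (mem_extChartAt_target (I := 𝓡 n) (1 : G))
  constructor
  · have hc := (continuousAt_extChartAt (I := 𝓡 n) (1 : G)).eventually h1
    filter_upwards [hc, extChartAt_source_mem_nhds (I := 𝓡 n) (1 : G)] with g hg hgs h
    rw [(chartOne n G).left_inv hgs] at hg
    exact (chartOne n G).injOn hgs (mem_extChartAt_source (I := 𝓡 n) (1 : G)) (hg h)
  · intro Z
    obtain ⟨ε, hε, u, hu0, hcont, hu⟩ := h2 Z
    refine ⟨ε, hε, fun t => (chartOne n G).symm (u t), ?_, ?_, fun t ht => (hu t ht).2⟩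
    · change (chartOne n G).symm (u 0) = 1
      rw [hu0, chartOne_symm_apply_self]
    · exact (continuousOn_extChartAt_symm (I := 𝓡 n) (1 : G)).comp hcont fun t ht => (hu t ht).1

end AdjointRepresentation

/-! ### Powers, triviality and invariant subspaces of exponentials. -/

section ExpPowers

open NormedSpace

variable {V : Type*} [NormedAddCommGroup V] [NormedSpace ℝ V] [CompleteSpace V]

theorem exp_natCast_mul_smul (D : V →L[ℝ] V) (s : ℝ) (N : ℕ) :
    exp (((N : ℝ) * s) • D) = exp (s • D) ^ N := by
  induction N with
  | zero => simp
  | succ N ih =>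
    ext v
    rw [pow_succ, mul_apply_eq_comp, ← ih, ← exp_smul_add_apply]
    congr 3
    push_cast
    ring

/-- A one-parameter group of operators that is trivial near `0` has trivial generator. -/
theorem eq_zero_of_exp_smul_eq_one {D : V →L[ℝ] V} {ε : ℝ} (hε : 0 < ε)
    (h : ∀ t ∈ Set.Ioo (-ε) ε, exp (t • D) = 1) : D = 0 := by
  ext v
  have h1 := hasDerivAt_exp_smul_apply D v 0
  have h2 : HasDerivAt (fun t : ℝ => exp (t • D) v) 0 0 := by
    refine (hasDerivAt_const (0 : ℝ) v).congr_of_eventuallyEq ?_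
    filter_upwards [Ioo_mem_nhds (neg_lt_zero.2 hε) hε] with t ht
    rw [h t ht]
    rfl
  have h3 := h1.unique h2
  rw [zero_smul, exp_zero] at h3
  exact h3

theorem exp_apply_mem {D : V →L[ℝ] V} {S : Submodule ℝ V} [FiniteDimensional ℝ S]
    (h : ∀ x ∈ S, D x ∈ S)
    {x : V} (hx : x ∈ S) : exp D x ∈ S := by
  have : CompleteSpace S := FiniteDimensional.complete ℝ S
  have h1 := map_exp_smul_apply_of_comp_eq (D := D.restrict h) (D' := D)
    (f := S.subtypeL) (by ext v; rfl) 1 ⟨x, hx⟩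
  rw [one_smul, one_smul] at h1
  rw [show x = S.subtypeL ⟨x, hx⟩ from rfl, ← h1]
  exact Subtype.property _

end ExpPowers

/-! ### The group $K$, and consequences of effectiveness. -/

namespace CompactSymmetricPair

open Filter Topology NormedSpace

variable {n : ℕ} {G : Type*} [TopologicalSpace G]
  [ChartedSpace (EuclideanSpace ℝ (Fin n)) G] [Group G] [LieGroup (𝓡 n) ∞ G]
  [T2Space G] [CompactSpace G] [ConnectedSpace G] (P : CompactSymmetricPair n G)

/-- The Cartan involution on the model space of `𝔤`. -/
noncomputable def modelθ : EuclideanSpace ℝ (Fin n) →L[ℝ] EuclideanSpace ℝ (Fin n) := P.θ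

/-- The bracket of `𝔤` and the negative of its Killing form. -/
noncomputable abbrev bracket : CompactBracket (EuclideanSpace ℝ (Fin n)) :=
  compactBracket P.killingForm_neg

theorem modelθ_modelθ (X : EuclideanSpace ℝ (Fin n)) : P.modelθ (P.modelθ X) = X := by
  have hσ : MDifferentiable (𝓡 n) (𝓡 n) P.σ := P.contMDiff_σ.mdifferentiable (by simp)
  have h : P.σ.comp P.σ = MonoidHom.id G := by
    ext g
    exact P.σ_σ g
  have h2 := congrArg (lieDifferential n) h
  rw [lieDifferential_comp hσ hσ, lieDifferential_id] at h2
  exact congrArg (fun f : LieAlg n G →L[ℝ] LieAlg n G => f X) h2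

theorem modelθ_mul_modelθ : P.modelθ * P.modelθ = 1 :=
  ContinuousLinearMap.ext P.modelθ_modelθ

theorem modelθ_bracket (X Y : EuclideanSpace ℝ (Fin n)) :
    P.modelθ (modelBracket n G X Y) = modelBracket n G (P.modelθ X) (P.modelθ Y) :=
  (congrArg P.modelθ (modelBracket_apply (n := n) (G := G) X Y)).trans
    ((P.θ_lie X Y).trans (modelBracket_apply (n := n) (G := G) (P.θ X) (P.θ Y)).symm)

theorem isAut_modelθ : P.bracket.IsAut P.modelθ :=
  isAut_of_bracket_of_mul_eq_one P.killingForm_neg P.modelθ_bracket P.modelθ_mul_modelθ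
    P.modelθ_mul_modelθ

/-- This is the derivative at $x=1$ of $\sigma(gxg^{-1})=\sigma(g)\sigma(x)\sigma(g)^{-1}$. -/
theorem modelAd_σ_mul_modelθ (g : G) :
    modelAd n (P.σ g) * P.modelθ = P.modelθ * modelAd n g := by
  have hσ : MDifferentiable (𝓡 n) (𝓡 n) P.σ := P.contMDiff_σ.mdifferentiable (by simp)
  have h : P.σ.comp (MulAut.conj g).toMonoidHom = (MulAut.conj (P.σ g)).toMonoidHom.comp P.σ := by
    ext x
    simp
  have h2 := congrArg (lieDifferential n) h
  rw [lieDifferential_comp hσ (mdifferentiable_conj g),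
    lieDifferential_comp (mdifferentiable_conj (P.σ g)) hσ] at h2
  exact h2.symm

theorem modelAd_mul_modelθ_of_mem {k : G} (hk : k ∈ P.K) :
    modelAd n k * P.modelθ = P.modelθ * modelAd n k := by
  have := P.modelAd_σ_mul_modelθ k
  rwa [P.σ_eq_of_mem_K k hk] at this

/-- A connected set through `1` whose adjoint action commutes with `θ` is contained in `K`. -/
theorem subset_K_of_commute {C : Set G} (hC : IsPreconnected C) (h1 : (1 : G) ∈ C)
    (hcomm : ∀ c ∈ C, modelAd n c * P.modelθ = P.modelθ * modelAd n c) : C ⊆ P.K := by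
  have hG : IsTopologicalGroup G := topologicalGroup_of_lieGroup (𝓡 n) ∞
  have hσ : Continuous P.σ := P.contMDiff_σ.continuous
  -- If $\mathrm{Ad}(c)$ commutes with $\theta$, then $\mathrm{Ad}(\sigma c)=\mathrm{Ad}(c)$. So
  -- $c^{-1}\sigma(c)$ lies in the kernel of $\mathrm{Ad}$, which is discrete, and it is constantly
  -- $1$ on the connected set $C$.
  have hker : ∀ c ∈ C, modelAd n (c⁻¹ * P.σ c) = 1 := by
    intro c hc
    have h2 := (P.modelAd_σ_mul_modelθ c).trans (hcomm c hc).symm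
    have h3 : modelAd n (P.σ c) = modelAd n c := by
      have := congrArg (· * P.modelθ) h2
      simpa only [mul_assoc, P.modelθ_mul_modelθ, mul_one] using this
    rw [modelAd_mul, h3, modelAd_inv_mul_modelAd]
  have : PreconnectedSpace C := isPreconnected_iff_preconnectedSpace.1 hC
  let f : C → G := fun c => (c : G)⁻¹ * P.σ c
  have hf : Continuous f := by
    have := hσ.comp (continuous_subtype_val (p := (· ∈ C)))
    exact continuous_subtype_val.inv.mul this
  have hclopen : IsClopen {c : C | f c = 1} := by
    refine ⟨isClosed_eq hf continuous_const, isOpen_iff_mem_nhds.2 fun c hc => ?_⟩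
    have hev := (exists_lift_exp P.killingForm_neg).1
    rw [← show f c = 1 from hc] at hev
    filter_upwards [hf.continuousAt.eventually hev] with d hd
    exact (hd (hker d d.2)).trans hc
  have huniv := hclopen.eq_univ ⟨⟨1, h1⟩, by simp [f]⟩
  refine Set.Subset.trans ?_ P.connectedComponent_subset_K
  refine hC.subset_connectedComponentIn h1 fun c hc => ?_
  have : (⟨c, hc⟩ : C) ∈ {c : C | f c = 1} := huniv ▸ Set.mem_univ _
  exact (inv_mul_eq_one.1 this).symm

theorem exp_smul_mul_modelθ {Z : EuclideanSpace ℝ (Fin n)} (hZ : P.modelθ Z = Z) (t : ℝ) :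
    exp (t • modelBracket n G Z) * P.modelθ = P.modelθ * exp (t • modelBracket n G Z) := by
  have h := P.isAut_modelθ.mul_exp_ad (t • Z)
  rw [P.modelθ.map_smul, hZ, map_smul] at h
  exact h.symm

/-- Conjugates of a lift of a one-parameter group generated by an element of `𝔨`. -/
theorem conj_lift_mem_K {Z : EuclideanSpace ℝ (Fin n)} {ε : ℝ} (hε : 0 < ε) {γ : ℝ → G}
    (h0 : γ 0 = 1) (hγ : ContinuousOn γ (Set.Ioo (-ε) ε))
    (hexp : ∀ t ∈ Set.Ioo (-ε) ε, modelAd n (γ t) = exp (t • modelBracket n G Z)) (g : G)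
    (hg : P.modelθ (modelAd n g Z) = modelAd n g Z) {t : ℝ} (ht : t ∈ Set.Ioo (-ε) ε) :
    g * γ t * g⁻¹ ∈ P.K := by
  have hG : IsTopologicalGroup G := topologicalGroup_of_lieGroup (𝓡 n) ∞
  have hc : ContinuousOn (fun t => g * γ t * g⁻¹) (Set.Ioo (-ε) ε) :=
    (continuousOn_const.mul hγ).mul continuousOn_const
  refine P.subset_K_of_commute (isPreconnected_Ioo.image _ hc)
    ⟨0, ⟨neg_lt_zero.2 hε, hε⟩, by simp [h0]⟩ ?_ ⟨t, ht, rfl⟩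
  rintro _ ⟨s, hs, rfl⟩
  have h1 : modelAd n (g * γ s * g⁻¹) = exp (s • modelBracket n G (modelAd n g Z)) := by
    have h2 := (isAut_modelAd P.killingForm_neg g).mul_exp_ad (s • Z)
    rw [map_smul, map_smul, map_smul] at h2
    rw [modelAd_mul, modelAd_mul, hexp s hs]
    refine (congrArg (· * modelAd n g⁻¹) h2).trans ?_
    rw [mul_assoc, modelAd_mul_modelAd_inv, mul_one]
    rfl
  change modelAd n (g * γ s * g⁻¹) * P.modelθ = P.modelθ * modelAd n (g * γ s * g⁻¹)
  rw [h1]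
  exact P.exp_smul_mul_modelθ hg s

/-- A lift exists only for small parameters; the element for $t$ is the $N$-th power of the one for
$t/N$. -/
theorem exists_mem_K_modelAd_eq_exp {Z : EuclideanSpace ℝ (Fin n)} (hZ : P.modelθ Z = Z) (t : ℝ) :
    ∃ k ∈ P.K, modelAd n k = exp (t • modelBracket n G Z) := by
  obtain ⟨ε, hε, γ, h0, hγ, hexp⟩ := (exists_lift_exp P.killingForm_neg).2 Z
  obtain ⟨N, hN⟩ := exists_nat_gt (|t| / ε)
  have hN0 : 0 < (N : ℝ) := lt_of_le_of_lt (by positivity) hN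
  have hs : t / N ∈ Set.Ioo (-ε) ε := by
    rw [Set.mem_Ioo, ← abs_lt, abs_div, abs_of_pos hN0, div_lt_iff₀ hN0]
    rwa [div_lt_iff₀ hε, mul_comm] at hN
  have hmem := P.conj_lift_mem_K hε h0 hγ hexp 1 (by
    rw [modelAd_one]
    exact hZ) hs
  rw [one_mul, inv_one, mul_one] at hmem
  refine ⟨γ (t / N) ^ N, pow_mem hmem N, ?_⟩
  have hpow : ∀ (g : G) (m : ℕ), modelAd n (g ^ m) = modelAd n g ^ m := by
    intro g m
    induction m with
    | zero => rw [pow_zero, pow_zero, modelAd_one]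
    | succ m ih => rw [pow_succ, pow_succ, modelAd_mul, ih]
  rw [hpow, hexp _ hs, ← exp_natCast_mul_smul, mul_div_cancel₀ _ hN0.ne']

theorem exists_add_eq (Y : EuclideanSpace ℝ (Fin n)) :
    ∃ U x, P.modelθ U = U ∧ P.modelθ x = -x ∧ U + x = Y := by
  refine ⟨(2⁻¹ : ℝ) • (Y + P.modelθ Y), (2⁻¹ : ℝ) • (Y - P.modelθ Y), ?_, ?_, ?_⟩
  · rw [map_smul, map_add, modelθ_modelθ, add_comm]
  · rw [map_smul, map_sub, modelθ_modelθ, ← smul_neg, neg_sub]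
  · rw [← smul_add, add_add_sub_cancel, ← two_smul ℝ Y, smul_smul]
    norm_num

/-- For an effective pair, `𝔨` acts faithfully on `𝔭`. -/
theorem eq_zero_of_isEffective (hP : P.IsEffective) {Z : EuclideanSpace ℝ (Fin n)}
    (hZ : P.modelθ Z = Z) (hZp : ∀ x, P.modelθ x = -x → modelBracket n G Z x = 0) : Z = 0 := by
  let a : Submodule ℝ (EuclideanSpace ℝ (Fin n)) :=
    { carrier := {Z | P.modelθ Z = Z ∧ ∀ x, P.modelθ x = -x → modelBracket n G Z x = 0}
      add_mem' := fun {X Y} hX hY => ⟨by rw [map_add, hX.1, hY.1], fun x hx => by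
        rw [map_add, add_apply, hX.2 x hx, hY.2 x hx, add_zero]⟩
      zero_mem' := ⟨map_zero _, fun x _ => by rw [map_zero, zero_apply]⟩
      smul_mem' := fun c X hX => ⟨by rw [map_smul, hX.1], fun x hx => by
        rw [map_smul, smul_apply, hX.2 x hx, smul_zero]⟩ }
  -- The elements of $\mathfrak k$ acting trivially on $\mathfrak p$ form an ideal of $\mathfrak g$,
  -- so $\mathrm{Ad}(g)Z$ stays among them for every $g$.
  have hideal : ∀ Y, ∀ Z ∈ a, modelBracket n G Y Z ∈ a := by
    intro Y Z hZ
    obtain ⟨U, x, hU, hx, rfl⟩ := P.exists_add_eq Y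
    have h1 : modelBracket n G x Z = 0 :=
      (modelBracket_skew (n := n) (G := G) x Z).trans (neg_eq_zero.2 (hZ.2 x hx))
    rw [map_add, add_apply, h1, add_zero]
    refine ⟨by rw [modelθ_bracket, hU, hZ.1], fun y hy => ?_⟩
    have h2 := modelBracket_jacobi (n := n) (G := G) U Z y
    have h3 : modelBracket n G Z (modelBracket n G U y) = 0 :=
      hZ.2 _ (by rw [modelθ_bracket, hU, hy, map_neg])
    have h4 : modelBracket n G Z y = 0 := hZ.2 y hy
    have h5 : modelBracket n G U (modelBracket n G Z y) = 0 := by rw [h4, map_zero]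
    exact (add_zero _).symm.trans ((congrArg _ h3.symm).trans (h2.symm.trans h5))
  have hAd : ∀ g : G, modelAd n g Z ∈ a := by
    intro g
    obtain ⟨Y, hY⟩ := exists_modelAd_eq_exp P.killingForm_neg g
    rw [hY]
    exact exp_apply_mem (hideal Y) ⟨hZ, hZp⟩
  obtain ⟨ε, hε, γ, h0, hγ, hexp⟩ := (exists_lift_exp P.killingForm_neg).2 Z
  -- All conjugates of the lifted one-parameter arc lie in $K$, so the arc generates a normal
  -- subgroup of $G$ inside $K$, trivial by effectiveness. Thus $e^{t\,\mathrm{ad}Z}=1$ for small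
  -- $t$.
  have hN : (Subgroup.normalClosure (γ '' Set.Ioo (-ε) ε) : Subgroup G) = ⊥ := by
    refine hP _ Subgroup.normalClosure_normal ((Subgroup.closure_le _).2 fun h hh => ?_)
    obtain ⟨_, ⟨t, ht, rfl⟩, hconj⟩ := Group.mem_conjugatesOfSet_iff.1 hh
    obtain ⟨g, rfl⟩ := isConj_iff.1 hconj
    exact P.conj_lift_mem_K hε h0 hγ hexp g (hAd g).1 ht
  refine modelBracket_injective P.killingForm_neg (eq_zero_of_exp_smul_eq_one hε fun t ht => ?_)
  have h1 : γ t ∈ Subgroup.normalClosure (γ '' Set.Ioo (-ε) ε) :=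
    Subgroup.subset_normalClosure ⟨t, ht, rfl⟩
  rw [hN, Subgroup.mem_bot] at h1
  rw [← hexp t ht, h1, modelAd_one]

/-- If `-1` belongs to the image of the `s`-representation, then `θ` is inner. -/
theorem modelθ_eq_modelAd (hP : P.IsEffective) {k : G} (hk : k ∈ P.K)
    (hneg : ∀ x, P.modelθ x = -x → modelAd n k x = -x) : P.modelθ = modelAd n k := by
  have hcomm : ∀ x, modelAd n k (P.modelθ x) = P.modelθ (modelAd n k x) := fun x =>
    congrArg (fun f : EuclideanSpace ℝ (Fin n) →L[ℝ] EuclideanSpace ℝ (Fin n) => f x)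
      (P.modelAd_mul_modelθ_of_mem hk)
  ext1 Y
  obtain ⟨U, x, hU, hx, rfl⟩ := P.exists_add_eq Y
  -- Applying $\mathrm{Ad}(k)$ to $[U,y]\in\mathfrak p$ gives $-[U,y]=[\mathrm{Ad}(k)U,-y]$, so
  -- $\mathrm{Ad}(k)U-U$ acts trivially on $\mathfrak p$.
  have hfix : modelAd n k U - U = 0 := by
    refine P.eq_zero_of_isEffective hP (by rw [map_sub, ← hcomm, hU]) fun y hy => ?_
    have h1 := modelAd_bracket k U y
    rw [hneg y hy, hneg _ (by rw [modelθ_bracket, hU, hy, map_neg]), map_neg, neg_inj] at h1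
    rw [map_sub, sub_apply, ← h1, sub_self]
  rw [map_add, map_add, hU, hx, hneg x hx, sub_eq_zero.1 hfix]

end CompactSymmetricPair

/-! ### Complex structures and the orbit foliation. -/

/-- The subgroup generated by a connected set through `1` is connected. -/
theorem isConnected_closure_of_isPreconnected {M : Type*} [Group M] [TopologicalSpace M]
    [IsTopologicalGroup M] {S : Set M} (hS : IsPreconnected S) (h1 : (1 : M) ∈ S) :
    IsConnected (Subgroup.closure S : Set M) := by
  let H := Subgroup.closure S
  have hpre : IsPreconnected ((↑) ⁻¹' S : Set H) := by
    have h2 : (Subtype.val : H → M) '' (Subtype.val ⁻¹' S) = S :=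
      Set.image_preimage_eq_of_subset fun x hx => ⟨⟨x, Subgroup.subset_closure hx⟩, rfl⟩
    exact Topology.IsInducing.subtypeVal.isPreconnected_image.1 (h2.symm ▸ hS)
  -- The identity component is a subgroup and contains the generators.
  have htop : Subgroup.connectedComponentOfOne H = ⊤ := by
    rw [eq_top_iff, ← Subgroup.closure_closure_coe_preimage, Subgroup.closure_le]
    exact hpre.subset_connectedComponent h1
  have hconn : IsConnected (Set.univ : Set H) := by
    have h2 : connectedComponent (1 : H) = Set.univ :=
      congrArg (fun N : Subgroup H => (N : Set H)) htop
    rw [← h2]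
    exact isConnected_connectedComponent
  have := hconn.image ((↑) : H → M) continuous_subtype_val.continuousOn
  rwa [Set.image_univ, Subtype.range_coe] at this

namespace CompactSymmetricPair

open Filter Topology NormedSpace

variable {n : ℕ} {G : Type*} [TopologicalSpace G]
  [ChartedSpace (EuclideanSpace ℝ (Fin n)) G] [Group G] [LieGroup (𝓡 n) ∞ G]
  [T2Space G] [CompactSpace G] [ConnectedSpace G] (P : CompactSymmetricPair n G)

instance t2Space_lieAlg : T2Space (LieAlg n G) :=
  inferInstanceAs (T2Space (EuclideanSpace ℝ (Fin n)))

/-- Serves to make the units of $\mathrm{End}(\mathfrak p)$ a topological group: $\mathfrak p$ sits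
in a tangent space, and the norm is supplied by the model space. -/
theorem continuousMul_clm (W : Type*) [NormedAddCommGroup W] [NormedSpace ℝ W] :
    ContinuousMul (W →L[ℝ] W) := inferInstance

theorem continuousMul_clm_submodule {V : Type*} [NormedAddCommGroup V] [NormedSpace ℝ V]
    (S : Submodule ℝ V) : ContinuousMul (S →L[ℝ] S) := continuousMul_clm S

instance continuousMul_clm_𝔭 : ContinuousMul (P.𝔭 →L[ℝ] P.𝔭) :=
  continuousMul_clm_submodule (V := EuclideanSpace ℝ (Fin n)) P.𝔭

theorem innerP_add_left (x y z : P.𝔭) : P.innerP (x + y) z = P.innerP x z + P.innerP y z := by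
  simp only [innerP, Submodule.coe_add, map_add, LinearMap.add_apply, neg_add]

theorem innerP_smul_left (c : ℝ) (x y : P.𝔭) : P.innerP (c • x) y = c * P.innerP x y := by
  simp only [innerP, Submodule.coe_smul, map_smul, LinearMap.smul_apply, smul_eq_mul, mul_neg]

theorem innerP_comm (x y : P.𝔭) : P.innerP x y = P.innerP y x :=
  congrArg (fun r : ℝ => -r) (LieModule.traceForm_comm ℝ (LieAlg n G) (LieAlg n G) x y)

theorem innerP_add_right (x y z : P.𝔭) : P.innerP x (y + z) = P.innerP x y + P.innerP x z := by
  rw [innerP_comm, innerP_add_left, innerP_comm, P.innerP_comm z]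

theorem innerP_smul_right (c : ℝ) (x y : P.𝔭) : P.innerP x (c • y) = c * P.innerP x y := by
  rw [innerP_comm, innerP_smul_left, innerP_comm]

theorem innerP_self_pos {x : P.𝔭} (hx : x ≠ 0) : 0 < P.innerP x x := by
  have := P.killingForm_neg x (fun h => hx (Subtype.ext h))
  exact neg_pos.2 this

theorem eq_zero_of_innerP_self {x : P.𝔭} (h : P.innerP x x = 0) : x = 0 := by
  by_contra hx
  exact (P.innerP_self_pos hx).ne' h

variable {P}

theorem IsComplexStructure.apply_apply {J : P.𝔭 →ₗ[ℝ] P.𝔭} (hJ : P.IsComplexStructure J)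
    (x : P.𝔭) : J (J x) = -x := by
  have h : ∀ y, P.innerP (J (J x) + x) y = 0 := fun y => by
    rw [innerP_add_left, hJ.2, hJ.1, neg_add_cancel]
  exact eq_neg_of_add_eq_zero_left (P.eq_zero_of_innerP_self (h _))

/-- The rotation `cos t + sin t J`. -/
noncomputable def IsComplexStructure.rotation {J : P.𝔭 →ₗ[ℝ] P.𝔭} (hJ : P.IsComplexStructure J)
    (t : ℝ) : (P.𝔭 →L[ℝ] P.𝔭)ˣ :=
  have key : ∀ (c s : ℝ) (x : P.𝔭), c ^ 2 + s ^ 2 = 1 →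
      c • (c • x + (-s) • J x) + s • J (c • x + (-s) • J x) = x := fun c s x h => by
    rw [map_add, map_smul, map_smul, hJ.apply_apply]
    have : x = (c ^ 2 + s ^ 2) • x := by rw [h, one_smul]
    conv_rhs => rw [this]
    module
  { val := Real.cos t • 1 + Real.sin t • LinearMap.toContinuousLinearMap J
    inv := Real.cos t • 1 + (-Real.sin t) • LinearMap.toContinuousLinearMap J
    val_inv := ContinuousLinearMap.ext fun x => key _ _ x (by rw [Real.cos_sq_add_sin_sq])
    inv_val := ContinuousLinearMap.ext fun x => by
      have := key (Real.cos t) (-Real.sin t) x (by rw [neg_sq, Real.cos_sq_add_sin_sq])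
      rwa [neg_neg] at this }

theorem IsComplexStructure.rotation_smul {J : P.𝔭 →ₗ[ℝ] P.𝔭} (hJ : P.IsComplexStructure J)
    (t : ℝ) (x : P.𝔭) : hJ.rotation t • x = Real.cos t • x + Real.sin t • J x := rfl

theorem IsComplexStructure.continuous_rotation {J : P.𝔭 →ₗ[ℝ] P.𝔭}
    (hJ : P.IsComplexStructure J) : Continuous hJ.rotation := by
  refine Units.continuous_iff.2 ⟨?_, ?_⟩
  · change Continuous fun t : ℝ => Real.cos t • (1 : P.𝔭 →L[ℝ] P.𝔭) +
      Real.sin t • LinearMap.toContinuousLinearMap J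
    fun_prop
  · change Continuous fun t : ℝ => Real.cos t • (1 : P.𝔭 →L[ℝ] P.𝔭) +
      (-Real.sin t) • LinearMap.toContinuousLinearMap J
    fun_prop

theorem IsComplexStructure.rotation_zero {J : P.𝔭 →ₗ[ℝ] P.𝔭}
    (hJ : P.IsComplexStructure J) : hJ.rotation 0 = 1 := by
  refine Units.ext (ContinuousLinearMap.ext fun x => (hJ.rotation_smul 0 x).trans ?_)
  simp

theorem IsComplexStructure.rotation_mem {J : P.𝔭 →ₗ[ℝ] P.𝔭}
    (hJ : P.IsComplexStructure J) (t : ℝ) : hJ.rotation t ∈ P.orthogonalGroup := by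
  intro x y
  change P.innerP (Real.cos t • x + Real.sin t • J x) (Real.cos t • y + Real.sin t • J y) = _
  simp only [innerP_add_left, innerP_add_right, innerP_smul_left, innerP_smul_right, hJ.1, hJ.2]
  linear_combination (P.innerP x y) * Real.cos_sq_add_sin_sq t

/-- A rotation by a complex structure preserving the foliation preserves the orbits. -/
theorem IsComplexStructure.rotation_smul_mem_orbit {J : P.𝔭 →ₗ[ℝ] P.𝔭}
    (hJ : P.IsComplexStructure J) (hpres : P.PreservesFoliation J) (t : ℝ) (v : P.𝔭) :
    hJ.rotation t • v ∈ MulAction.orbit P.adK v := by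
  rcases eq_or_ne v 0 with rfl | hv
  · rw [smul_zero]
    exact MulAction.mem_orbit_self _
  have hpos := P.innerP_self_pos hv
  -- Leaves consist of unit vectors, so $v$ is normalised first and linearity carries the conclusion
  -- back.
  set r := Real.sqrt (P.innerP v v) with hr
  have hr0 : r ≠ 0 := (Real.sqrt_pos.2 hpos).ne'
  have hunit : P.innerP (r⁻¹ • v) (r⁻¹ • v) = 1 := by
    rw [innerP_smul_left, innerP_smul_right, ← Real.mul_self_sqrt hpos.le, ← hr]
    field_simp
  obtain ⟨k, hk⟩ := hpres _ ⟨r⁻¹ • v, hunit, rfl⟩ _ (MulAction.mem_orbit_self _) ⟨t, rfl⟩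
  refine ⟨k, ?_⟩
  have h1 : r⁻¹ • (k • v) = r⁻¹ • (hJ.rotation t • v) := by
    refine ((k.1.val.map_smul r⁻¹ v).symm.trans hk).trans ?_
    exact (((hJ.rotation t).val.map_smul r⁻¹ v))
  exact smul_right_injective _ (inv_ne_zero hr0) h1

/-- Adjoining the rotations of $J$ to $\mathrm{Ad}(K)|_{\mathfrak p}$ changes neither connectedness
nor orbits, so by maximality it adds nothing. In particular the half-turn $-1$ comes from $K$. -/
theorem isInner_of_complexStructure (hP : P.MaximalityProperty) {J : P.𝔭 →ₗ[ℝ] P.𝔭}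
    (hJ : P.IsComplexStructure J) (hpres : P.PreservesFoliation J) : P.IsInner := by
  obtain ⟨horth, hconn, -⟩ := hP.maximal.prop
  let S : Set (P.𝔭 →L[ℝ] P.𝔭)ˣ := P.adK ∪ Set.range hJ.rotation
  have hS : IsPreconnected S := by
    refine IsPreconnected.union 1 (one_mem P.adK) ⟨0, hJ.rotation_zero⟩ hconn.isPreconnected ?_
    exact isPreconnected_range hJ.continuous_rotation
  have hle : P.adK ≤ Subgroup.closure S :=
    fun k hk => Subgroup.subset_closure (Or.inl hk)
  have horbit : ∀ h ∈ Subgroup.closure S, ∀ v : P.𝔭, h • v ∈ MulAction.orbit P.adK v := by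
    intro h hh
    induction hh using Subgroup.closure_induction with
    | mem x hx =>
      intro v
      rcases hx with hx | ⟨t, rfl⟩
      · exact ⟨⟨x, hx⟩, rfl⟩
      · exact hJ.rotation_smul_mem_orbit hpres t v
    | one => intro v; rw [one_smul]; exact MulAction.mem_orbit_self v
    | mul x y _ _ hx hy =>
      intro v
      rw [mul_smul, ← MulAction.orbit_eq_iff.2 (hy v)]
      exact hx _
    | inv x _ hx =>
      intro v
      have := hx (x⁻¹ • v)
      rw [smul_inv_smul] at this
      exact MulAction.mem_orbit_symm.1 this
  have hmax := hP.maximal.2 (y := Subgroup.closure S) ⟨(Subgroup.closure_le _).2 (Set.union_subset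
    horth (Set.range_subset_iff.2 hJ.rotation_mem)), isConnected_closure_of_isPreconnected hS
      (Or.inl (one_mem P.adK)), fun v => Set.Subset.antisymm ?_ ?_⟩ hle
  · obtain ⟨k, hk⟩ := hmax (Subgroup.subset_closure (Or.inr ⟨Real.pi, rfl⟩))
    refine ⟨k, P.modelθ_eq_modelAd hP.effective k.2 fun x hx => ?_⟩
    have h1 := congrArg (fun u : (P.𝔭 →L[ℝ] P.𝔭)ˣ => ((u • (⟨x, hx⟩ : P.𝔭) : P.𝔭) : LieAlg n G)) hk
    refine h1.trans ?_
    rw [hJ.rotation_smul, Real.cos_pi, Real.sin_pi]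
    simp
    rfl
  · rintro _ ⟨h, rfl⟩
    exact horbit h h.2 v
  · rintro _ ⟨k, rfl⟩
    exact ⟨⟨k, hle k.2⟩, rfl⟩

/-- The complex structures `ad(T)|_𝔭` preserve the foliation. -/
theorem preservesFoliation_adP {T : P.𝔨} (hT : P.IsComplexStructure (P.adP T)) :
    P.PreservesFoliation (P.adP T) := by
  rintro _ ⟨u, -, rfl⟩ v hv _ ⟨t, rfl⟩
  -- As $\mathrm{ad}(T)^2=-1$ on $\mathfrak p$, the Hopf circle through $v$ is the curve
  -- $e^{t\,\mathrm{ad}T}v$, whose points are reached by elements of $K$.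
  obtain ⟨k, hk, hkt⟩ := P.exists_mem_K_modelAd_eq_exp (Z := (T : LieAlg n G)) T.2 t
  rw [← MulAction.orbit_eq_iff.2 hv]
  refine ⟨⟨P.sRep ⟨k, hk⟩, ⟨k, hk⟩, rfl⟩, Subtype.ext ?_⟩
  have h0 : modelBracket n G (T : LieAlg n G) (v : LieAlg n G) = (P.adP T v : P.𝔭).1 :=
    modelBracket_apply (n := n) (G := G) T v
  have h1 : modelBracket n G (T : LieAlg n G) (P.adP T v).1 = -(v : LieAlg n G) :=
    (modelBracket_apply (n := n) (G := G) T (P.adP T v)).trans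
      (congrArg Subtype.val (hT.apply_apply v))
  have h2 := exp_smul_apply_of_rotation h0 h1 t
  exact (congrArg (fun f : EuclideanSpace ℝ (Fin n) →L[ℝ] EuclideanSpace ℝ (Fin n) => f v.1)
    hkt).trans h2

end CompactSymmetricPair

/-! ### Real and imaginary parts in complexifications and root spaces. -/

section Complexifications

variable {V : Type*} [AddCommGroup V] [Module ℝ V]

/-- The element `a + i b` of `V^ℂ`. -/
noncomputable def complexMk (a b : V) : Complexification V := (1 : ℂ) ⊗ₜ[ℝ] a + Complex.I ⊗ₜ[ℝ] b

theorem complexMk_add (a b a' b' : V) :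
    complexMk a b + complexMk a' b' = complexMk (a + a') (b + b') := by
  simp only [complexMk, TensorProduct.tmul_add]
  abel

theorem smul_complexMk (c : ℂ) (a b : V) :
    c • complexMk a b = complexMk (c.re • a - c.im • b) (c.im • a + c.re • b) := by
  have h : ∀ (d : ℂ) (v : V), d ⊗ₜ[ℝ] v = (1 : ℂ) ⊗ₜ[ℝ] (d.re • v) + Complex.I ⊗ₜ[ℝ] (d.im • v) := by
    intro d v
    rw [← TensorProduct.smul_tmul, ← TensorProduct.smul_tmul, ← TensorProduct.add_tmul]
    congr 1
    apply Complex.ext <;> simp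
  simp only [complexMk, smul_add, TensorProduct.smul_tmul', smul_eq_mul, mul_one]
  rw [h c a, h (c * Complex.I) b]
  simp only [Complex.mul_re, Complex.mul_im, Complex.I_re, Complex.I_im, mul_zero, mul_one,
    zero_sub, add_zero, TensorProduct.tmul_add, TensorProduct.tmul_sub, neg_smul,
    TensorProduct.tmul_neg]
  abel

theorem tmul_eq_complexMk (c : ℂ) (v : V) : c ⊗ₜ[ℝ] v = complexMk (c.re • v) (c.im • v) := by
  have h : c ⊗ₜ[ℝ] v = c • complexMk v 0 := by
    simp [complexMk, TensorProduct.smul_tmul']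
  rw [h, smul_complexMk, smul_zero, smul_zero, sub_zero, add_zero]

theorem exists_eq_complexMk (z : Complexification V) : ∃ a b, z = complexMk a b := by
  induction z using TensorProduct.induction_on with
  | zero => exact ⟨0, 0, by simp [complexMk]⟩
  | tmul c v => exact ⟨_, _, tmul_eq_complexMk c v⟩
  | add x y hx hy =>
    obtain ⟨a, b, rfl⟩ := hx
    obtain ⟨a', b', rfl⟩ := hy
    exact ⟨_, _, complexMk_add a b a' b'⟩

theorem complexMk_inj {a b a' b' : V} : complexMk a b = complexMk a' b' ↔ a = a' ∧ b = b' := by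
  refine ⟨fun h => ?_, fun h => by rw [h.1, h.2]⟩
  have hre := congrArg (fun z => TensorProduct.lid ℝ V (LinearMap.rTensor V Complex.reLm z)) h
  have him := congrArg (fun z => TensorProduct.lid ℝ V (LinearMap.rTensor V Complex.imLm z)) h
  simp only [complexMk, map_add, LinearMap.rTensor_tmul, TensorProduct.lid_tmul] at hre him
  simp at hre him
  exact ⟨hre, him⟩

theorem complexMk_eq_zero {a b : V} : complexMk a b = 0 ↔ a = 0 ∧ b = 0 := by
  have : (0 : Complexification V) = complexMk 0 0 := by simp [complexMk]
  rw [this, complexMk_inj]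

theorem complexMk_mem_baseChange {S : Submodule ℝ V} {a b : V} :
    complexMk a b ∈ S.baseChange ℂ ↔ a ∈ S ∧ b ∈ S := by
  refine ⟨fun h => ?_, fun h => add_mem (Submodule.tmul_mem_baseChange_of_mem _ h.1)
    (Submodule.tmul_mem_baseChange_of_mem _ h.2)⟩
  have key : ∀ z ∈ S.baseChange ℂ, ∃ a ∈ S, ∃ b ∈ S, z = complexMk a b := by
    intro z hz
    rw [Submodule.baseChange_eq_span] at hz
    induction hz using Submodule.span_induction with
    | mem x hx =>
      obtain ⟨v, hv, rfl⟩ := hx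
      exact ⟨v, hv, 0, S.zero_mem, by simp [complexMk]⟩
    | zero => exact ⟨0, S.zero_mem, 0, S.zero_mem, by simp [complexMk]⟩
    | add x y _ _ hx hy =>
      obtain ⟨a, ha, b, hb, rfl⟩ := hx
      obtain ⟨a', ha', b', hb', rfl⟩ := hy
      exact ⟨_, S.add_mem ha ha', _, S.add_mem hb hb', complexMk_add a b a' b'⟩
    | smul c x _ hx =>
      obtain ⟨a, ha, b, hb, rfl⟩ := hx
      exact ⟨_, S.sub_mem (S.smul_mem _ ha) (S.smul_mem _ hb), _,
        S.add_mem (S.smul_mem _ ha) (S.smul_mem _ hb), smul_complexMk c a b⟩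
  obtain ⟨a', ha', b', hb', hz⟩ := key _ h
  obtain ⟨rfl, rfl⟩ := complexMk_inj.1 hz
  exact ⟨ha', hb'⟩

theorem toComplexification_smul (r : ℝ) (v : V) :
    toComplexification (r • v) = (r : ℂ) • toComplexification v := by
  rw [TensorProduct.smul_tmul', smul_eq_mul, mul_one, tmul_eq_complexMk]
  simp [complexMk]

end Complexifications

section RootSpaces

variable {L : Type*} [LieRing L] [LieAlgebra ℝ L] {𝔱 : LieSubalgebra ℝ L}

theorem mem_complexRootSpace_iff {α : Module.Dual ℂ (Complexification 𝔱)} {a b : L} :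
    complexMk a b ∈ complexRootSpace 𝔱 α ↔ ∀ H : 𝔱,
      ⁅(H : L), a⁆ = -((α (toComplexification H)).im • a) - (α (toComplexification H)).re • b ∧
      ⁅(H : L), b⁆ = (α (toComplexification H)).re • a - (α (toComplexification H)).im • b := by
  refine forall_congr' fun H => ?_
  have h1 : ⁅toComplexification (H : L), complexMk a b⁆ = complexMk ⁅(H : L), a⁆ ⁅(H : L), b⁆ := by
    simp [complexMk, lie_add]
  rw [h1, smul_complexMk, complexMk_inj]
  simp [sub_eq_add_neg]

theorem exists_mem_rootSpace_of_mem_roots {α : Module.Dual ℂ (Complexification 𝔱)}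
    (hα : α ∈ complexRoots 𝔱) :
    ∃ a b : L, (a ≠ 0 ∨ b ≠ 0) ∧ complexMk a b ∈ complexRootSpace 𝔱 α := by
  obtain ⟨z, hz, hz0⟩ := Submodule.exists_mem_ne_zero_of_ne_bot hα.2
  obtain ⟨a, b, rfl⟩ := exists_eq_complexMk z
  refine ⟨a, b, ?_, hz⟩
  by_contra! h
  exact hz0 (complexMk_eq_zero.2 h)

theorem complexRoot_ext {α β : Module.Dual ℂ (Complexification 𝔱)}
    (h : ∀ H : 𝔱, α (toComplexification H) = β (toComplexification H)) : α = β := by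
  refine LinearMap.ext fun x => ?_
  induction x using TensorProduct.induction_on with
  | zero => rw [map_zero, map_zero]
  | tmul c v =>
    have : c ⊗ₜ[ℝ] v = c • toComplexification v := by simp [TensorProduct.smul_tmul']
    rw [this, map_smul, map_smul, h]
  | add x y hx hy => rw [map_add, map_add, hx, hy]

/-- A nonzero real subspace invariant under an abelian subalgebra contains the real and imaginary
parts of a common eigenvector. -/
theorem exists_mem_complexRootSpace [FiniteDimensional ℝ L] [IsLieAbelian 𝔱] {R : Submodule ℝ L}
    (hR : R ≠ ⊥) (hinv : ∀ H ∈ 𝔱, ∀ x ∈ R, ⁅H, x⁆ ∈ R) :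
    ∃ α : Module.Dual ℂ (Complexification 𝔱), ∃ a ∈ R, ∃ b ∈ R, (a ≠ 0 ∨ b ≠ 0) ∧
      complexMk a b ∈ complexRootSpace 𝔱 α := by
  let N : LieSubmodule ℝ 𝔱 L := { R with lie_mem := fun {H x} hx => hinv H H.2 x hx }
  have hfin : FiniteDimensional ℝ N := inferInstanceAs (FiniteDimensional ℝ R)
  have hnt : Nontrivial N := (Submodule.nontrivial_iff_ne_bot (p := R)).2 hR
  have hfinC : FiniteDimensional ℂ (ℂ ⊗[ℝ] N) := inferInstance
  have hntC : Nontrivial (ℂ ⊗[ℝ] N) := by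
    obtain ⟨x, hx⟩ := exists_ne (0 : N)
    refine ⟨complexMk x 0, 0, fun h => hx (complexMk_eq_zero.1 h).1⟩
  -- Lie's theorem for the complexified abelian algebra provides a common eigenvector.
  obtain ⟨χ, hχ⟩ := LieModule.exists_nontrivial_weightSpace_of_isSolvable ℂ (ℂ ⊗[ℝ] 𝔱) (ℂ ⊗[ℝ] N)
  obtain ⟨⟨z, hz⟩, hz0⟩ := exists_ne (0 : LieModule.weightSpace (ℂ ⊗[ℝ] N) χ)
  obtain ⟨a, b, rfl⟩ := exists_eq_complexMk z
  have hz0' : complexMk a b ≠ 0 := fun h => hz0 (Subtype.ext h)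
  rw [LieModule.mem_weightSpace] at hz
  -- The factor $-i$ matches the convention $[H,X]=i\,\alpha(H)X$.
  refine ⟨-Complex.I • χ, a, a.2, b, b.2, ?_, ?_⟩
  · by_contra! h
    exact hz0' (complexMk_eq_zero.2 ⟨Subtype.ext h.1, Subtype.ext h.2⟩)
  · rw [mem_complexRootSpace_iff]
    intro H
    have h2 := hz (toComplexification H)
    have h1 : ⁅toComplexification H, complexMk a b⁆ = complexMk ⁅H, a⁆ ⁅H, b⁆ := by
      refine (lie_add (toComplexification H) ((1 : ℂ) ⊗ₜ[ℝ] a) (Complex.I ⊗ₜ[ℝ] b)).trans ?_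
      rw [LieAlgebra.ExtendScalars.bracket_tmul, LieAlgebra.ExtendScalars.bracket_tmul, one_mul,
        one_mul]
      rfl
    rw [h1, smul_complexMk, complexMk_inj] at h2
    have ha := congrArg (Subtype.val) h2.1
    have hb := congrArg (Subtype.val) h2.2
    refine ⟨ha.trans ?_, hb.trans ?_⟩
    · simp [sub_eq_add_neg]
    · simp [sub_eq_add_neg, add_comm]

end RootSpaces

theorem eq_zero_of_eq_neg_self {V : Type*} [AddCommGroup V] [Module ℝ V] {x : V} (h : x = -x) :
    x = 0 := by
  have h2 : (2 : ℝ) • x = 0 := by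
    rw [two_smul]
    nth_rewrite 1 [h]
    exact neg_add_cancel x
  exact (smul_eq_zero.1 h2).resolve_left two_ne_zero

theorem neg_smul_of_eq_one {V : Type*} [AddCommGroup V] [Module ℝ V] {r : ℝ} (h : r = 1) (x : V) :
    -(r • x) = -x := by
  rw [h, one_smul]

/-! ### Reality of roots, and rotations equal to $-1$. -/

section RealEigenvalues

open NormedSpace CompactBracket

variable {V : Type*} [NormedAddCommGroup V] [NormedSpace ℝ V]

/-- Here $r+is$ is the value of a root. Since $\mathrm{ad}(H)$ is skew for a definite form, its
eigenvalues are imaginary, which makes roots real on $\mathfrak t$. -/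
theorem CompactBracket.eq_zero_of_ad_eq (C : CompactBracket V) {H a b : V} {r s : ℝ}
    (ha : C.ad H a = -(s • a) - r • b) (hb : C.ad H b = r • a - s • b) (h : a ≠ 0 ∨ b ≠ 0) :
    s = 0 := by
  have h1 := C.form_ad H a a
  have h2 := C.form_ad H b b
  rw [ha] at h1
  rw [hb] at h2
  simp only [map_neg, map_sub, map_smul, neg_apply, smul_apply, sub_apply, smul_eq_mul] at h1 h2
  rw [C.form_symm b a] at h1 h2
  have h3 : s * (C.form a a + C.form b b) = 0 := by linarith
  refine (mul_eq_zero.1 h3).resolve_right (ne_of_gt ?_)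
  have hnonneg : ∀ x, 0 ≤ C.form x x := fun x => by
    rcases eq_or_ne x 0 with rfl | hx
    · simp
    · exact (C.form_pos x hx).le
  rcases h with h | h
  · exact add_pos_of_pos_of_nonneg (C.form_pos a h) (hnonneg b)
  · exact add_pos_of_nonneg_of_pos (hnonneg a) (C.form_pos b h)

variable [CompleteSpace V]

theorem exp_apply_snd_of_rotation_by {D : V →L[ℝ] V} {a b : V} {r : ℝ} (ha : D a = -(r • b))
    (hb : D b = r • a) : exp D b = Real.cos r • b + Real.sin r • a := by
  have h := exp_apply_of_rotation_by (D := D) (a := b) (b := -a) (r := r)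
    (by rw [hb, smul_neg, neg_neg]) (by rw [map_neg, ha, neg_neg])
  rw [h, smul_neg, sub_neg_eq_add]

/-- If a rotation takes the value `-1` somewhere, it does so on every plane with the same angle. -/
theorem exp_apply_eq_neg_of_rotation_by {D : V →L[ℝ] V} {a b a' b' : V} {r : ℝ}
    (ha : D a = -(r • b)) (hb : D b = r • a) (h : a ≠ 0 ∨ b ≠ 0) (hea : exp D a = -a)
    (heb : exp D b = -b) (ha' : D a' = -(r • b')) (hb' : D b' = r • a') :
    exp D a' = -a' ∧ exp D b' = -b' := by
  have h1 : (1 + Real.cos r) • a - Real.sin r • b = 0 := by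
    have := exp_apply_of_rotation_by ha hb
    rw [hea] at this
    rw [add_smul, one_smul, add_sub_assoc, ← this, add_neg_cancel]
  have h2 : (1 + Real.cos r) • b + Real.sin r • a = 0 := by
    have := exp_apply_snd_of_rotation_by ha hb
    rw [heb] at this
    rw [add_smul, one_smul, add_assoc, ← this, add_neg_cancel]
  -- This is the determinant of the linear system satisfied by the nonzero pair $(a,b)$; its
  -- vanishing forces $\cos r=-1$.
  have h3 : (1 + Real.cos r) ^ 2 + Real.sin r ^ 2 = 0 := by
    rcases h with h | h
    · refine (smul_eq_zero.1 ?_).resolve_right h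
      have : ((1 + Real.cos r) ^ 2 + Real.sin r ^ 2) • a =
          (1 + Real.cos r) • ((1 + Real.cos r) • a - Real.sin r • b) +
          Real.sin r • ((1 + Real.cos r) • b + Real.sin r • a) := by module
      rw [this, h1, h2, smul_zero, smul_zero, add_zero]
    · refine (smul_eq_zero.1 ?_).resolve_right h
      have : ((1 + Real.cos r) ^ 2 + Real.sin r ^ 2) • b =
          (1 + Real.cos r) • ((1 + Real.cos r) • b + Real.sin r • a) -
          Real.sin r • ((1 + Real.cos r) • a - Real.sin r • b) := by module
      rw [this, h1, h2, smul_zero, smul_zero, sub_zero]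
  have hc : Real.cos r = -1 := by
    have := Real.cos_sq_add_sin_sq r
    linarith
  have hs : Real.sin r = 0 := by
    rw [hc] at h3
    simpa using h3
  constructor
  · rw [exp_apply_of_rotation_by ha' hb', hc, hs, zero_smul, sub_zero, neg_one_smul]
  · rw [exp_apply_snd_of_rotation_by ha' hb', hc, hs, zero_smul, add_zero, neg_one_smul]

end RealEigenvalues

/-! ### Roots with respect to $\mathfrak t$, and values on noncompact roots. -/

namespace CompactSymmetricPair

section RootValue

variable {n : ℕ} {G : Type*} [TopologicalSpace G]
  [ChartedSpace (EuclideanSpace ℝ (Fin n)) G] [Group G] [LieGroup (𝓡 n) ∞ G]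
  {𝔱 : LieSubalgebra ℝ (LieAlg n G)}

open Classical in
/-- The real values of a root on `𝔱`. -/
noncomputable def rootValue (𝔱 : LieSubalgebra ℝ (LieAlg n G))
    (α : Module.Dual ℂ (Complexification 𝔱)) (H : EuclideanSpace ℝ (Fin n)) : ℝ :=
  if h : H ∈ 𝔱.toSubmodule then (α (toComplexification ⟨H, h⟩)).re else 0

theorem rootValue_of_mem {α : Module.Dual ℂ (Complexification 𝔱)} {H : LieAlg n G} (hH : H ∈ 𝔱) :
    rootValue 𝔱 α H = (α (toComplexification ⟨H, hH⟩)).re := dif_pos hH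

end RootValue

open NormedSpace CompactBracket

variable {n : ℕ} {G : Type*} [TopologicalSpace G]
  [ChartedSpace (EuclideanSpace ℝ (Fin n)) G] [Group G] [LieGroup (𝓡 n) ∞ G]
  [T2Space G] [CompactSpace G] [ConnectedSpace G] {P : CompactSymmetricPair n G}
  {𝔱 : LieSubalgebra ℝ (LieAlg n G)}

/-- A maximal abelian subalgebra of `𝔨` contains its centralizer in `𝔨`. -/
theorem IsMaximalAbelian.mem_of_lie_eq_zero (h𝔱 : P.IsMaximalAbelian 𝔱) {U : LieAlg n G}
    (hU : U ∈ P.𝔨) (h : ∀ H ∈ 𝔱, ⁅H, U⁆ = 0) : U ∈ 𝔱 := by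
  obtain ⟨hle, hab⟩ := h𝔱.prop
  have hcomm : ∀ H ∈ 𝔱, ∀ H' ∈ 𝔱, ⁅H, H'⁆ = 0 := fun H hH H' hH' =>
    congrArg Subtype.val (hab.trivial ⟨H, hH⟩ ⟨H', hH'⟩)
  let S : Submodule ℝ (LieAlg n G) := 𝔱.toSubmodule ⊔ Submodule.span ℝ {U}
  have hS : ∀ x ∈ S, ∀ y ∈ S, ⁅x, y⁆ = 0 := by
    intro x hx y hy
    obtain ⟨H, hH, u, hu, rfl⟩ := Submodule.mem_sup.1 hx
    obtain ⟨H', hH', u', hu', rfl⟩ := Submodule.mem_sup.1 hy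
    obtain ⟨c, rfl⟩ := Submodule.mem_span_singleton.1 hu
    obtain ⟨c', rfl⟩ := Submodule.mem_span_singleton.1 hu'
    have h1 : ⁅U, H'⁆ = 0 := by rw [← lie_skew, h H' hH', neg_zero]
    rw [add_lie, lie_add, lie_add, hcomm H hH H' hH', lie_smul, h H hH, smul_lie, h1, smul_lie,
      lie_smul, lie_self]
    simp
  let 𝔰 : LieSubalgebra ℝ (LieAlg n G) :=
    { S with
      lie_mem' := fun {x y} hx hy => by
        change ⁅x, y⁆ ∈ S
        rw [hS x hx y hy]
        exact S.zero_mem }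
  have hmax := h𝔱.2 (y := 𝔰) ⟨fun x hx => ?_, ⟨fun x y => Subtype.ext (hS x x.2 y y.2)⟩⟩
    (show 𝔱.toSubmodule ≤ S from le_sup_left)
  · exact hmax (show U ∈ S from Submodule.mem_sup_right (Submodule.mem_span_singleton_self U))
  · have : S ≤ P.𝔨.toSubmodule :=
      sup_le hle ((Submodule.span_singleton_le_iff_mem _ _).2 hU)
    exact this hx

/-- A subalgebra of `𝔤`, as a subspace of the model space. -/
def modelSubspace (𝔱 : LieSubalgebra ℝ (LieAlg n G)) : Submodule ℝ (EuclideanSpace ℝ (Fin n)) :=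
  𝔱.toSubmodule

theorem IsMaximalAbelian.modelBracket_eq_zero (h𝔱 : P.IsMaximalAbelian 𝔱) :
    ∀ H ∈ modelSubspace 𝔱, ∀ H' ∈ modelSubspace 𝔱, modelBracket n G H H' = 0 :=
  fun H hH H' hH' => (modelBracket_apply (n := n) (G := G) H H').trans
    (congrArg Subtype.val (h𝔱.prop.2.trivial ⟨H, hH⟩ ⟨H', hH'⟩))

theorem IsMaximalAbelian.mem_of_modelBracket_eq_zero (h𝔱 : P.IsMaximalAbelian 𝔱)
    {U : EuclideanSpace ℝ (Fin n)} (hU : P.modelθ U = U)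
    (h : ∀ H ∈ modelSubspace 𝔱, modelBracket n G H U = 0) : U ∈ modelSubspace 𝔱 :=
  h𝔱.mem_of_lie_eq_zero (U := U) hU fun H hH =>
    (modelBracket_apply (n := n) (G := G) H U).symm.trans (h H hH)

theorem IsMaximalAbelian.modelθ_apply (h𝔱 : P.IsMaximalAbelian 𝔱)
    {H : EuclideanSpace ℝ (Fin n)} (hH : H ∈ modelSubspace 𝔱) : P.modelθ H = H :=
  h𝔱.prop.1 hH

/-- If `θ` is inner, it is the exponential of an element of `𝔱`. -/
theorem IsMaximalAbelian.exists_shortest_log (h𝔱 : P.IsMaximalAbelian 𝔱) (hinner : P.IsInner) :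
    ∃ X ∈ modelSubspace 𝔱, exp (modelBracket n G X) = P.modelθ ∧
      ∀ X' ∈ modelSubspace 𝔱, exp (modelBracket n G X') = exp (modelBracket n G X) →
        modelForm n G X X ≤ modelForm n G X' X' := by
  obtain ⟨g, hg⟩ := hinner
  have hA : ∃ Y, P.modelθ = exp (P.bracket.ad Y) := by
    obtain ⟨Y, hY⟩ := exists_modelAd_eq_exp P.killingForm_neg g
    exact ⟨Y, (show P.modelθ = modelAd n g from hg).trans hY⟩
  obtain ⟨Y, hY, hcomm⟩ := CompactBracket.exists_log_commuting (C := P.bracket) hA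
    (𝔱 := modelSubspace 𝔱) (fun H hH => h𝔱.modelθ_apply hH) h𝔱.modelBracket_eq_zero
  -- Since $\theta=e^{\mathrm{ad}Y}$ fixes $Y$, the logarithm lies in $\mathfrak k$ and centralises
  -- $\mathfrak t$, hence lies in $\mathfrak t$.
  have hYθ : P.modelθ Y = Y := by rw [hY, CompactBracket.exp_ad_apply_self]
  have hYt := h𝔱.mem_of_modelBracket_eq_zero hYθ hcomm
  obtain ⟨X, hX, hXY, hmin⟩ := CompactBracket.exists_shortest_log P.bracket hYt
  exact ⟨X, hX, hXY.trans hY.symm, hmin⟩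

/-- When $\theta=e^{\mathrm{ad}X}$ with $X\in\mathfrak t$, anything commuting with $\mathfrak t$ is
fixed by $\theta$ and so lies in $\mathfrak k$. Thus $\mathfrak t$ is its own centraliser in all of
$\mathfrak g$. -/
theorem IsMaximalAbelian.mem_of_exp_eq (h𝔱 : P.IsMaximalAbelian 𝔱)
    {X : EuclideanSpace ℝ (Fin n)} (hX : X ∈ modelSubspace 𝔱)
    (hexp : exp (modelBracket n G X) = P.modelθ) {x : EuclideanSpace ℝ (Fin n)}
    (hx : ∀ H ∈ modelSubspace 𝔱, modelBracket n G H x = 0) : x ∈ modelSubspace 𝔱 := by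
  refine h𝔱.mem_of_modelBracket_eq_zero ?_ hx
  rw [← hexp]
  exact CompactBracket.exp_ad_apply_of_commute (C := P.bracket) (hx X hX)

theorem im_root_eq_zero (P : CompactSymmetricPair n G) {α : Module.Dual ℂ (Complexification 𝔱)}
    {a b : LieAlg n G}
    (hab : a ≠ 0 ∨ b ≠ 0) (h : complexMk a b ∈ complexRootSpace 𝔱 α) (H : 𝔱) :
    (α (toComplexification H)).im = 0 := by
  obtain ⟨ha, hb⟩ := mem_complexRootSpace_iff.1 h H
  exact P.bracket.eq_zero_of_ad_eq ((modelBracket_apply (H : LieAlg n G) a).trans ha)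
    ((modelBracket_apply (H : LieAlg n G) b).trans hb) hab

theorem root_apply_eq_rootValue (P : CompactSymmetricPair n G)
    {α : Module.Dual ℂ (Complexification 𝔱)} {a b : LieAlg n G}
    (hab : a ≠ 0 ∨ b ≠ 0) (h : complexMk a b ∈ complexRootSpace 𝔱 α) {H : LieAlg n G}
    (hH : H ∈ 𝔱) : α (toComplexification ⟨H, hH⟩) = (rootValue 𝔱 α H : ℂ) := by
  rw [rootValue_of_mem hH]
  exact Complex.ext rfl (im_root_eq_zero P hab h ⟨H, hH⟩)

theorem isRootPair_of_mem {α : Module.Dual ℂ (Complexification 𝔱)}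
    (hα : ∀ H : 𝔱, (α (toComplexification H)).im = 0) {a b : LieAlg n G}
    (h : complexMk a b ∈ complexRootSpace 𝔱 α) :
    CompactBracket.IsRootPair P.bracket (modelSubspace 𝔱) (rootValue 𝔱 α) a b := by
  constructor
  · intro H hH
    refine (modelBracket_apply (n := n) (G := G) H a).trans
      ((mem_complexRootSpace_iff.1 h ⟨H, hH⟩).1.trans ?_)
    rw [hα, zero_smul, neg_zero, zero_sub]
    exact congrArg (fun r : ℝ => -(r • b)) (rootValue_of_mem (n := n) (G := G) hH).symm
  · intro H hH
    refine (modelBracket_apply (n := n) (G := G) H b).trans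
      ((mem_complexRootSpace_iff.1 h ⟨H, hH⟩).2.trans ?_)
    rw [hα, zero_smul, sub_zero]
    exact congrArg (fun r : ℝ => r • a) (rootValue_of_mem (n := n) (G := G) hH).symm

/-- Invariance of the Killing form already makes $\mathrm{ad}(T)|_{\mathfrak p}$ skew; for a skew
map, orthogonality means square $-1$. -/
theorem isComplexStructure_adP_iff {T : P.𝔨} : P.IsComplexStructure (P.adP T) ↔
    ∀ x : LieAlg n G, x ∈ P.𝔭 → ⁅(T : LieAlg n G), ⁅(T : LieAlg n G), x⁆⁆ = -x := by
  have hskew : ∀ x y, P.innerP (P.adP T x) y = -P.innerP x (P.adP T y) := fun x y => by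
    change -killingForm ℝ (LieAlg n G) ⁅(T : LieAlg n G), (x : LieAlg n G)⁆ y =
      - -killingForm ℝ (LieAlg n G) x ⁅(T : LieAlg n G), (y : LieAlg n G)⁆
    rw [LieModule.traceForm_apply_lie_apply']
  refine ⟨fun h x hx => congrArg Subtype.val (h.apply_apply ⟨x, hx⟩), fun h => ⟨fun x y => ?_,
    hskew⟩⟩
  have h1 : P.adP T (P.adP T y) = -y := Subtype.ext (h y y.2)
  rw [hskew, h1, ← neg_one_smul ℝ y, innerP_smul_right]
  ring

theorem lie_lie_of_isRootPair {C : CompactBracket (EuclideanSpace ℝ (Fin n))}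
    {𝔰 : Submodule ℝ (EuclideanSpace ℝ (Fin n))} {f : EuclideanSpace ℝ (Fin n) → ℝ}
    {a b T : EuclideanSpace ℝ (Fin n)} (h : CompactBracket.IsRootPair C 𝔰 f a b) (hT : T ∈ 𝔰) :
    C.ad T (C.ad T a) = -(f T ^ 2 • a) ∧ C.ad T (C.ad T b) = -(f T ^ 2 • b) := by
  constructor
  · rw [h.ad_fst T hT, map_neg, map_smul, h.ad_snd T hT, smul_smul, sq]
  · rw [h.ad_snd T hT, map_smul, h.ad_fst T hT, smul_neg, smul_smul, sq]

theorem ad_eq_zero_of_isRootPair {C : CompactBracket (EuclideanSpace ℝ (Fin n))}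
    {𝔰 : Submodule ℝ (EuclideanSpace ℝ (Fin n))} {f : EuclideanSpace ℝ (Fin n) → ℝ}
    {a b H : EuclideanSpace ℝ (Fin n)} (h : CompactBracket.IsRootPair C 𝔰 f a b) (hH : H ∈ 𝔰)
    (h0 : f H = 0) : C.ad H a = 0 ∧ C.ad H b = 0 :=
  ⟨by rw [h.ad_fst H hH, h0, zero_smul, neg_zero], by rw [h.ad_snd H hH, h0, zero_smul]⟩

/-- Complex structures `ad(T)|_𝔭` take the values `±1` on noncompact roots. -/
theorem root_apply_eq_one_or_of_isComplexStructure {T : LieAlg n G} (hT : T ∈ 𝔱)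
    (hJ : ∀ x : LieAlg n G, x ∈ P.𝔭 → ⁅T, ⁅T, x⁆⁆ = -x) {α : Module.Dual ℂ (Complexification 𝔱)}
    (hα : P.IsNoncompactRoot 𝔱 α) :
    α (toComplexification ⟨T, hT⟩) = 1 ∨ α (toComplexification ⟨T, hT⟩) = -1 := by
  obtain ⟨a, b, hab, h⟩ := exists_mem_rootSpace_of_mem_roots hα.1
  obtain ⟨ha, hb⟩ := complexMk_mem_baseChange.1 (hα.2 h)
  rw [root_apply_eq_rootValue P hab h hT]
  have hpair := isRootPair_of_mem (P := P) (im_root_eq_zero P hab h) h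
  obtain ⟨h1, h2⟩ := lie_lie_of_isRootPair hpair hT
  have key : ∀ x : EuclideanSpace ℝ (Fin n), x ∈ P.𝔭 → x ≠ 0 →
      modelBracket n G T (modelBracket n G T x) = -(rootValue 𝔱 α T ^ 2 • x) →
      rootValue 𝔱 α T ^ 2 = 1 := by
    intro x hx hx0 h
    have h3 : modelBracket n G T (modelBracket n G T x) = -x :=
      ((congrArg (modelBracket n G T) (modelBracket_apply (n := n) (G := G) T x)).trans
        (modelBracket_apply (n := n) (G := G) T ⁅T, x⁆)).trans (hJ x hx)
    rw [h3, neg_inj] at h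
    refine sub_eq_zero.1 ((smul_eq_zero.1 (?_ : (rootValue 𝔱 α T ^ 2 - 1) • x = 0)).resolve_right
      hx0)
    rw [sub_smul, ← h, one_smul, sub_self]
  have h4 : rootValue 𝔱 α T ^ 2 = 1 := by
    rcases hab with hab | hab
    · exact key a ha hab h1
    · exact key b hb hab h2
  rcases sq_eq_one_iff.1 h4 with h5 | h5
  · left; rw [h5]; simp
  · right; rw [h5]; simp

/-- A root with a root vector in `𝔭^ℂ` is noncompact, if `θ` is inner. -/
theorem IsMaximalAbelian.isNoncompactRoot (h𝔱 : P.IsMaximalAbelian 𝔱) (hinner : P.IsInner)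
    {α : Module.Dual ℂ (Complexification 𝔱)} {a b : LieAlg n G}
    (hab : a ≠ 0 ∨ b ≠ 0) (h : complexMk a b ∈ complexRootSpace 𝔱 α) (ha : a ∈ P.𝔭)
    (hb : b ∈ P.𝔭) : P.IsNoncompactRoot 𝔱 α := by
  obtain ⟨X, hX, hexp, -⟩ := h𝔱.exists_shortest_log hinner
  have him := im_root_eq_zero P hab h
  have hpair := isRootPair_of_mem (P := P) him h
  refine ⟨⟨?_, fun hbot => ?_⟩, fun z hz => ?_⟩
  -- If $\alpha$ were zero, $a$ and $b$ would centralise $\mathfrak t$, so they would lie in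
  -- $\mathfrak t\cap\mathfrak p=0$.
  · rintro rfl
    have h0 : ∀ H ∈ modelSubspace 𝔱, rootValue 𝔱 (0 : Module.Dual ℂ (Complexification 𝔱)) H = 0 :=
      fun H hH => (rootValue_of_mem (n := n) (G := G) hH).trans rfl
    have key : ∀ x : EuclideanSpace ℝ (Fin n), x ∈ P.𝔭 →
        (∀ H ∈ modelSubspace 𝔱, modelBracket n G H x = 0) → x = 0 := by
      intro x hx hH
      have h1 := h𝔱.modelθ_apply (h𝔱.mem_of_exp_eq hX hexp hH)
      have h2 : P.modelθ x = -x := hx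
      exact eq_zero_of_eq_neg_self (h1.symm.trans h2)
    rcases hab with hab | hab
    · exact hab (key a ha fun H hH => (ad_eq_zero_of_isRootPair hpair hH (h0 H hH)).1)
    · exact hab (key b hb fun H hH => (ad_eq_zero_of_isRootPair hpair hH (h0 H hH)).2)
  · rw [hbot, Submodule.mem_bot, complexMk_eq_zero] at h
    exact hab.elim (fun k => k h.1) (fun k => k h.2)
  · obtain ⟨a', b', rfl⟩ := exists_eq_complexMk z
    have hpair' := isRootPair_of_mem (P := P) him hz
    have hea : exp (modelBracket n G X) a = -a := by
      rw [hexp]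
      exact ha
    have heb : exp (modelBracket n G X) b = -b := by
      rw [hexp]
      exact hb
    -- On all of $\mathfrak g_\alpha$ the map $\theta=e^{\mathrm{ad}X}$ rotates by the same angle
    -- $\alpha(X)$; it is $-1$ on one root vector, hence on all.
    have := exp_apply_eq_neg_of_rotation_by (hpair.ad_fst X hX) (hpair.ad_snd X hX) hab hea heb
      (hpair'.ad_fst X hX) (hpair'.ad_snd X hX)
    have h3 : P.modelθ a' = -a' ∧ P.modelθ b' = -b' := by
      rw [← hexp]
      exact this
    exact complexMk_mem_baseChange.2 h3

/-- The operator $D=\mathrm{ad}(T)^2+1$ is symmetric, so it is injective on its image $R=D\mathfrak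
p$. If $R\ne0$, this $\mathfrak t$-invariant subspace contains the parts of a root vector; its root
is noncompact, so $\alpha(T)=\pm1$ and $D$ kills it, a contradiction. -/
theorem IsMaximalAbelian.lie_lie_eq_neg (h𝔱 : P.IsMaximalAbelian 𝔱) (hinner : P.IsInner)
    {T : LieAlg n G} (hT : T ∈ 𝔱)
    (hα : ∀ α : Module.Dual ℂ (Complexification 𝔱), P.IsNoncompactRoot 𝔱 α →
      α (toComplexification ⟨T, hT⟩) = 1 ∨ α (toComplexification ⟨T, hT⟩) = -1)
    (x : LieAlg n G) (hx : x ∈ P.𝔭) : ⁅T, ⁅T, x⁆⁆ = -x := by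
  let D : LieAlg n G →ₗ[ℝ] LieAlg n G := LieAlgebra.ad ℝ (LieAlg n G) T ∘ₗ
    LieAlgebra.ad ℝ (LieAlg n G) T + LinearMap.id
  have hD : ∀ y, D y = ⁅T, ⁅T, y⁆⁆ + y := fun _ => rfl
  have hT𝔨 : T ∈ P.𝔨 := h𝔱.prop.1 hT
  let R : Submodule ℝ (LieAlg n G) := P.𝔭.map D
  have hR𝔭 : R ≤ P.𝔭 := by
    rintro _ ⟨y, hy, rfl⟩
    exact P.𝔭.add_mem (P.lie_mem_𝔭 hT𝔨 (P.lie_mem_𝔭 hT𝔨 hy)) hy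
  have hsymm : ∀ y z, killingForm ℝ (LieAlg n G) (D y) z = killingForm ℝ (LieAlg n G) y (D z) := by
    intro y z
    rw [hD, hD, map_add, map_add, LinearMap.add_apply, LieModule.traceForm_apply_lie_apply',
      LieModule.traceForm_apply_lie_apply', neg_neg]
  have hker : ∀ y ∈ R, D y = 0 → y = 0 := by
    rintro _ ⟨y, -, rfl⟩ h
    by_contra h0
    refine (P.killingForm_neg _ h0).ne ?_
    have := hsymm y (D y)
    rw [h, map_zero] at this
    exact this
  by_contra hne
  have hRne : R ≠ ⊥ := fun hbot => by
    have : D x ∈ R := ⟨x, hx, rfl⟩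
    rw [hbot, Submodule.mem_bot, hD] at this
    exact hne (eq_neg_of_add_eq_zero_left this)
  have := h𝔱.prop.2
  obtain ⟨α, a, ha, b, hb, hab, h⟩ := exists_mem_complexRootSpace (𝔱 := 𝔱) hRne (by
    rintro H hH _ ⟨y, hy, rfl⟩
    refine ⟨⁅H, y⁆, P.lie_mem_𝔭 (h𝔱.prop.1 hH) hy, ?_⟩
    have hTH : ⁅T, H⁆ = 0 := congrArg Subtype.val (h𝔱.prop.2.trivial ⟨T, hT⟩ ⟨H, hH⟩)
    have hc : ∀ z : LieAlg n G, ⁅T, ⁅H, z⁆⁆ = ⁅H, ⁅T, z⁆⁆ := fun z => by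
      rw [leibniz_lie, hTH, zero_lie, zero_add]
    rw [hD, hD, lie_add, hc, hc])
  have hval := hα α (h𝔱.isNoncompactRoot hinner hab h (hR𝔭 ha) (hR𝔭 hb))
  rw [root_apply_eq_rootValue P hab h hT] at hval
  have hsq : rootValue 𝔱 α T ^ 2 = 1 := by
    have : ((rootValue 𝔱 α T : ℂ)) ^ 2 = 1 := by
      rcases hval with h | h <;> rw [h] <;> norm_num
    exact_mod_cast this
  have hpair := isRootPair_of_mem (P := P) (im_root_eq_zero P hab h) h
  obtain ⟨h1, h2⟩ := lie_lie_of_isRootPair hpair hT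
  replace h1 := h1.trans (neg_smul_of_eq_one hsq _)
  replace h2 := h2.trans (neg_smul_of_eq_one hsq _)
  have key : ∀ y : LieAlg n G, modelBracket n G T (modelBracket n G T y) = -y → D y = 0 := by
    intro y hy
    have h3 : ⁅T, ⁅T, y⁆⁆ = -y :=
      ((congrArg (modelBracket n G T) (modelBracket_apply (n := n) (G := G) T y)).trans
        (modelBracket_apply (n := n) (G := G) T ⁅T, y⁆)).symm.trans hy
    rw [hD, h3, neg_add_cancel]
  exact hab.elim (fun k => k (hker a ha (key a h1))) (fun k => k (hker b hb (key b h2)))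

/-- If `θ` is inner, some element of `𝔱` takes the values `±1` on all noncompact roots. -/
theorem IsMaximalAbelian.exists_root_apply_eq_one_or (h𝔱 : P.IsMaximalAbelian 𝔱)
    (hinner : P.IsInner) : ∃ (T : LieAlg n G) (hT : T ∈ 𝔱),
      ∀ α : Module.Dual ℂ (Complexification 𝔱), P.IsNoncompactRoot 𝔱 α →
        α (toComplexification ⟨T, hT⟩) = 1 ∨ α (toComplexification ⟨T, hT⟩) = -1 := by
  obtain ⟨X, hX, hexp, hmin⟩ := h𝔱.exists_shortest_log hinner
  -- The witness is $T=X/\pi$, because noncompact roots take the values $\pm\pi$ on the shortest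
  -- logarithm $X$.
  have hmem : Real.pi⁻¹ • X ∈ modelSubspace 𝔱 := (modelSubspace 𝔱).smul_mem _ hX
  refine ⟨Real.pi⁻¹ • X, hmem, fun α hα => ?_⟩
  obtain ⟨a, b, hab, h⟩ := exists_mem_rootSpace_of_mem_roots hα.1
  obtain ⟨ha, hb⟩ := complexMk_mem_baseChange.1 (hα.2 h)
  have hpair := isRootPair_of_mem (P := P) (im_root_eq_zero P hab h) h
  obtain ⟨H, hH⟩ : ∃ H : 𝔱, α (toComplexification H) ≠ 0 := by
    by_contra! h0
    exact hα.1.1 (complexRoot_ext h0)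
  have hH0 : rootValue 𝔱 α (H : LieAlg n G) ≠ 0 := fun h0 => hH <| by
    have := root_apply_eq_rootValue P hab h H.2
    rw [h0] at this
    exact this
  have ha0 : a ≠ 0 := by
    rintro rfl
    refine hab.elim (fun k => k rfl) fun k => k ?_
    have h1 := hpair.ad_fst H.1 H.2
    rw [show P.bracket.ad H.1 (0 : LieAlg n G) = 0 from map_zero _] at h1
    exact (smul_eq_zero.1 (neg_eq_zero.1 h1.symm)).resolve_left hH0
  have hval := hpair.eq_pi_or_eq_neg_pi ha0 H.2 hH0 h𝔱.modelBracket_eq_zero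
    (fun x hx => h𝔱.mem_of_exp_eq hX hexp hx) hX hmin (by
      refine (congrArg (fun f : EuclideanSpace ℝ (Fin n) →L[ℝ] EuclideanSpace ℝ (Fin n) => f a)
        hexp).trans ha)
  have hαX : α (toComplexification ⟨Real.pi⁻¹ • X, hmem⟩)
      = ((Real.pi⁻¹ : ℝ) : ℂ) • α (toComplexification ⟨X, hX⟩) :=
    (congrArg α (toComplexification_smul Real.pi⁻¹ (⟨X, hX⟩ : 𝔱))).trans (map_smul α _ _)
  rw [hαX, root_apply_eq_rootValue P hab h hX]
  rcases hval with hv | hv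
  · left
    rw [hv]
    simp [Real.pi_ne_zero]
  · right
    rw [hv]
    simp [Real.pi_ne_zero]

/-- Roots are real on $\mathfrak t$, so the conjugation $a+ib\mapsto a-ib$ exchanges $\mathfrak
g_{-\alpha}$ and $\mathfrak g_\alpha$ and preserves $\mathfrak p^{\mathbb C}$. -/
theorem IsNoncompactRoot.neg {α : Module.Dual ℂ (Complexification 𝔱)}
    (hα : P.IsNoncompactRoot 𝔱 α) (hneg : -α ∈ complexRoots 𝔱) : P.IsNoncompactRoot 𝔱 (-α) := by
  refine ⟨hneg, fun z hz => ?_⟩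
  obtain ⟨a, b, rfl⟩ := exists_eq_complexMk z
  by_cases hab : a = 0 ∧ b = 0
  · rw [complexMk_eq_zero.2 hab]
    exact zero_mem _
  have him := im_root_eq_zero P (not_and_or.1 hab) hz
  have h := mem_complexRootSpace_iff.1 hz
  have hconj : complexMk a (-b) ∈ complexRootSpace 𝔱 α := by
    refine mem_complexRootSpace_iff.2 fun H => ?_
    obtain ⟨h1, h2⟩ := h H
    have h3 := him H
    simp only [LinearMap.neg_apply, Complex.neg_im, Complex.neg_re, neg_eq_zero] at h1 h2 h3
    rw [lie_neg, h1, h2, h3]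
    simp
  obtain ⟨h1, h2⟩ := complexMk_mem_baseChange.1 (hα.2 hconj)
  exact complexMk_mem_baseChange.2 ⟨h1, by simpa using h2⟩

theorem forall_noncompactRoot_iff_of_isPositiveSystem {T : 𝔱}
    {Δp : Set (Module.Dual ℂ (Complexification 𝔱))} (hΔ : IsPositiveSystem 𝔱 Δp) :
    (∀ α : Module.Dual ℂ (Complexification 𝔱), P.IsNoncompactRoot 𝔱 α →
      α (toComplexification T) = 1 ∨ α (toComplexification T) = -1) ↔
    ∀ α ∈ Δp, P.IsNoncompactRoot 𝔱 α →
      α (toComplexification T) = 1 ∨ α (toComplexification T) = -1 := by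
  refine ⟨fun h α _ hα => h α hα, fun h α hα => ?_⟩
  rcases hΔ.2.1 α hα.1 with ⟨hmem, -⟩ | ⟨hmem, -⟩
  · exact h α hmem hα
  · have := h _ hmem (hα.neg (hΔ.1 hmem))
    simp only [LinearMap.neg_apply, neg_eq_iff_eq_neg, neg_neg] at this
    exact this.symm

end CompactSymmetricPair

/-! ### The theorem. -/

theorem mainTheorem9 {n : ℕ} {G : Type*} [TopologicalSpace G]
    [ChartedSpace (EuclideanSpace ℝ (Fin n)) G] [Group G] [LieGroup (𝓡 n) ∞ G]
    [T2Space G] [CompactSpace G] [ConnectedSpace G]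
    (P : CompactSymmetricPair n G) (hP : P.MaximalityProperty)
    (𝔱 : LieSubalgebra ℝ (LieAlg n G)) (h𝔱 : P.IsMaximalAbelian 𝔱) :
    ((∃ J : P.𝔭 →ₗ[ℝ] P.𝔭, P.IsComplexStructure J ∧ P.PreservesFoliation J) ↔ P.IsInner) ∧
    (P.IsInner → ∀ (T : LieAlg n G) (hT : T ∈ 𝔱),
      ((P.IsComplexStructure (P.adP ⟨T, h𝔱.prop.1 hT⟩) ∧
          P.PreservesFoliation (P.adP ⟨T, h𝔱.prop.1 hT⟩)) ↔
        ∀ α : Module.Dual ℂ (Complexification 𝔱), P.IsNoncompactRoot 𝔱 α →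
          α (toComplexification ⟨T, hT⟩) = 1 ∨ α (toComplexification ⟨T, hT⟩) = -1) ∧
      ∀ Δp : Set (Module.Dual ℂ (Complexification 𝔱)), IsPositiveSystem 𝔱 Δp →
        ((P.IsComplexStructure (P.adP ⟨T, h𝔱.prop.1 hT⟩) ∧
            P.PreservesFoliation (P.adP ⟨T, h𝔱.prop.1 hT⟩)) ↔
          ∀ α ∈ Δp, P.IsNoncompactRoot 𝔱 α →
            α (toComplexification ⟨T, hT⟩) = 1 ∨ α (toComplexification ⟨T, hT⟩) = -1)) := by
  have key : P.IsInner → ∀ (T : LieAlg n G) (hT : T ∈ 𝔱),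
      (P.IsComplexStructure (P.adP ⟨T, h𝔱.prop.1 hT⟩) ∧
          P.PreservesFoliation (P.adP ⟨T, h𝔱.prop.1 hT⟩)) ↔
        ∀ α : Module.Dual ℂ (Complexification 𝔱), P.IsNoncompactRoot 𝔱 α →
          α (toComplexification ⟨T, hT⟩) = 1 ∨ α (toComplexification ⟨T, hT⟩) = -1 := by
    intro hinner T hT
    have hiff := CompactSymmetricPair.isComplexStructure_adP_iff (P := P) (T := ⟨T, h𝔱.prop.1 hT⟩)
    refine ⟨fun h α hα => CompactSymmetricPair.root_apply_eq_one_or_of_isComplexStructure hT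
      (hiff.1 h.1) hα, fun h => ?_⟩
    have hJ := hiff.2 (h𝔱.lie_lie_eq_neg hinner hT h)
    exact ⟨hJ, CompactSymmetricPair.preservesFoliation_adP hJ⟩
  refine ⟨⟨fun ⟨J, hJ, hpres⟩ => CompactSymmetricPair.isInner_of_complexStructure hP hJ hpres,
    fun hinner => ?_⟩, fun hinner T hT => ⟨key hinner T hT, fun Δp hΔ => ?_⟩⟩
  · obtain ⟨T, hT, hα⟩ := h𝔱.exists_root_apply_eq_one_or hinner
    exact ⟨_, (key hinner T hT).2 hα⟩
  · exact (key hinner T hT).trans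
      (CompactSymmetricPair.forall_noncompactRoot_iff_of_isPositiveSystem (T := ⟨T, hT⟩) hΔ)
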